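/- Let $\mathcal{F}$ be a Frobenius category, that is, an additive category with a Quillen exact structure that has enough projectives and enough injectives (relative to the conflations) and in which the projective objects coincide with the injective objects. Let $\mathcal{P}$ be the full subcategory of projective-injective objects, and let $\mathsf{K}(\mathcal{P})$ be the homotopy category of complexes over $\mathcal{P}$. Call a complex $X$ over $\mathcal{P}$ acyclic in $\mathcal{F}$ if for every $i\in\mathbb{Z}$ there are conflations $Z^i\to X^i\to Z^{i+1}$ of $\mathcal{F}$ such that $d_X^i$ is the composite $X^i\to Z^{i+1}\to X^{i+1}$. Let $\mathsf{K}^{\infty,\mathrm{b}}(\mathcal{P},\mathcal{F})$ be the full subcategory of $\mathsf{K}(\mathcal{P})$ of the objects isomorphic to a complex $X$ for which there are integers $m\le n$ and complexes $Y,Y'$ over $\mathcal{P}$, acyclic in $\mathcal{F}$, such that the brutal truncations satisfy $\tau_{\le m}X\cong\tau_{\le m}Y$ and $\tau_{\ge n}X\cong\tau_{\ge n}Y'$. Let $\mathsf{K}^{\mathrm{b}}(\mathcal{P})\subseteq\mathsf{K}(\mathcal{P})$ be the full subcategory of the objects isomorphic to bounded complexes. Let $\mathsf{Mor}^{\mathrm{e}}(\mathcal{F})$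 be the category whose objects are the admissible epimorphisms $X\to Y$ of $\mathcal{F}$ and whose morphisms are the commutative squares, with the sequences that are conflations of $\mathcal{F}$ both on sources and on targets as conflations. Then $\mathsf{Mor}^{\mathrm{e}}(\mathcal{F})$ is a Frobenius category whose projective-injective objects are exactly the admissible epimorphisms $X\to Y$ with $X,Y\in\mathcal{P}$; the subcategory $\mathsf{K}^{\infty,\mathrm{b}}(\mathcal{P},\mathcal{F})$ of $\mathsf{K}(\mathcal{P})$ is triangulated; and the stable category $\underline{\mathsf{Mor}}^{\mathrm{e}}(\mathcal{F})$ of $\mathsf{Mor}^{\mathrm{e}}(\mathcal{F})$ modulo its projective-injective objects is triangle equivalent to the Verdier quotient $$(\mathsf{K}^{\infty,\mathrm{b}}/\mathsf{K}^{\mathrm{b}})(\mathcal{P},\mathcal{F})=\mathsf{K}^{\infty,\mathrm{b}}(\mathcal{P},\mathcal{F})/\mathsf{K}^{\mathrm{b}}(\mathcal{P}).$$ -/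

import Mathlib

open CategoryTheory CategoryTheory.Limits CategoryTheory.Pretriangulated ZeroObject

universe v u v' u'

set_option linter.unusedSectionVars false

noncomputable section

namespace ExactCat

/-! ### Exact categories and Frobenius categories -/

section Exact

variable {C : Type u} [Category.{v} C] [Preadditive C]

/-- `i` is an admissible monomorphism (inflation): the first map of a conflation. -/
def AdmissibleMono (S : ObjectProperty (ShortComplex C)) : MorphismProperty C :=
  fun _ Y i => ∃ (Z : C) (p : Y ⟶ Z) (w : i ≫ p = 0), S (ShortComplex.mk i p w)

/-- `p` is an admissible epimorphism (deflation): the second map of a conflation. -/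
def AdmissibleEpi (S : ObjectProperty (ShortComplex C)) : MorphismProperty C :=
  fun Y _ p => ∃ (X : C) (i : X ⟶ Y) (w : i ≫ p = 0), S (ShortComplex.mk i p w)

/-- The class `S` of short complexes (the conflations, or admissible short exact sequences)
is an exact structure, in the sense of Quillen, on the additive category `C`. -/
class IsExactStructure [HasZeroObject C] [HasBinaryBiproducts C]
    (S : ObjectProperty (ShortComplex C)) : Prop where
  of_iso : ∀ {T T' : ShortComplex C}, (T ≅ T') → S T → S T'
  kernel : ∀ T : ShortComplex C, S T → Nonempty (IsLimit (KernelFork.ofι T.f T.zero))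
  cokernel : ∀ T : ShortComplex C, S T → Nonempty (IsColimit (CokernelCofork.ofπ T.g T.zero))
  id_mono : ∀ X : C, AdmissibleMono S (𝟙 X)
  id_epi : ∀ X : C, AdmissibleEpi S (𝟙 X)
  comp_mono : ∀ {X Y Z : C} (i : X ⟶ Y) (j : Y ⟶ Z),
    AdmissibleMono S i → AdmissibleMono S j → AdmissibleMono S (i ≫ j)
  comp_epi : ∀ {X Y Z : C} (p : X ⟶ Y) (q : Y ⟶ Z),
    AdmissibleEpi S p → AdmissibleEpi S q → AdmissibleEpi S (p ≫ q)
  pushout : ∀ {X Y X' : C} (i : X ⟶ Y) (f : X ⟶ X'), AdmissibleMono S i →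
    ∃ (Y' : C) (f' : Y ⟶ Y') (i' : X' ⟶ Y'), IsPushout i f f' i' ∧ AdmissibleMono S i'
  pullback : ∀ {Y Z Z' : C} (p : Y ⟶ Z) (f : Z' ⟶ Z), AdmissibleEpi S p →
    ∃ (Y' : C) (f' : Y' ⟶ Y) (p' : Y' ⟶ Z'), IsPullback f' p' p f ∧ AdmissibleEpi S p'

/-- The projective objects relative to the conflations `S`. -/
def projectives (S : ObjectProperty (ShortComplex C)) : ObjectProperty C :=
  fun P => ∀ T : ShortComplex C, S T → ∀ f : P ⟶ T.X₃, ∃ g : P ⟶ T.X₂, g ≫ T.g = f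

/-- The injective objects relative to the conflations `S`. -/
def injectives (S : ObjectProperty (ShortComplex C)) : ObjectProperty C :=
  fun I => ∀ T : ShortComplex C, S T → ∀ f : T.X₁ ⟶ I, ∃ g : T.X₂ ⟶ I, T.f ≫ g = f

/-- `(C, S)` is a Frobenius category: an exact category with enough projectives and enough
injectives, in which the projectives coincide with the injectives. Its full subcategory of
projective-injective objects is given by `projectives S`. -/
class IsFrobenius [HasZeroObject C] [HasBinaryBiproducts C]
    (S : ObjectProperty (ShortComplex C)) : Prop extends IsExactStructure S where
  projectives_eq_injectives : projectives S = injectives S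
  enough_projectives : ∀ X : C, ∃ (K P : C) (i : K ⟶ P) (p : P ⟶ X) (w : i ≫ p = 0),
    projectives S P ∧ S (ShortComplex.mk i p w)
  enough_injectives : ∀ X : C, ∃ (I Z : C) (i : X ⟶ I) (p : I ⟶ Z) (w : i ≫ p = 0),
    injectives S I ∧ S (ShortComplex.mk i p w)

lemma projectives_biprod [HasBinaryBiproducts C] (S : ObjectProperty (ShortComplex C)) {P Q : C}
    (hP : projectives S P) (hQ : projectives S Q) : projectives S (P ⊞ Q) := by
  intro T hT f
  obtain ⟨a, ha⟩ := hP T hT (biprod.inl ≫ f)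
  obtain ⟨b, hb⟩ := hQ T hT (biprod.inr ≫ f)
  refine ⟨biprod.desc a b, ?_⟩
  ext <;> simp [ha, hb]

lemma projectives_of_iso (S : ObjectProperty (ShortComplex C)) {P Q : C} (e : P ≅ Q)
    (hP : projectives S P) : projectives S Q := by
  intro T hT f
  obtain ⟨a, ha⟩ := hP T hT (e.hom ≫ f)
  exact ⟨e.inv ≫ a, by simp [ha]⟩

instance (S : ObjectProperty (ShortComplex C)) : (projectives S).IsClosedUnderIsomorphisms :=
  ⟨fun e h => projectives_of_iso S e h⟩

instance [HasZeroObject C] (S : ObjectProperty (ShortComplex C)) :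
    (projectives S).ContainsZero :=
  ⟨⟨_, isZero_zero C, fun _ _ _ => ⟨0, (isZero_zero C).eq_of_src _ _⟩⟩⟩

instance [HasBinaryBiproducts C] (S : ObjectProperty (ShortComplex C)) :
    HasBinaryBiproducts (projectives S).FullSubcategory where
  has_binary_biproduct P Q := HasBinaryBiproduct.mk
    { bicone :=
        { pt := ⟨P.obj ⊞ Q.obj, projectives_biprod S P.property Q.property⟩
          fst := ObjectProperty.homMk biprod.fst
          snd := ObjectProperty.homMk biprod.snd
          inl := ObjectProperty.homMk biprod.inl
          inr := ObjectProperty.homMk biprod.inr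
          inl_fst := by ext; simp
          inl_snd := by ext; simp
          inr_fst := by ext; simp
          inr_snd := by ext; simp }
      isBilimit := isBinaryBilimitOfTotal _ (by
        ext1
        exact biprod.total) }

end Exact

/-! ### The stable category of a Frobenius category -/

section Stable

variable {C : Type u} [Category.{v} C] [Preadditive C]

/-- Two parallel morphisms are identified in the stable category when their difference factors
through a projective object. -/
def stableRel (S : ObjectProperty (ShortComplex C)) : HomRel C :=
  fun X Y f g => ∃ (P : C) (_ : projectives S P) (a : X ⟶ P) (b : P ⟶ Y), f - g = a ≫ b

instance [HasZeroObject C] [HasBinaryBiproducts C] (S : ObjectProperty (ShortComplex C)) :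
    Congruence (stableRel S) where
  equivalence :=
    { refl := fun f => ⟨_, (projectives S).prop_zero, 0, 0, by simp⟩
      symm := by
        rintro f g ⟨P, hP, a, b, h⟩
        exact ⟨P, hP, -a, b, by rw [Preadditive.neg_comp, ← h]; abel⟩
      trans := by
        rintro f g k ⟨P, hP, a, b, h⟩ ⟨P', hP', a', b', h'⟩
        refine ⟨_, projectives_biprod S hP hP', biprod.lift a a', biprod.desc b b', ?_⟩
        rw [biprod.lift_desc, ← h, ← h']; abel }
  comp_left := by
    rintro X Y Z f g g' ⟨P, hP, a, b, h⟩
    exact ⟨P, hP, f ≫ a, b, by rw [← Preadditive.comp_sub, h, Category.assoc]⟩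
  comp_right := by
    rintro X Y Z f f' g ⟨P, hP, a, b, h⟩
    exact ⟨P, hP, a, b ≫ g, by rw [← Preadditive.sub_comp, h, Category.assoc]⟩

/-- The stable category: the quotient of `C` by the ideal of the morphisms which factor
through a projective object. -/
abbrev Stable (S : ObjectProperty (ShortComplex C)) := CategoryTheory.Quotient (stableRel S)

/-- The projection to the stable category. -/
abbrev toStable (S : ObjectProperty (ShortComplex C)) : C ⥤ Stable S :=
  CategoryTheory.Quotient.functor (stableRel S)

variable [HasZeroObject C] [HasBinaryBiproducts C]
variable (S : ObjectProperty (ShortComplex C)) [IsFrobenius S]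

/-- A chosen conflation `X ⟶ I(X) ⟶ ΣX` with `I(X)` injective. -/
abbrev cosyzygy (X : C) : ShortComplex C :=
  ShortComplex.mk _ _
    (IsFrobenius.enough_injectives (S := S) X).choose_spec.choose_spec.choose_spec.choose_spec.choose

lemma cosyzygy_injective (X : C) : injectives S (cosyzygy S X).X₂ :=
  (IsFrobenius.enough_injectives (S := S) X).choose_spec.choose_spec.choose_spec.choose_spec.choose_spec.1

lemma cosyzygy_conflation (X : C) : S (cosyzygy S X) :=
  (IsFrobenius.enough_injectives (S := S) X).choose_spec.choose_spec.choose_spec.choose_spec.choose_spec.2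

variable {S}

lemma exists_extension {T T' : ShortComplex C} (hT : S T) (hI : injectives S T'.X₂)
    (f : T.X₁ ⟶ T'.X₁) : ∃ φ : T ⟶ T', φ.τ₁ = f := by
  obtain ⟨a, ha⟩ := hI T hT (f ≫ T'.f)
  obtain ⟨h⟩ := IsExactStructure.cokernel T hT
  obtain ⟨b, hb⟩ := CokernelCofork.IsColimit.desc' h (a ≫ T'.g)
    (by rw [← Category.assoc, ha, Category.assoc, T'.zero, comp_zero])
  exact ⟨⟨f, a, b, ha.symm, hb.symm⟩, rfl⟩

lemma stableRel_τ₃ {T T' : ShortComplex C} (hT : S T) (hI : injectives S T'.X₂)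
    (φ ψ : T ⟶ T') (h : stableRel S φ.τ₁ ψ.τ₁) : stableRel S φ.τ₃ ψ.τ₃ := by
  obtain ⟨J, hJ, a, b, hab⟩ := h
  have hJ' : injectives S J := by
    rw [← IsFrobenius.projectives_eq_injectives (S := S)]; exact hJ
  obtain ⟨k, hk⟩ := hJ' T hT a
  obtain ⟨hc⟩ := IsExactStructure.cokernel T hT
  obtain ⟨c, hc'⟩ := CokernelCofork.IsColimit.desc' hc (φ.τ₂ - ψ.τ₂ - k ≫ b ≫ T'.f) (by
    simp only [Preadditive.comp_sub, reassoc_of% hk, ← φ.comm₁₂, ← ψ.comm₁₂]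
    rw [← Category.assoc a, ← hab, Preadditive.sub_comp, sub_self])
  refine ⟨T'.X₂, ?_, c, T'.g, ?_⟩
  · rw [IsFrobenius.projectives_eq_injectives (S := S)]; exact hI
  · have hc'' : T.g ≫ c = φ.τ₂ - ψ.τ₂ - k ≫ b ≫ T'.f := hc'
    apply Cofork.IsColimit.hom_ext hc
    change T.g ≫ (φ.τ₃ - ψ.τ₃) = T.g ≫ c ≫ T'.g
    rw [reassoc_of% hc'']
    simp [Preadditive.comp_sub, Preadditive.sub_comp, φ.comm₂₃, ψ.comm₂₃]

/-- A morphism `f : X ⟶ Y`, extended to the chosen conflations. -/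
def cosyzygyMap {X Y : C} (f : X ⟶ Y) : cosyzygy S X ⟶ cosyzygy S Y :=
  (exists_extension (cosyzygy_conflation S X) (cosyzygy_injective S Y) f).choose

lemma cosyzygyMap_τ₁ {X Y : C} (f : X ⟶ Y) : (cosyzygyMap (S := S) f).τ₁ = f :=
  (exists_extension (cosyzygy_conflation S X) (cosyzygy_injective S Y) f).choose_spec

lemma toStable_τ₃_eq {X Y : C} (φ ψ : cosyzygy S X ⟶ cosyzygy S Y)
    (h : stableRel S φ.τ₁ ψ.τ₁) : (toStable S).map φ.τ₃ = (toStable S).map ψ.τ₃ :=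
  CategoryTheory.Quotient.sound _
    (stableRel_τ₃ (cosyzygy_conflation S X) (cosyzygy_injective S Y) φ ψ h)

lemma stableRel_of_eq {X Y : C} {f g : X ⟶ Y} (h : f = g) : stableRel S f g :=
  h ▸ Congruence.equivalence.refl f

variable (S) in
/-- The suspension functor `X ↦ ΣX` of the stable category. -/
def suspension : Stable S ⥤ Stable S :=
  CategoryTheory.Quotient.lift (stableRel S)
    { obj := fun X => (toStable S).obj (cosyzygy S X).X₃
      map := fun f => (toStable S).map (cosyzygyMap (S := S) f).τ₃
      map_id := fun X => by
        rw [← (toStable S).map_id, ← ShortComplex.id_τ₃]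
        exact toStable_τ₃_eq _ _ (stableRel_of_eq (by rw [cosyzygyMap_τ₁]; rfl))
      map_comp := fun f g => by
        rw [← (toStable S).map_comp, ← ShortComplex.comp_τ₃]
        exact toStable_τ₃_eq _ _ (stableRel_of_eq (by
          rw [ShortComplex.comp_τ₁]; simp only [cosyzygyMap_τ₁])) }
    (fun X Y f g h => toStable_τ₃_eq _ _ (by simpa only [cosyzygyMap_τ₁] using h))

variable (S) in
/-- The distinguished triangles `X ⟶ Y ⟶ Z ⟶ ΣX` of the stable category: those isomorphic to
the image of `T.X₁ ⟶ T.X₂ ⟶ T.X₃ ⟶ Σ T.X₁`, where `T` is a conflation and the last map is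
induced on cokernels by a map of conflations from `T` to `T.X₁ ⟶ I(T.X₁) ⟶ Σ T.X₁`
extending the identity of `T.X₁`. -/
def IsDistinguished {X Y Z : Stable S} (f : X ⟶ Y) (g : Y ⟶ Z)
    (h : Z ⟶ (suspension S).obj X) : Prop :=
  ∃ (T : ShortComplex C) (_ : S T) (φ : T ⟶ cosyzygy S T.X₁) (_ : φ.τ₁ = 𝟙 T.X₁)
    (e₁ : X ≅ (toStable S).obj T.X₁) (e₂ : Y ≅ (toStable S).obj T.X₂)
    (e₃ : Z ≅ (toStable S).obj T.X₃),
    f ≫ e₂.hom = e₁.hom ≫ (toStable S).map T.f ∧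
    g ≫ e₃.hom = e₂.hom ≫ (toStable S).map T.g ∧
    h ≫ (suspension S).map e₁.hom = e₃.hom ≫ (toStable S).map φ.τ₃

variable (S) in
/-- A triangle equivalence from the stable category of a Frobenius category to a triangulated
category `D`: an equivalence of categories `F`, together with a natural isomorphism `F Σ ≅ Σ F`,
under which the distinguished triangles of the two sides correspond to each other. -/
structure StableTriangleEquivalence (D : Type u') [Category.{v'} D] [Preadditive D]
    [HasZeroObject D] [HasShift D ℤ] [∀ n : ℤ, (shiftFunctor D n).Additive]
    [Pretriangulated D] where
  functor : Stable S ⥤ D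
  isEquivalence : functor.IsEquivalence
  shiftIso : suspension S ⋙ functor ≅ functor ⋙ shiftFunctor D (1 : ℤ)
  distinguished_iff : ∀ {X Y Z : Stable S} (f : X ⟶ Y) (g : Y ⟶ Z)
    (h : Z ⟶ (suspension S).obj X), IsDistinguished S f g h ↔
      Triangle.mk (functor.map f) (functor.map g) (functor.map h ≫ shiftIso.hom.app X) ∈
        distTriang D

end Stable

/-! ### The category of admissible epimorphisms -/

section MorEpi

variable {C : Type u} [Category.{v} C] [Preadditive C]

/-- The category of admissible epimorphisms: the objects are the admissible epimorphisms
`X ⟶ Y`, the morphisms are the commutative squares. -/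
abbrev MorEpi (S : ObjectProperty (ShortComplex C)) :=
  ObjectProperty.FullSubcategory (fun α : Arrow C => AdmissibleEpi S α.hom)

/-- The conflations of the category of admissible epimorphisms: the sequences whose sequence of
sources and whose sequence of targets are conflations. -/
def morEpiConflations (S : ObjectProperty (ShortComplex C)) :
    ObjectProperty (ShortComplex (MorEpi S)) :=
  fun T =>
    S (ShortComplex.mk T.f.hom.left T.g.hom.left
      (congrArg (fun k : T.X₁ ⟶ T.X₃ => k.hom.left) T.zero)) ∧
    S (ShortComplex.mk T.f.hom.right T.g.hom.right
      (congrArg (fun k : T.X₁ ⟶ T.X₃ => k.hom.right) T.zero))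

variable [HasZeroObject C] [HasBinaryBiproducts C]
variable (S : ObjectProperty (ShortComplex C)) [IsExactStructure S]

variable {S} in
lemma AdmissibleEpi.comp_iso {X Y Z : C} {p : X ⟶ Y} (hp : AdmissibleEpi S p) (e : Y ≅ Z) :
    AdmissibleEpi S (p ≫ e.hom) := by
  obtain ⟨K, i, w, h⟩ := hp
  exact ⟨K, i, by rw [reassoc_of% w, zero_comp],
    IsExactStructure.of_iso (T := ShortComplex.mk i p w)
      (T' := ShortComplex.mk i (p ≫ e.hom) (by rw [reassoc_of% w, zero_comp]))
      (ShortComplex.isoMk (Iso.refl _) (Iso.refl _) e) h⟩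

variable {S} in
lemma AdmissibleEpi.iso_comp {X Y Z : C} {p : X ⟶ Y} (hp : AdmissibleEpi S p) (e : Z ≅ X) :
    AdmissibleEpi S (e.hom ≫ p) := by
  obtain ⟨K, i, w, h⟩ := hp
  exact ⟨K, i ≫ e.inv, by simp [w],
    IsExactStructure.of_iso (T := ShortComplex.mk i p w)
      (T' := ShortComplex.mk (i ≫ e.inv) (e.hom ≫ p) (by simp [w]))
      (ShortComplex.isoMk (Iso.refl _) e.symm (Iso.refl _)) h⟩

variable {S} in
lemma AdmissibleEpi.of_isPullback {Y Z Y' Z' : C} {f' : Y' ⟶ Y} {p' : Y' ⟶ Z'} {p : Y ⟶ Z}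
    {f : Z' ⟶ Z} (sq : IsPullback f' p' p f) (hp : AdmissibleEpi S p) :
    AdmissibleEpi S p' := by
  obtain ⟨Y'', f'', p'', sq', h⟩ := IsExactStructure.pullback p f hp
  have := h.iso_comp (sq.isoIsPullback _ _ sq')
  rwa [IsPullback.isoIsPullback_hom_snd] at this

variable {S} in
lemma AdmissibleEpi.biprod_map {X Y X' Y' : C} {p : X ⟶ Y} {q : X' ⟶ Y'}
    (hp : AdmissibleEpi S p) (hq : AdmissibleEpi S q) : AdmissibleEpi S (biprod.map p q) := by
  have h₁ : IsPullback (biprod.fst : X ⊞ X' ⟶ X) (biprod.map p (𝟙 X')) p biprod.fst :=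
    ⟨⟨by simp⟩, ⟨PullbackCone.IsLimit.mk _ (fun s => biprod.lift s.fst (s.snd ≫ biprod.snd))
      (fun s => by simp) (fun s => by ext <;> simp [s.condition])
      (fun s m hm hm' => by ext <;> simp [← hm, ← hm'])⟩⟩
  have h₂ : IsPullback (biprod.snd : Y ⊞ X' ⟶ X') (biprod.map (𝟙 Y) q) q biprod.snd :=
    ⟨⟨by simp⟩, ⟨PullbackCone.IsLimit.mk _ (fun s => biprod.lift (s.snd ≫ biprod.fst) s.fst)
      (fun s => by simp) (fun s => by ext <;> simp [s.condition])
      (fun s m hm hm' => by ext <;> simp [← hm, ← hm'])⟩⟩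
  have := IsExactStructure.comp_epi _ _ (hp.of_isPullback h₁) (hq.of_isPullback h₂)
  have e : biprod.map p (𝟙 X') ≫ biprod.map (𝟙 Y) q = biprod.map p q := by
    ext <;> simp
  rwa [e] at this

instance : HasZeroObject (MorEpi S) where
  zero := by
    refine ⟨⟨Arrow.mk (𝟙 (0 : C)), IsExactStructure.id_epi _⟩, (IsZero.iff_id_eq_zero _).2 ?_⟩
    ext
    · exact (isZero_zero C).eq_of_src _ _
    · exact (isZero_zero C).eq_of_src _ _

instance : HasBinaryBiproducts (MorEpi S) where
  has_binary_biproduct α β := HasBinaryBiproduct.mk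
    { bicone :=
        { pt := ⟨Arrow.mk (biprod.map α.obj.hom β.obj.hom), α.property.biprod_map β.property⟩
          fst := ObjectProperty.homMk (Arrow.homMk biprod.fst biprod.fst (by simp))
          snd := ObjectProperty.homMk (Arrow.homMk biprod.snd biprod.snd (by simp))
          inl := ObjectProperty.homMk (Arrow.homMk biprod.inl biprod.inl (by simp))
          inr := ObjectProperty.homMk (Arrow.homMk biprod.inr biprod.inr (by simp))
          inl_fst := by ext <;> simp
          inl_snd := by ext <;> simp
          inr_fst := by ext <;> simp
          inr_snd := by ext <;> simp }
      isBilimit := isBinaryBilimitOfTotal _ (by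
        ext
        · exact biprod.total
        · exact biprod.total) }

end MorEpi

/-! ### The homotopy categories of complexes of projective-injective objects -/

section Complexes

variable {C : Type u} [Category.{v} C] [Preadditive C]

/-- Cochain complexes of projective-injective objects. -/
abbrev ProjComplex (S : ObjectProperty (ShortComplex C)) :=
  CochainComplex (projectives S).FullSubcategory ℤ

/-- The complex `X` is acyclic in `(C, S)`: its cycles `Zⁱ` exist in `C`, the sequences
`Zⁱ ⟶ Xⁱ ⟶ Zⁱ⁺¹` are conflations, and the differential is `Xⁱ ⟶ Zⁱ⁺¹ ⟶ Xⁱ⁺¹`. -/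
def IsAcyclicComplex (S : ObjectProperty (ShortComplex C)) (X : ProjComplex S) : Prop :=
  ∃ (Z : ℤ → C) (ι : ∀ i, Z i ⟶ (X.X i).obj) (π : ∀ i, (X.X i).obj ⟶ Z (i + 1))
    (w : ∀ i, ι i ≫ π i = 0),
    ∀ i, S (ShortComplex.mk (ι i) (π i) (w i)) ∧ (X.d i (i + 1)).hom = π i ≫ ι (i + 1)

variable [HasZeroObject C]

/-- `X` agrees with an acyclic complex in all degrees `≤ m`, and with an acyclic complex in all
degrees `≥ n`, for some integers `m ≤ n`. -/
def IsEventuallyAcyclic (S : ObjectProperty (ShortComplex C)) : ObjectProperty (ProjComplex S) :=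
  fun X => ∃ (m n : ℤ) (_ : m ≤ n) (Y Y' : ProjComplex S),
    IsAcyclicComplex S Y ∧ IsAcyclicComplex S Y' ∧
    Nonempty (X.stupidTrunc (ComplexShape.embeddingUpIntLE m) ≅
      Y.stupidTrunc (ComplexShape.embeddingUpIntLE m)) ∧
    Nonempty (X.stupidTrunc (ComplexShape.embeddingUpIntGE n) ≅
      Y'.stupidTrunc (ComplexShape.embeddingUpIntGE n))

/-- Bounded complexes. -/
def IsBoundedComplex (S : ObjectProperty (ShortComplex C)) : ObjectProperty (ProjComplex S) :=
  fun X => ∃ a b : ℤ, X.IsStrictlyGE a ∧ X.IsStrictlyLE b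

variable [HasBinaryBiproducts C] (S : ObjectProperty (ShortComplex C))

/-- The homotopy category `K(P)` of complexes of projective-injective objects. -/
abbrev KProj := HomotopyCategory (projectives S).FullSubcategory (ComplexShape.up ℤ)

/-- The full subcategory `K^{∞,b}(P, F)` of `K(P)` (closed under isomorphisms). -/
def KInfB : ObjectProperty (KProj S) :=
  ((IsEventuallyAcyclic S).strictMap (HomotopyCategory.quotient _ _)).isoClosure

/-- The full subcategory `K^b(P)` of `K(P)` of the bounded complexes, before closing under
isomorphisms. -/
def KBoundedStrict : ObjectProperty (KProj S) :=
  (IsBoundedComplex S).strictMap (HomotopyCategory.quotient _ _)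

lemma KBoundedStrict_quotient_obj_iff (K : ProjComplex S) :
    KBoundedStrict S ((HomotopyCategory.quotient _ _).obj K) ↔ IsBoundedComplex S K := by
  refine ⟨?_, fun h ↦ ⟨_, h⟩⟩
  simp only [KBoundedStrict, ObjectProperty.strictMap_iff]
  rintro ⟨L, h, hL⟩
  obtain rfl : L = K := congr_arg Quotient.as hL
  exact h

instance : (KBoundedStrict S).ContainsZero where
  exists_zero :=
    ⟨(HomotopyCategory.quotient _ _).obj 0, Functor.map_isZero _ (isZero_zero _), by
      rw [KBoundedStrict_quotient_obj_iff]
      exact ⟨0, 0, inferInstance, inferInstance⟩⟩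

instance : (KBoundedStrict S).IsStableUnderShift ℤ where
  isStableUnderShiftBy n :=
    { le_shift K hK := by
        obtain ⟨K : CochainComplex _ _, rfl⟩ := K.quotient_obj_surjective
        rw [KBoundedStrict_quotient_obj_iff] at hK
        obtain ⟨a, b, _, _⟩ := hK
        rw [ObjectProperty.prop_shift_iff, HomotopyCategory.shift_quotient_obj,
          KBoundedStrict_quotient_obj_iff]
        exact ⟨a - n, b - n, K.isStrictlyGE_shift a n (a - n) (by lia),
          K.isStrictlyLE_shift b n (b - n) (by lia)⟩ }

lemma isBoundedComplex_mappingCone {K L : ProjComplex S} (f : K ⟶ L)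
    (hK : IsBoundedComplex S K) (hL : IsBoundedComplex S L) :
    IsBoundedComplex S (CochainComplex.mappingCone f) := by
  obtain ⟨a, b, _, _⟩ := hK
  obtain ⟨a', b', _, _⟩ := hL
  refine ⟨min (a - 1) a', max b b', ?_, ?_⟩
  · rw [CochainComplex.isStrictlyGE_iff]
    intro i hi
    simp only [lt_min_iff] at hi
    rw [CochainComplex.mappingCone.isZero_X_iff]
    exact ⟨K.isZero_of_isStrictlyGE a _ (by lia), L.isZero_of_isStrictlyGE a' _ (by lia)⟩
  · rw [CochainComplex.isStrictlyLE_iff]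
    intro i hi
    simp only [max_lt_iff] at hi
    rw [CochainComplex.mappingCone.isZero_X_iff]
    exact ⟨K.isZero_of_isStrictlyLE b _ (by lia), L.isZero_of_isStrictlyLE b' _ (by lia)⟩

instance : (KBoundedStrict S).IsTriangulatedClosed₃ where
  ext₃' T hT h₁ h₂ := by
    have h₁' : IsBoundedComplex S T.obj₁.as := by
      rwa [← KBoundedStrict_quotient_obj_iff]
    have h₂' : IsBoundedComplex S T.obj₂.as := by
      rwa [← KBoundedStrict_quotient_obj_iff]
    obtain ⟨f : T.obj₁.as ⟶ T.obj₂.as, hf⟩ :=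
      (HomotopyCategory.quotient _ _).map_surjective T.mor₁
    refine ⟨_, ?_,
      ⟨Triangle.π₃.mapIso (isoTriangleOfIso₁₂ T _ hT
        (HomotopyCategory.mappingCone_triangleh_distinguished f)
        (Iso.refl _) (Iso.refl _) ?_)⟩⟩
    · exact (KBoundedStrict_quotient_obj_iff S _).2 (isBoundedComplex_mappingCone S f h₁' h₂')
    · exact (Category.comp_id _).trans (hf.symm.trans (Category.id_comp _).symm)

instance : (KBoundedStrict S).IsTriangulated where
  toIsTriangulatedClosed₂ := .of_isTriangulatedClosed₃

/-- The full subcategory `K^b(P)` of `K(P)` (closed under isomorphisms). -/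
abbrev KBounded : ObjectProperty (KProj S) := (KBoundedStrict S).isoClosure

variable [(KInfB S).IsTriangulated]

/-- The Verdier quotient `(K^{∞,b}/K^b)(P, F)` of `K^{∞,b}(P, F)` by `K^b(P)`: the localization
of `K^{∞,b}(P, F)` at the morphisms with cone in `K^b(P)`. -/
abbrev KInfBModKBounded :=
  ((KBounded S).inverseImage (KInfB S).ι).trW.Localization

end Complexes

end ExactCat

end

noncomputable section

namespace ExactCat

/-! ### Lemmas on exact categories -/

section ExactLemmas

variable {C : Type u} [Category.{v} C] [Preadditive C]

/-! To a deflation `α : X ⟶ Y` one attaches a complex over the projective-injectives: a projective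
resolution of `X` in degrees `< 0` and an injective coresolution of `Y` in degrees `≥ 0`, spliced by
`P⁻¹ ⟶ X ⟶ Y ⟶ I⁰` (a `Model`). It is acyclic away from degrees `-1` and `0`, hence lies in
`K^{∞,b}`. Morphisms of arrows lift to chain maps, uniquely up to homotopy, and every chain map
between models comes from a morphism of arrows, because `X` is the cokernel of `d⁻²` and `Y` the
kernel of `d⁰`. This gives a full functor to `K(P)`, then a functor `toVerdier` to the Verdier
quotient.

The decisive fact is an orthogonality. Since `α` is a deflation, maps into a projective-injective
extend along the differentials of the model, and maps from one lift along them, in every degree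
except `-1`. So in `K(P)` there are no nonzero maps, in either direction, between the model and a
bounded complex vanishing in degree `-1` (`quotient_hom_eq_zero_right`,
`quotient_hom_eq_zero_left`). Splitting bounded complexes by brutal truncation then yields fullness
of `toVerdier`, and shows that a morphism through a bounded complex is, up to homotopy, one through
a single projective `P` in degree `-1`, that is, through the deflation `P ⟶ 0`. Null homotopies
correspond to factorizations through identities `Q ⟶ Q`. These two kinds of objects account for all
projective deflations, so the kernel of `toVerdier` is exactly the ideal of the stable category.

For essential surjectivity, a complex in `K^{∞,b}` coincides far to the left and far to the right
with acyclic complexes; replacing it by these outside a finite range links it to the model of some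
arrow, and adding a projective cover to the source makes this arrow a deflation. Neither change
matters modulo bounded complexes (`isIso_verdierMap_quotient`).

For the triangles, a conflation of deflations is itself a deflation between deflations, so it has a
model over the Frobenius category `Mor^e` itself. The exact functors kernel, source and target turn
this one complex into models of the three terms, forming a degreewise split sequence. Its connecting
map is natural, so `toVerdier` is a `DeltaFunctor`, and such a functor induces a triangle
equivalence on the stable category.

That `K^{∞,b}` is triangulated follows from a degreewise notion of acyclicity (`AcyclicAt`), which
mapping cones inherit from finitely many neighbouring degrees. -/

lemma isPullback_of_exists_lift {P X Y Z : C} {fst : P ⟶ X} {snd : P ⟶ Y} {f : X ⟶ Z} {g : Y ⟶ Z}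
    (w : fst ≫ f = snd ≫ g)
    (hex : ∀ {W : C} (a : W ⟶ X) (b : W ⟶ Y), a ≫ f = b ≫ g →
      ∃ l : W ⟶ P, l ≫ fst = a ∧ l ≫ snd = b)
    (huniq : ∀ {W : C} (l : W ⟶ P), l ≫ fst = 0 → l ≫ snd = 0 → l = 0) :
    IsPullback fst snd f g :=
  ⟨⟨w⟩, ⟨PullbackCone.IsLimit.mk _ (fun s => (hex s.fst s.snd s.condition).choose)
    (fun s => (hex s.fst s.snd s.condition).choose_spec.1)
    (fun s => (hex s.fst s.snd s.condition).choose_spec.2)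
    (fun s m h₁ h₂ => by
      rw [← sub_eq_zero]
      refine huniq _ ?_ ?_
      · rw [Preadditive.sub_comp, h₁, (hex s.fst s.snd s.condition).choose_spec.1, sub_self]
      · rw [Preadditive.sub_comp, h₂, (hex s.fst s.snd s.condition).choose_spec.2, sub_self])⟩⟩

lemma isPushout_of_exists_desc {Z X Y P : C} {f : Z ⟶ X} {g : Z ⟶ Y} {inl : X ⟶ P} {inr : Y ⟶ P}
    (w : f ≫ inl = g ≫ inr)
    (hex : ∀ {W : C} (a : X ⟶ W) (b : Y ⟶ W), f ≫ a = g ≫ b →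
      ∃ l : P ⟶ W, inl ≫ l = a ∧ inr ≫ l = b)
    (huniq : ∀ {W : C} (l : P ⟶ W), inl ≫ l = 0 → inr ≫ l = 0 → l = 0) :
    IsPushout f g inl inr :=
  ⟨⟨w⟩, ⟨PushoutCocone.IsColimit.mk _ (fun s => (hex s.inl s.inr s.condition).choose)
    (fun s => (hex s.inl s.inr s.condition).choose_spec.1)
    (fun s => (hex s.inl s.inr s.condition).choose_spec.2)
    (fun s m h₁ h₂ => by
      rw [← sub_eq_zero]
      refine huniq _ ?_ ?_
      · rw [Preadditive.comp_sub, h₁, (hex s.inl s.inr s.condition).choose_spec.1, sub_self]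
      · rw [Preadditive.comp_sub, h₂, (hex s.inl s.inr s.condition).choose_spec.2, sub_self])⟩⟩

variable [HasZeroObject C] [HasBinaryBiproducts C]
variable {S : ObjectProperty (ShortComplex C)} [IsExactStructure S]

section

variable {X Y Z : C} {i : X ⟶ Y} {p : Y ⟶ Z} {w : i ≫ p = 0}

lemma conflation_lift (h : S (ShortComplex.mk i p w)) {W : C} (f : W ⟶ Y) (hf : f ≫ p = 0) :
    ∃ l : W ⟶ X, l ≫ i = f := by
  obtain ⟨hl⟩ := IsExactStructure.kernel _ h
  obtain ⟨l, hl⟩ := KernelFork.IsLimit.lift' hl f hf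
  exact ⟨l, hl⟩

lemma conflation_desc (h : S (ShortComplex.mk i p w)) {W : C} (f : Y ⟶ W) (hf : i ≫ f = 0) :
    ∃ l : Z ⟶ W, p ≫ l = f := by
  obtain ⟨hl⟩ := IsExactStructure.cokernel _ h
  obtain ⟨l, hl⟩ := CokernelCofork.IsColimit.desc' hl f hf
  exact ⟨l, hl⟩

lemma conflation_mono (h : S (ShortComplex.mk i p w)) : Mono i := by
  obtain ⟨hl⟩ := IsExactStructure.kernel _ h
  exact Fork.IsLimit.mono hl

lemma conflation_epi (h : S (ShortComplex.mk i p w)) : Epi p := by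
  obtain ⟨hl⟩ := IsExactStructure.cokernel _ h
  exact Cofork.IsColimit.epi hl

end

lemma AdmissibleEpi.epi {X Y : C} {p : X ⟶ Y} (hp : AdmissibleEpi S p) : Epi p := by
  obtain ⟨_, _, _, h⟩ := hp
  exact conflation_epi h

lemma AdmissibleMono.mono {X Y : C} {i : X ⟶ Y} (hi : AdmissibleMono S i) : Mono i := by
  obtain ⟨_, _, _, h⟩ := hi
  exact conflation_mono h

lemma conflation_of_iso {X Y Z X' Y' Z' : C} {i : X ⟶ Y} {p : Y ⟶ Z} {w : i ≫ p = 0}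
    (h : S (ShortComplex.mk i p w)) {i' : X' ⟶ Y'} {p' : Y' ⟶ Z'} (w' : i' ≫ p' = 0)
    (e₁ : X ≅ X') (e₂ : Y ≅ Y') (e₃ : Z ≅ Z') (h₁ : e₁.hom ≫ i' = i ≫ e₂.hom)
    (h₂ : e₂.hom ≫ p' = p ≫ e₃.hom) : S (ShortComplex.mk i' p' w') :=
  IsExactStructure.of_iso (T := ShortComplex.mk i p w) (T' := ShortComplex.mk i' p' w')
    (ShortComplex.isoMk e₁ e₂ e₃ h₁ h₂) h

/-- Kernels are unique up to isomorphism, so `i` differs by an isomorphism from the kernel that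
comes with the deflation `p`, and conflations are closed under isomorphism. -/
lemma conflation_of_admissibleEpi {X Y Z : C} {i : X ⟶ Y} {p : Y ⟶ Z} (w : i ≫ p = 0)
    (hp : AdmissibleEpi S p) (hi : Mono i)
    (hl : ∀ {W : C} (f : W ⟶ Y), f ≫ p = 0 → ∃ l : W ⟶ X, l ≫ i = f) :
    S (ShortComplex.mk i p w) := by
  obtain ⟨K, j, w', h⟩ := hp
  have := conflation_mono h
  obtain ⟨a, ha⟩ := conflation_lift h i w
  obtain ⟨b, hb⟩ := hl j w'
  refine conflation_of_iso h w ⟨b, a, ?_, ?_⟩ (Iso.refl _) (Iso.refl _) ?_ ?_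
  · rw [← cancel_mono j, Category.assoc, ha, hb, Category.id_comp]
  · rw [← cancel_mono i, Category.assoc, hb, ha, Category.id_comp]
  · simp [hb]
  · simp

lemma conflation_of_admissibleMono {X Y Z : C} {i : X ⟶ Y} {p : Y ⟶ Z} (w : i ≫ p = 0)
    (hi : AdmissibleMono S i) (hp : Epi p)
    (hl : ∀ {W : C} (f : Y ⟶ W), i ≫ f = 0 → ∃ l : Z ⟶ W, p ≫ l = f) :
    S (ShortComplex.mk i p w) := by
  obtain ⟨K, q, w', h⟩ := hi
  have := conflation_epi h
  obtain ⟨a, ha⟩ := conflation_desc h p w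
  obtain ⟨b, hb⟩ := hl q w'
  refine conflation_of_iso h w (Iso.refl _) (Iso.refl _) ⟨a, b, ?_, ?_⟩ ?_ ?_
  · rw [← cancel_epi q, reassoc_of% ha, hb, Category.comp_id]
  · rw [← cancel_epi p, reassoc_of% hb, ha, Category.comp_id]
  · simp
  · simp [ha]

lemma AdmissibleMono.comp_iso {X Y Z : C} {i : X ⟶ Y} (hi : AdmissibleMono S i) (e : Y ≅ Z) :
    AdmissibleMono S (i ≫ e.hom) := by
  obtain ⟨K, p, w, h⟩ := hi
  exact ⟨K, e.inv ≫ p, by simp [w],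
    conflation_of_iso h _ (Iso.refl _) e (Iso.refl _) (by simp) (by simp)⟩

lemma AdmissibleMono.of_isPushout {X Y X' Y' : C} {i : X ⟶ Y} {f : X ⟶ X'} {f' : Y ⟶ Y'}
    {i' : X' ⟶ Y'} (sq : IsPushout i f f' i') (hi : AdmissibleMono S i) :
    AdmissibleMono S i' := by
  obtain ⟨Y'', f'', i'', sq', h⟩ := IsExactStructure.pushout i f hi
  have := h.comp_iso (sq'.isoIsPushout _ _ sq)
  rwa [IsPushout.inr_isoIsPushout_hom] at this

lemma conflation_pullback {X Y Z Y' Z' : C} {i : X ⟶ Y} {p : Y ⟶ Z} {w : i ≫ p = 0}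
    (h : S (ShortComplex.mk i p w)) {f' : Y' ⟶ Y} {p' : Y' ⟶ Z'} {f : Z' ⟶ Z}
    (sq : IsPullback f' p' p f) :
    ∃ (i' : X ⟶ Y') (w' : i' ≫ p' = 0), S (ShortComplex.mk i' p' w') ∧ i' ≫ f' = i := by
  have := conflation_mono h
  refine ⟨sq.lift i 0 (by simp [w]), by simp, ?_, by simp⟩
  refine conflation_of_admissibleEpi _ (AdmissibleEpi.of_isPullback sq ⟨_, _, _, h⟩) ?_ ?_
  · exact mono_of_mono_fac (sq.lift_fst i 0 (by simp [w]))
  · intro W g hg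
    obtain ⟨l, hl⟩ := conflation_lift h (g ≫ f') (by rw [Category.assoc, sq.w, reassoc_of% hg,
      zero_comp])
    exact ⟨l, sq.hom_ext (by simp [hl]) (by simp [hg])⟩

lemma conflation_pushout {X Y Z X' Y' : C} {i : X ⟶ Y} {p : Y ⟶ Z} {w : i ≫ p = 0}
    (h : S (ShortComplex.mk i p w)) {f : X ⟶ X'} {f' : Y ⟶ Y'} {i' : X' ⟶ Y'}
    (sq : IsPushout i f f' i') :
    ∃ (p' : Y' ⟶ Z) (w' : i' ≫ p' = 0), S (ShortComplex.mk i' p' w') ∧ f' ≫ p' = p := by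
  have := conflation_epi h
  refine ⟨sq.desc p 0 (by simp [w]), by simp, ?_, by simp⟩
  refine conflation_of_admissibleMono _ (AdmissibleMono.of_isPushout sq ⟨_, _, _, h⟩) ?_ ?_
  · exact epi_of_epi_fac (sq.inl_desc p 0 (by simp [w]))
  · intro W g hg
    obtain ⟨l, hl⟩ := conflation_desc h (f' ≫ g) (by rw [sq.w_assoc, hg, comp_zero])
    exact ⟨l, sq.hom_ext (by simp [hl]) (by simp [hg])⟩

/-- The short five lemma. On the pullback `E` of both projections to `T'.X₃`, the two routes to
`T'.X₂` differ by a map `ρ` into `T'.X₁`. Correcting `r₁` by `ρ` kills the kernel of `r₂`, and the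
corrected map descends along the deflation `r₂` to a section of `φ.τ₂`. -/
lemma isIso_τ₂_of_conflation {T T' : ShortComplex C} (hT : S T) (hT' : S T') (φ : T ⟶ T')
    [IsIso φ.τ₁] [IsIso φ.τ₃] : IsIso φ.τ₂ := by
  have hf := conflation_mono hT
  have hf' := conflation_mono hT'
  obtain ⟨E, r₁, r₂, sq, -⟩ := IsExactStructure.pullback (T.g ≫ φ.τ₃) T'.g
    (AdmissibleEpi.comp_iso (S := S) ⟨_, _, _, hT⟩ (asIso φ.τ₃))
  have hT₁ : S (ShortComplex.mk T.f (T.g ≫ φ.τ₃) (by simp)) :=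
    conflation_of_iso hT _ (Iso.refl _) (Iso.refl _) (asIso φ.τ₃) (by simp) (by simp)
  obtain ⟨j, wj, hj, hj'⟩ := conflation_pullback hT₁ sq
  have := conflation_epi hj
  obtain ⟨ρ, hρ⟩ := conflation_lift hT' (r₁ ≫ φ.τ₂ - r₂) (by
    rw [Preadditive.sub_comp, Category.assoc, φ.comm₂₃, sq.w, sub_self])
  have hjρ : j ≫ ρ = φ.τ₁ := by
    rw [← cancel_mono T'.f, Category.assoc, hρ, Preadditive.comp_sub, reassoc_of% hj', wj,
      sub_zero, φ.comm₁₂]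
  obtain ⟨k, hk⟩ := conflation_desc hj (r₁ - ρ ≫ inv φ.τ₁ ≫ T.f) (by
    rw [Preadditive.comp_sub, hj', reassoc_of% hjρ]; simp)
  have hk' : k ≫ φ.τ₂ = 𝟙 _ := by
    rw [← cancel_epi r₂, reassoc_of% hk, Preadditive.sub_comp]
    simp only [Category.assoc, ← φ.comm₁₂, IsIso.inv_hom_id_assoc, hρ]
    simp
  have hm : Mono φ.τ₂ := Preadditive.mono_of_cancel_zero _ (fun {W} x hx => by
    obtain ⟨y, rfl⟩ := conflation_lift hT x (by
      rw [← cancel_mono φ.τ₃, Category.assoc, ← φ.comm₂₃, reassoc_of% hx]; simp)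
    have : y ≫ φ.τ₁ = 0 := by
      rw [← cancel_mono T'.f, Category.assoc, φ.comm₁₂, ← Category.assoc, hx, zero_comp]
    have hy : y = 0 := by rw [← cancel_mono φ.τ₁, this, zero_comp]
    simp [hy])
  exact ⟨k, by rw [← cancel_mono φ.τ₂, Category.assoc, hk', Category.comp_id, Category.id_comp],
    hk'⟩

/-- The conflation of the kernels of two composable deflations and of their composite. -/
lemma conflation_kernels_comp {X Y Z K L M : C} {i : K ⟶ X} {p : X ⟶ Y} {w : i ≫ p = 0}
    {j : L ⟶ Y} {q : Y ⟶ Z} {w' : j ≫ q = 0} {r : X ⟶ Z} {m : M ⟶ X} {w'' : m ≫ r = 0}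
    (h : S (ShortComplex.mk i p w)) (h' : S (ShortComplex.mk j q w'))
    (h'' : S (ShortComplex.mk m r w'')) (hr : p ≫ q = r) :
    ∃ (a : K ⟶ M) (b : M ⟶ L) (wab : a ≫ b = 0), S (ShortComplex.mk a b wab) ∧
      a ≫ m = i ∧ m ≫ p = b ≫ j := by
  have := conflation_mono h
  have := conflation_mono h'
  have := conflation_mono h''
  obtain ⟨a, ha⟩ := conflation_lift h'' i (by rw [← hr, reassoc_of% w, zero_comp])
  obtain ⟨b, hb⟩ := conflation_lift h' (m ≫ p) (by rw [Category.assoc, hr, w''])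
  have wab : a ≫ b = 0 := by
    rw [← cancel_mono j, Category.assoc, hb, reassoc_of% ha, w, zero_comp]
  -- The kernel of `p ≫ q` is the preimage under `p` of the kernel of `q`, so `b` is a base change
  -- of `p`.
  have sq : IsPullback m b p j := isPullback_of_exists_lift hb.symm
    (fun {W} c d hcd => by
      obtain ⟨l, hl⟩ := conflation_lift h'' c (by
        rw [← hr, reassoc_of% hcd, w', comp_zero])
      exact ⟨l, hl, by rw [← cancel_mono j, Category.assoc, hb, reassoc_of% hl, hcd]⟩)
    (fun l hl _ => by rw [← cancel_mono m, hl, zero_comp])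
  refine ⟨a, b, wab, conflation_of_admissibleEpi _ (.of_isPullback sq ⟨_, _, _, h⟩)
    (mono_of_mono_fac ha) ?_, ha, hb.symm⟩
  intro W f hf
  obtain ⟨l, hl⟩ := conflation_lift h (f ≫ m) (by
    rw [Category.assoc, ← hb, reassoc_of% hf, zero_comp])
  exact ⟨l, by rw [← cancel_mono m, Category.assoc, ha, hl]⟩

/-- The conflation of the cokernels of two composable inflations and of their composite. -/
lemma conflation_cokernels_comp {X Y Z U V R : C} {i : X ⟶ Y} {p : Y ⟶ U} {w : i ≫ p = 0}
    {j : Y ⟶ Z} {r : Z ⟶ R} {w' : j ≫ r = 0} {k : X ⟶ Z} {q : Z ⟶ V} {w'' : k ≫ q = 0}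
    (h : S (ShortComplex.mk i p w)) (h' : S (ShortComplex.mk j r w'))
    (h'' : S (ShortComplex.mk k q w'')) (hk : i ≫ j = k) :
    ∃ (a : U ⟶ V) (b : V ⟶ R) (wab : a ≫ b = 0), S (ShortComplex.mk a b wab) ∧
      p ≫ a = j ≫ q ∧ q ≫ b = r := by
  have := conflation_epi h
  have := conflation_epi h'
  have := conflation_epi h''
  obtain ⟨a, ha⟩ := conflation_desc h (j ≫ q) (by rw [← Category.assoc, hk, w''])
  obtain ⟨b, hb⟩ := conflation_desc h'' r (by rw [← hk, Category.assoc, w', comp_zero])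
  have wab : a ≫ b = 0 := by
    rw [← cancel_epi p, reassoc_of% ha, hb, w', comp_zero]
  have sq : IsPushout j p q a := isPushout_of_exists_desc ha.symm
    (fun {W} c d hcd => by
      obtain ⟨l, hl⟩ := conflation_desc h'' c (by
        rw [← hk, Category.assoc, hcd, reassoc_of% w, zero_comp])
      exact ⟨l, hl, by rw [← cancel_epi p, reassoc_of% ha, hl, hcd]⟩)
    (fun l hl _ => by rw [← cancel_epi q, hl, comp_zero])
  refine ⟨a, b, wab, conflation_of_admissibleMono _ (.of_isPushout sq ⟨_, _, _, h'⟩)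
    (epi_of_epi_fac hb) ?_, ha, hb⟩
  intro W f hf
  obtain ⟨l, hl⟩ := conflation_desc h' (q ≫ f) (by
    rw [← reassoc_of% ha, hf, comp_zero])
  exact ⟨l, by rw [← cancel_epi q, reassoc_of% hb, hl]⟩

/-- If a morphism of conflations is an isomorphism on the cokernels and a deflation with kernel `k`
on the first objects, then it is a deflation on the middle objects, with the same kernel. -/
lemma conflation_τ₂_of_isIso_τ₃ {T T' : ShortComplex C} (hT : S T) (hT' : S T') (φ : T ⟶ T')
    [IsIso φ.τ₃] {K : C} {k : K ⟶ T.X₁} {w : k ≫ φ.τ₁ = 0} (h : S (ShortComplex.mk k φ.τ₁ w)) :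
    S (ShortComplex.mk (k ≫ T.f) φ.τ₂ (by rw [Category.assoc, ← φ.comm₁₂, reassoc_of% w,
      zero_comp])) := by
  have := conflation_epi h
  have := conflation_epi hT
  -- The quotient `Z` of `T.X₂` by `K` is an extension of `T.X₃` by `T'.X₁`; the short five lemma
  -- identifies it with `T'.X₂`.
  obtain ⟨Z, p, w', h'⟩ := IsExactStructure.comp_mono k T.f ⟨_, _, _, h⟩ ⟨_, _, _, hT⟩
  have := conflation_epi h'
  obtain ⟨u, hu⟩ := conflation_desc h' φ.τ₂ (by
    rw [Category.assoc, ← φ.comm₁₂, reassoc_of% w, zero_comp])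
  obtain ⟨a, b, wab, hab, ha, hb⟩ := conflation_cokernels_comp h hT h' rfl
  let ψ : ShortComplex.mk a b wab ⟶ T' :=
    { τ₁ := 𝟙 _
      τ₂ := u
      τ₃ := φ.τ₃
      comm₁₂ := by
        dsimp
        rw [Category.id_comp, ← cancel_epi φ.τ₁, reassoc_of% ha, hu, φ.comm₁₂]
      comm₂₃ := by
        dsimp
        rw [← cancel_epi p, reassoc_of% hu, reassoc_of% hb, φ.comm₂₃] }
  have : IsIso ψ.τ₁ := by dsimp [ψ]; infer_instance
  have : IsIso ψ.τ₃ := by dsimp [ψ]; infer_instance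
  have : IsIso u := isIso_τ₂_of_conflation hab hT' ψ
  exact conflation_of_iso h' _ (Iso.refl _) (Iso.refl _) (asIso u) (by simp) (by simp [hu])

/-- A morphism of conflations which is a deflation on both ends factors, in the middle, through
the pullback of the second conflation; both factors are deflations. -/
lemma exists_factorization_τ₂ {T T' : ShortComplex C} (hT : S T) (hT' : S T') (φ : T ⟶ T')
    {K₁ K₃ : C} {k₁ : K₁ ⟶ T.X₁} {w₁ : k₁ ≫ φ.τ₁ = 0} (h₁ : S (ShortComplex.mk k₁ φ.τ₁ w₁))
    {k₃ : K₃ ⟶ T.X₃} {w₃ : k₃ ≫ φ.τ₃ = 0} (h₃ : S (ShortComplex.mk k₃ φ.τ₃ w₃)) :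
    ∃ (D : C) (u : T.X₂ ⟶ D) (d₁ : D ⟶ T'.X₂) (d₂ : D ⟶ T.X₃) (l : K₃ ⟶ D)
      (wu : (k₁ ≫ T.f) ≫ u = 0) (wl : l ≫ d₁ = 0),
      IsPullback d₁ d₂ T'.g φ.τ₃ ∧ u ≫ d₁ = φ.τ₂ ∧ u ≫ d₂ = T.g ∧ l ≫ d₂ = k₃ ∧
      S (ShortComplex.mk (k₁ ≫ T.f) u wu) ∧ S (ShortComplex.mk l d₁ wl) := by
  obtain ⟨D, d₁, d₂, sq, -⟩ := IsExactStructure.pullback T'.g φ.τ₃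
    (⟨_, _, _, hT'⟩ : AdmissibleEpi S T'.g)
  obtain ⟨i, wi, hi, hi'⟩ := conflation_pullback hT' sq
  obtain ⟨l, wl, hl, hl'⟩ := conflation_pullback h₃ sq.flip
  let ψ : T ⟶ ShortComplex.mk i d₂ wi :=
    { τ₁ := φ.τ₁
      τ₂ := sq.lift φ.τ₂ T.g φ.comm₂₃
      τ₃ := 𝟙 _
      comm₁₂ := sq.hom_ext (by simp [hi', φ.comm₁₂]) (by simp [wi])
      comm₂₃ := by simp }
  have : IsIso ψ.τ₃ := by dsimp [ψ]; infer_instance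
  exact ⟨D, ψ.τ₂, d₁, d₂, l, _, wl, sq, sq.lift_fst _ _ _, sq.lift_snd _ _ _, hl',
    conflation_τ₂_of_isIso_τ₃ hT hi ψ h₁, hl⟩

/-- Both factors through the pullback are deflations. This is the tool that makes arrows induced on
kernels, cokernels, pushouts and pullbacks into objects of `MorEpi S` again. -/
lemma admissibleEpi_τ₂ {T T' : ShortComplex C} (hT : S T) (hT' : S T') (φ : T ⟶ T')
    (h₁ : AdmissibleEpi S φ.τ₁) (h₃ : AdmissibleEpi S φ.τ₃) : AdmissibleEpi S φ.τ₂ := by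
  obtain ⟨_, _, _, h₁⟩ := h₁
  obtain ⟨_, _, _, h₃⟩ := h₃
  obtain ⟨D, u, d₁, d₂, l, wu, wl, -, h, -, -, hu, hd⟩ := exists_factorization_τ₂ hT hT' φ h₁ h₃
  rw [← h]
  exact IsExactStructure.comp_epi _ _ ⟨_, _, _, hu⟩ ⟨_, _, _, hd⟩

/-- The conflation of the kernels of a morphism of conflations, all of whose components are
deflations. -/
lemma conflation_kernels {T T' : ShortComplex C} (hT : S T) (hT' : S T') (φ : T ⟶ T')
    {K₁ K₂ K₃ : C} {k₁ : K₁ ⟶ T.X₁} {w₁ : k₁ ≫ φ.τ₁ = 0} (h₁ : S (ShortComplex.mk k₁ φ.τ₁ w₁))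
    {k₂ : K₂ ⟶ T.X₂} {w₂ : k₂ ≫ φ.τ₂ = 0} (h₂ : S (ShortComplex.mk k₂ φ.τ₂ w₂))
    {k₃ : K₃ ⟶ T.X₃} {w₃ : k₃ ≫ φ.τ₃ = 0} (h₃ : S (ShortComplex.mk k₃ φ.τ₃ w₃)) :
    ∃ (a : K₁ ⟶ K₂) (b : K₂ ⟶ K₃) (w : a ≫ b = 0), S (ShortComplex.mk a b w) ∧
      a ≫ k₂ = k₁ ≫ T.f ∧ b ≫ k₃ = k₂ ≫ T.g := by
  obtain ⟨D, u, d₁, d₂, l, wu, wl, -, h, h', h'', hu, hd⟩ :=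
    exists_factorization_τ₂ hT hT' φ h₁ h₃
  obtain ⟨a, b, wab, hab, ha, hb⟩ := conflation_kernels_comp hu hd h₂ h
  exact ⟨a, b, wab, hab, ha, by rw [← h', reassoc_of% hb, h'']⟩

variable (S) in
lemma conflation_zero_left (X : C) {Z : C} (hZ : IsZero Z) :
    S (ShortComplex.mk (0 : Z ⟶ X) (𝟙 X) (by simp)) :=
  conflation_of_admissibleEpi _ (IsExactStructure.id_epi X)
    ⟨fun _ _ _ => hZ.eq_of_tgt _ _⟩ (fun f hf => ⟨0, by simpa using hf.symm⟩)

variable (S) in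
lemma conflation_zero_right (X : C) {Z : C} (hZ : IsZero Z) :
    S (ShortComplex.mk (𝟙 X) (0 : X ⟶ Z) (by simp)) :=
  conflation_of_admissibleMono _ (IsExactStructure.id_mono X)
    ⟨fun _ _ _ => hZ.eq_of_src _ _⟩ (fun f hf => ⟨0, by simpa using hf.symm⟩)

variable (S) in
lemma admissibleEpi_of_isIso {X Y : C} (f : X ⟶ Y) [IsIso f] : AdmissibleEpi S f := by
  simpa using AdmissibleEpi.comp_iso (IsExactStructure.id_epi (S := S) X) (asIso f)

variable (S) in
lemma admissibleMono_of_isIso {X Y : C} (f : X ⟶ Y) [IsIso f] : AdmissibleMono S f := by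
  simpa using AdmissibleMono.comp_iso (IsExactStructure.id_mono (S := S) X) (asIso f)

variable (S) in
lemma conflation_biprod (X Y : C) :
    S (ShortComplex.mk (biprod.inl : X ⟶ X ⊞ Y) biprod.snd (by simp)) := by
  have sq : IsPullback (biprod.fst : X ⊞ Y ⟶ X) biprod.snd (0 : X ⟶ 0) 0 :=
    isPullback_of_exists_lift (by simp) (fun a b _ => ⟨biprod.lift a b, by simp, by simp⟩)
      (fun l h h' => by ext <;> simp [h, h'])
  refine conflation_of_admissibleEpi _
    (.of_isPullback sq ⟨_, _, _, conflation_zero_right S X (isZero_zero C)⟩) inferInstance ?_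
  intro W f hf
  exact ⟨f ≫ biprod.fst, by ext <;> simp [hf]⟩

/-- Up to a shear automorphism of `Z ⊞ X`, the map is the inflation `inr` followed by `𝟙 ⊕ i`, a
pushout of `i`. Applied to an injective hull `i`, it turns an arbitrary morphism `f` into an
inflation without changing it stably. -/
lemma AdmissibleMono.biprod_lift {X Y Z : C} {i : X ⟶ Y} (hi : AdmissibleMono S i) (f : X ⟶ Z) :
    AdmissibleMono S (biprod.lift f i) := by
  have sq : IsPushout i (biprod.inr : X ⟶ Z ⊞ X) (biprod.inr : Y ⟶ Z ⊞ Y)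
      (biprod.map (𝟙 Z) i) :=
    isPushout_of_exists_desc (by simp)
      (fun a b h => ⟨biprod.desc (biprod.inl ≫ b) a, by simp, by ext <;> simp [h]⟩)
      (fun l h h' => by
        ext
        · simpa using biprod.inl ≫= h'
        · simpa using h)
  let e : Z ⊞ X ≅ Z ⊞ X :=
    { hom := biprod.desc biprod.inl (biprod.lift f (𝟙 _))
      inv := biprod.desc biprod.inl (biprod.lift (-f) (𝟙 _))
      hom_inv_id := by ext <;> simp
      inv_hom_id := by ext <;> simp }
  have h₀ : AdmissibleMono S (biprod.inr : X ⟶ Z ⊞ X) := by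
    have := AdmissibleMono.comp_iso (S := S) ⟨_, _, _, conflation_biprod S X Z⟩
      (biprod.braiding X Z)
    convert this using 1
    ext <;> simp
  have := IsExactStructure.comp_mono _ _ (h₀.comp_iso e) (.of_isPushout sq hi)
  convert this using 1
  ext <;> simp [e]

/-- Dual shear argument. Applied to a projective cover `p`, it turns an arbitrary arrow `f` into a
deflation. -/
lemma AdmissibleEpi.biprod_desc {X Y Z : C} {p : X ⟶ Y} (hp : AdmissibleEpi S p) (f : Z ⟶ Y) :
    AdmissibleEpi S (biprod.desc f p) := by
  have h := hp.biprod_map (IsExactStructure.id_epi (S := S) Z)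
  have sq : IsPullback (biprod.snd : Z ⊞ X ⟶ X) (biprod.map (𝟙 Z) p) p biprod.snd :=
    isPullback_of_exists_lift (by simp)
      (fun a b h => ⟨biprod.lift (b ≫ biprod.fst) a, by simp, by ext <;> simp [h]⟩)
      (fun l h h' => by
        ext
        · simpa using h' =≫ biprod.fst
        · simpa using h)
  let e : Z ⊞ Y ≅ Z ⊞ Y :=
    { hom := biprod.lift biprod.fst (biprod.desc f (𝟙 _))
      inv := biprod.lift biprod.fst (biprod.desc (-f) (𝟙 _))
      hom_inv_id := by ext <;> simp
      inv_hom_id := by ext <;> simp }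
  have h₀ : AdmissibleEpi S (biprod.snd : Z ⊞ Y ⟶ Y) := ⟨_, _, _, conflation_biprod S Z Y⟩
  have := IsExactStructure.comp_epi _ _ (.of_isPullback sq hp) (h₀.iso_comp e)
  convert this using 1
  ext <;> simp [e]

end ExactLemmas

end ExactCat

namespace ExactCat

/-! ### The Frobenius structure on the category of admissible epimorphisms -/

section MorEpiExact

variable {C : Type u} [Category.{v} C] [Preadditive C]

section

variable (S : ObjectProperty (ShortComplex C))

/-- The source functor on the category of admissible epimorphisms. -/
abbrev MorEpi.leftFunctor : MorEpi S ⥤ C := ObjectProperty.ι _ ⋙ Arrow.leftFunc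

/-- The target functor on the category of admissible epimorphisms. -/
abbrev MorEpi.rightFunctor : MorEpi S ⥤ C := ObjectProperty.ι _ ⋙ Arrow.rightFunc

variable {S}

/-- An admissible epimorphism, as an object of the category of admissible epimorphisms. -/
abbrev MorEpi.of {X Y : C} {p : X ⟶ Y} (hp : AdmissibleEpi S p) : MorEpi S := ⟨Arrow.mk p, hp⟩

/-- A commutative square, as a morphism of the category of admissible epimorphisms. -/
abbrev MorEpi.ofHom {α β : MorEpi S} (l : α.obj.left ⟶ β.obj.left) (r : α.obj.right ⟶ β.obj.right)
    (w : l ≫ β.obj.hom = α.obj.hom ≫ r) : α ⟶ β :=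
  ObjectProperty.homMk (Arrow.homMk l r w)

lemma MorEpi.hom_ext {α β : MorEpi S} {f g : α ⟶ β} (h₁ : f.hom.left = g.hom.left)
    (h₂ : f.hom.right = g.hom.right) : f = g :=
  ObjectProperty.hom_ext _ (Arrow.hom_ext _ _ h₁ h₂)

lemma MorEpi.w {α β : MorEpi S} (f : α ⟶ β) :
    f.hom.left ≫ β.obj.hom = α.obj.hom ≫ f.hom.right :=
  Arrow.w f.hom

end

variable [HasZeroObject C] [HasBinaryBiproducts C]
variable {S : ObjectProperty (ShortComplex C)} [IsExactStructure S]

lemma morEpi_conflation_mk {α β γ : MorEpi S} {i : α ⟶ β} {p : β ⟶ γ}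
    {w₁ : i.hom.left ≫ p.hom.left = 0} (h₁ : S (ShortComplex.mk i.hom.left p.hom.left w₁))
    {w₂ : i.hom.right ≫ p.hom.right = 0} (h₂ : S (ShortComplex.mk i.hom.right p.hom.right w₂)) :
    ∃ w : i ≫ p = 0, morEpiConflations S (ShortComplex.mk i p w) :=
  ⟨MorEpi.hom_ext w₁ w₂, h₁, h₂⟩

/-- In the axioms on composites and pushouts (dually pullbacks), componentwise conflations come for
free; what needs an argument is that the induced arrow is a deflation. -/
lemma morEpi_admissibleMono {α β : MorEpi S} (i : α ⟶ β) {Z Z' : C} {p : β.obj.left ⟶ Z}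
    {w : i.hom.left ≫ p = 0} (h : S (ShortComplex.mk i.hom.left p w)) {p' : β.obj.right ⟶ Z'}
    {w' : i.hom.right ≫ p' = 0} (h' : S (ShortComplex.mk i.hom.right p' w')) {c : Z ⟶ Z'}
    (hc : AdmissibleEpi S c) (hpc : p ≫ c = β.obj.hom ≫ p') :
    AdmissibleMono (morEpiConflations S) i :=
  ⟨MorEpi.of hc, MorEpi.ofHom p p' hpc, morEpi_conflation_mk h h'⟩

lemma morEpi_admissibleEpi {α β : MorEpi S} (p : α ⟶ β) {K K' : C} {i : K ⟶ α.obj.left}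
    {w : i ≫ p.hom.left = 0} (h : S (ShortComplex.mk i p.hom.left w)) {i' : K' ⟶ α.obj.right}
    {w' : i' ≫ p.hom.right = 0} (h' : S (ShortComplex.mk i' p.hom.right w')) {k : K ⟶ K'}
    (hk : AdmissibleEpi S k) (hik : i ≫ α.obj.hom = k ≫ i') :
    AdmissibleEpi (morEpiConflations S) p :=
  ⟨MorEpi.of hk, MorEpi.ofHom i i' hik, morEpi_conflation_mk h h'⟩

lemma morEpi_conflation_of_iso {T T' : ShortComplex (MorEpi S)} (e : T ≅ T')
    (hT : morEpiConflations S T) : morEpiConflations S T' := by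
  let e₁ := ShortComplex.π₁.mapIso e
  let e₂ := ShortComplex.π₂.mapIso e
  let e₃ := ShortComplex.π₃.mapIso e
  exact ⟨conflation_of_iso hT.1 _ ((MorEpi.leftFunctor S).mapIso e₁)
      ((MorEpi.leftFunctor S).mapIso e₂) ((MorEpi.leftFunctor S).mapIso e₃)
      (congrArg (fun k : T.X₁ ⟶ T'.X₂ => k.hom.left) e.hom.comm₁₂)
      (congrArg (fun k : T.X₂ ⟶ T'.X₃ => k.hom.left) e.hom.comm₂₃),
    conflation_of_iso hT.2 _ ((MorEpi.rightFunctor S).mapIso e₁)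
      ((MorEpi.rightFunctor S).mapIso e₂) ((MorEpi.rightFunctor S).mapIso e₃)
      (congrArg (fun k : T.X₁ ⟶ T'.X₂ => k.hom.right) e.hom.comm₁₂)
      (congrArg (fun k : T.X₂ ⟶ T'.X₃ => k.hom.right) e.hom.comm₂₃)⟩

lemma morEpi_conflation_kernel (T : ShortComplex (MorEpi S)) (hT : morEpiConflations S T) :
    Nonempty (IsLimit (KernelFork.ofι T.f T.zero)) := by
  have h₁ := conflation_mono hT.1
  have h₂ := conflation_mono hT.2
  have hl {W : MorEpi S} (f : W ⟶ T.X₂) (hf : f ≫ T.g = 0) : ∃ l : W ⟶ T.X₁, l ≫ T.f = f := by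
    obtain ⟨a, ha⟩ := conflation_lift hT.1 f.hom.left
      (congrArg (fun k : W ⟶ T.X₃ => k.hom.left) hf)
    obtain ⟨b, hb⟩ := conflation_lift hT.2 f.hom.right
      (congrArg (fun k : W ⟶ T.X₃ => k.hom.right) hf)
    refine ⟨MorEpi.ofHom a b ?_, MorEpi.hom_ext ha hb⟩
    rw [← cancel_mono T.f.hom.right, Category.assoc, Category.assoc, hb, ← MorEpi.w f, ← ha,
      Category.assoc, MorEpi.w T.f]
  refine ⟨KernelFork.IsLimit.ofι _ _ (fun f hf => (hl f hf).choose)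
    (fun f hf => (hl f hf).choose_spec) (fun f hf m hm => ?_)⟩
  have hm' := hm.trans (hl f hf).choose_spec.symm
  refine MorEpi.hom_ext ?_ ?_
  · rw [← cancel_mono T.f.hom.left]
    exact congrArg (fun k : _ ⟶ T.X₂ => k.hom.left) hm'
  · rw [← cancel_mono T.f.hom.right]
    exact congrArg (fun k : _ ⟶ T.X₂ => k.hom.right) hm'

lemma morEpi_conflation_cokernel (T : ShortComplex (MorEpi S)) (hT : morEpiConflations S T) :
    Nonempty (IsColimit (CokernelCofork.ofπ T.g T.zero)) := by
  have h₁ := conflation_epi hT.1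
  have h₂ := conflation_epi hT.2
  have hl {W : MorEpi S} (f : T.X₂ ⟶ W) (hf : T.f ≫ f = 0) : ∃ l : T.X₃ ⟶ W, T.g ≫ l = f := by
    obtain ⟨a, ha⟩ := conflation_desc hT.1 f.hom.left
      (congrArg (fun k : T.X₁ ⟶ W => k.hom.left) hf)
    obtain ⟨b, hb⟩ := conflation_desc hT.2 f.hom.right
      (congrArg (fun k : T.X₁ ⟶ W => k.hom.right) hf)
    refine ⟨MorEpi.ofHom a b ?_, MorEpi.hom_ext ha hb⟩
    rw [← cancel_epi T.g.hom.left, reassoc_of% ha, reassoc_of% (MorEpi.w T.g), hb, MorEpi.w f]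
  refine ⟨CokernelCofork.IsColimit.ofπ _ _ (fun f hf => (hl f hf).choose)
    (fun f hf => (hl f hf).choose_spec) (fun f hf m hm => ?_)⟩
  have hm' := hm.trans (hl f hf).choose_spec.symm
  refine MorEpi.hom_ext ?_ ?_
  · rw [← cancel_epi T.g.hom.left]
    exact congrArg (fun k : T.X₂ ⟶ _ => k.hom.left) hm'
  · rw [← cancel_epi T.g.hom.right]
    exact congrArg (fun k : T.X₂ ⟶ _ => k.hom.right) hm'

/-- The cokernel of a composite inflation is an extension of the cokernel of `j` by that of `i`,
both on sources and on targets. The induced arrow `c` is a deflation on both ends of this extension,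
hence in the middle. -/
lemma morEpi_comp_mono {X Y Z : MorEpi S} (i : X ⟶ Y) (j : Y ⟶ Z)
    (hi : AdmissibleMono (morEpiConflations S) i) (hj : AdmissibleMono (morEpiConflations S) j) :
    AdmissibleMono (morEpiConflations S) (i ≫ j) := by
  obtain ⟨U, p, w, h, h'⟩ := hi
  obtain ⟨R, r, w', k, k'⟩ := hj
  obtain ⟨V, q, wq, hq⟩ := IsExactStructure.comp_mono (S := S) i.hom.left j.hom.left
    ⟨_, _, _, h⟩ ⟨_, _, _, k⟩
  obtain ⟨V', q', wq', hq'⟩ := IsExactStructure.comp_mono (S := S) i.hom.right j.hom.right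
    ⟨_, _, _, h'⟩ ⟨_, _, _, k'⟩
  obtain ⟨a, b, wab, hab, ha, hb⟩ := conflation_cokernels_comp h k hq rfl
  obtain ⟨a', b', wab', hab', ha', hb'⟩ := conflation_cokernels_comp h' k' hq' rfl
  have := conflation_epi h
  have := conflation_epi hq
  obtain ⟨c, hc⟩ := conflation_desc hq (Z.obj.hom ≫ q') (by
    rw [Category.assoc, reassoc_of% (MorEpi.w j), reassoc_of% (MorEpi.w i)]
    rw [Category.assoc] at wq'
    rw [wq', comp_zero])
  refine morEpi_admissibleMono (i ≫ j) hq hq' ?_ hc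
  refine admissibleEpi_τ₂ hab hab'
    { τ₁ := U.obj.hom, τ₂ := c, τ₃ := R.obj.hom, comm₁₂ := ?_, comm₂₃ := ?_ } U.property
    R.property
  · dsimp at ha ha' ⊢
    rw [← cancel_epi p.hom.left, reassoc_of% (MorEpi.w p), ha', reassoc_of% ha, hc,
      reassoc_of% (MorEpi.w j)]
  · dsimp at hb hb' ⊢
    rw [← cancel_epi q, reassoc_of% hc, hb', reassoc_of% hb, MorEpi.w r]

lemma morEpi_comp_epi {X Y Z : MorEpi S} (p : X ⟶ Y) (q : Y ⟶ Z)
    (hp : AdmissibleEpi (morEpiConflations S) p) (hq : AdmissibleEpi (morEpiConflations S) q) :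
    AdmissibleEpi (morEpiConflations S) (p ≫ q) := by
  obtain ⟨K, i, w, h, h'⟩ := hp
  obtain ⟨L, j, w', k, k'⟩ := hq
  obtain ⟨M, m, wm, hm⟩ := IsExactStructure.comp_epi (S := S) p.hom.left q.hom.left
    ⟨_, _, _, h⟩ ⟨_, _, _, k⟩
  obtain ⟨M', m', wm', hm'⟩ := IsExactStructure.comp_epi (S := S) p.hom.right q.hom.right
    ⟨_, _, _, h'⟩ ⟨_, _, _, k'⟩
  obtain ⟨a, b, wab, hab, ha, hb⟩ := conflation_kernels_comp h k hm rfl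
  obtain ⟨a', b', wab', hab', ha', hb'⟩ := conflation_kernels_comp h' k' hm' rfl
  have := conflation_mono k'
  have := conflation_mono hm'
  obtain ⟨c, hc⟩ := conflation_lift hm' (m ≫ X.obj.hom) (by
    rw [Category.assoc, ← reassoc_of% (MorEpi.w p), ← MorEpi.w q, reassoc_of% wm, zero_comp])
  refine morEpi_admissibleEpi (p ≫ q) hm hm' ?_ hc.symm
  refine admissibleEpi_τ₂ hab hab'
    { τ₁ := K.obj.hom, τ₂ := c, τ₃ := L.obj.hom, comm₁₂ := ?_, comm₂₃ := ?_ } K.property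
    L.property
  · dsimp at ha ha' ⊢
    rw [← cancel_mono m', Category.assoc, Category.assoc, ha', hc, reassoc_of% ha, MorEpi.w i]
  · dsimp at hb hb' ⊢
    rw [← cancel_mono j.hom.right, Category.assoc, Category.assoc, ← hb', reassoc_of% hc,
      ← MorEpi.w j, ← reassoc_of% hb, MorEpi.w p]

lemma morEpi_pushout {X Y X' : MorEpi S} (i : X ⟶ Y) (f : X ⟶ X')
    (hi : AdmissibleMono (morEpiConflations S) i) :
    ∃ (Y' : MorEpi S) (f' : Y ⟶ Y') (i' : X' ⟶ Y'), IsPushout i f f' i' ∧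
      AdmissibleMono (morEpiConflations S) i' := by
  obtain ⟨Z, p, w, h, h'⟩ := hi
  obtain ⟨D, f₁, i₁, sq, -⟩ := IsExactStructure.pushout (S := S) i.hom.left f.hom.left
    ⟨_, _, _, h⟩
  obtain ⟨D', f₂, i₂, sq', -⟩ := IsExactStructure.pushout (S := S) i.hom.right f.hom.right
    ⟨_, _, _, h'⟩
  obtain ⟨q, wq, hq, hq₁⟩ := conflation_pushout h sq
  obtain ⟨q', wq', hq', hq₁'⟩ := conflation_pushout h' sq'
  let d : D ⟶ D' := sq.desc (Y.obj.hom ≫ f₂) (X'.obj.hom ≫ i₂) (by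
    rw [reassoc_of% (MorEpi.w i), reassoc_of% (MorEpi.w f), sq'.w])
  have hd₁ : f₁ ≫ d = Y.obj.hom ≫ f₂ := sq.inl_desc _ _ _
  have hd₂ : i₁ ≫ d = X'.obj.hom ≫ i₂ := sq.inr_desc _ _ _
  have comm₂₃ : d ≫ q' = q ≫ Z.obj.hom := by
    apply sq.hom_ext
    · rw [reassoc_of% hd₁, hq₁', reassoc_of% hq₁, MorEpi.w]
    · rw [reassoc_of% hd₂, wq', reassoc_of% wq, comp_zero, zero_comp]
  -- Sources and targets of the pushout are extensions of those of `Z` by those of `X'`.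
  have hd : AdmissibleEpi S d := admissibleEpi_τ₂ hq hq'
    { τ₁ := X'.obj.hom, τ₂ := d, τ₃ := Z.obj.hom, comm₁₂ := hd₂.symm, comm₂₃ := comm₂₃ }
    X'.property Z.property
  refine ⟨MorEpi.of hd, MorEpi.ofHom f₁ f₂ hd₁, MorEpi.ofHom i₁ i₂ hd₂,
    isPushout_of_exists_desc (MorEpi.hom_ext sq.w sq'.w) ?_ ?_,
    morEpi_admissibleMono _ hq hq' Z.property comm₂₃.symm⟩
  · intro W a b hab
    have hab₁ := congrArg (fun k : X ⟶ W => k.hom.left) hab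
    have hab₂ := congrArg (fun k : X ⟶ W => k.hom.right) hab
    obtain ⟨l, hl, hl'⟩ : ∃ l : D ⟶ W.obj.left, f₁ ≫ l = a.hom.left ∧ i₁ ≫ l = b.hom.left :=
      ⟨sq.desc _ _ hab₁, sq.inl_desc _ _ _, sq.inr_desc _ _ _⟩
    obtain ⟨r, hr, hr'⟩ : ∃ r : D' ⟶ W.obj.right,
        f₂ ≫ r = a.hom.right ∧ i₂ ≫ r = b.hom.right :=
      ⟨sq'.desc _ _ hab₂, sq'.inl_desc _ _ _, sq'.inr_desc _ _ _⟩
    have hlr : l ≫ W.obj.hom = d ≫ r := sq.hom_ext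
      (by rw [reassoc_of% hl, reassoc_of% hd₁, hr, MorEpi.w])
      (by rw [reassoc_of% hl', reassoc_of% hd₂, hr', MorEpi.w])
    exact ⟨MorEpi.ofHom l r hlr, MorEpi.hom_ext hl hr, MorEpi.hom_ext hl' hr'⟩
  · intro W l h₁ h₂
    exact MorEpi.hom_ext
      (sq.hom_ext ((congrArg (fun k : Y ⟶ W => k.hom.left) h₁).trans comp_zero.symm)
        ((congrArg (fun k : X' ⟶ W => k.hom.left) h₂).trans comp_zero.symm))
      (sq'.hom_ext ((congrArg (fun k : Y ⟶ W => k.hom.right) h₁).trans comp_zero.symm)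
        ((congrArg (fun k : X' ⟶ W => k.hom.right) h₂).trans comp_zero.symm))

lemma morEpi_pullback {Y Z Z' : MorEpi S} (p : Y ⟶ Z) (f : Z' ⟶ Z)
    (hp : AdmissibleEpi (morEpiConflations S) p) :
    ∃ (Y' : MorEpi S) (f' : Y' ⟶ Y) (p' : Y' ⟶ Z'), IsPullback f' p' p f ∧
      AdmissibleEpi (morEpiConflations S) p' := by
  obtain ⟨X, i, w, h, h'⟩ := hp
  obtain ⟨D, f₁, p₁, sq, -⟩ := IsExactStructure.pullback (S := S) p.hom.left f.hom.left
    ⟨_, _, _, h⟩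
  obtain ⟨D', f₂, p₂, sq', -⟩ := IsExactStructure.pullback (S := S) p.hom.right f.hom.right
    ⟨_, _, _, h'⟩
  obtain ⟨j, wj, hj, hj₁⟩ := conflation_pullback h sq
  obtain ⟨j', wj', hj', hj₁'⟩ := conflation_pullback h' sq'
  let d : D ⟶ D' := sq'.lift (f₁ ≫ Y.obj.hom) (p₁ ≫ Z'.obj.hom) (by
    rw [Category.assoc, Category.assoc, ← MorEpi.w p, ← MorEpi.w f, sq.w_assoc])
  have hd₁ : d ≫ f₂ = f₁ ≫ Y.obj.hom := sq'.lift_fst _ _ _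
  have hd₂ : d ≫ p₂ = p₁ ≫ Z'.obj.hom := sq'.lift_snd _ _ _
  have comm₁₂ : j ≫ d = X.obj.hom ≫ j' := by
    apply sq'.hom_ext
    · rw [Category.assoc, Category.assoc, hd₁, hj₁', reassoc_of% hj₁, MorEpi.w]
    · rw [Category.assoc, Category.assoc, hd₂, wj', reassoc_of% wj, comp_zero, zero_comp]
  have hd : AdmissibleEpi S d := admissibleEpi_τ₂ hj hj'
    { τ₁ := X.obj.hom, τ₂ := d, τ₃ := Z'.obj.hom, comm₁₂ := comm₁₂.symm, comm₂₃ := hd₂ }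
    X.property Z'.property
  refine ⟨MorEpi.of hd, MorEpi.ofHom f₁ f₂ hd₁.symm, MorEpi.ofHom p₁ p₂ hd₂.symm,
    isPullback_of_exists_lift (MorEpi.hom_ext sq.w sq'.w) ?_ ?_,
    morEpi_admissibleEpi _ hj hj' X.property comm₁₂⟩
  · intro W a b hab
    have hab₁ := congrArg (fun k : W ⟶ Z => k.hom.left) hab
    have hab₂ := congrArg (fun k : W ⟶ Z => k.hom.right) hab
    obtain ⟨l, hl, hl'⟩ : ∃ l : W.obj.left ⟶ D, l ≫ f₁ = a.hom.left ∧ l ≫ p₁ = b.hom.left :=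
      ⟨sq.lift _ _ hab₁, sq.lift_fst _ _ _, sq.lift_snd _ _ _⟩
    obtain ⟨r, hr, hr'⟩ : ∃ r : W.obj.right ⟶ D',
        r ≫ f₂ = a.hom.right ∧ r ≫ p₂ = b.hom.right :=
      ⟨sq'.lift _ _ hab₂, sq'.lift_fst _ _ _, sq'.lift_snd _ _ _⟩
    have hlr : l ≫ d = W.obj.hom ≫ r := sq'.hom_ext
      (by rw [Category.assoc, Category.assoc, hd₁, hr, reassoc_of% hl, MorEpi.w])
      (by rw [Category.assoc, Category.assoc, hd₂, hr', reassoc_of% hl', MorEpi.w])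
    exact ⟨MorEpi.ofHom l r hlr, MorEpi.hom_ext hl hr, MorEpi.hom_ext hl' hr'⟩
  · intro W l h₁ h₂
    exact MorEpi.hom_ext
      (sq.hom_ext ((congrArg (fun k : W ⟶ Y => k.hom.left) h₁).trans zero_comp.symm)
        ((congrArg (fun k : W ⟶ Z' => k.hom.left) h₂).trans zero_comp.symm))
      (sq'.hom_ext ((congrArg (fun k : W ⟶ Y => k.hom.right) h₁).trans zero_comp.symm)
        ((congrArg (fun k : W ⟶ Z' => k.hom.right) h₂).trans zero_comp.symm))

instance : IsExactStructure (morEpiConflations S) where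
  of_iso := morEpi_conflation_of_iso
  kernel := morEpi_conflation_kernel
  cokernel := morEpi_conflation_cokernel
  id_mono X := morEpi_admissibleMono (𝟙 X) (conflation_zero_right S _ (isZero_zero C))
    (conflation_zero_right S _ (isZero_zero C)) (IsExactStructure.id_epi 0) (by simp)
  id_epi X := morEpi_admissibleEpi (𝟙 X) (conflation_zero_left S _ (isZero_zero C))
    (conflation_zero_left S _ (isZero_zero C)) (IsExactStructure.id_epi 0) (by simp)
  comp_mono := morEpi_comp_mono
  comp_epi := morEpi_comp_epi
  pushout := morEpi_pushout
  pullback := morEpi_pullback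

end MorEpiExact

end ExactCat

namespace ExactCat

/-! ### Projective and injective deflations. -/

section MorEpiFrobenius

variable {C : Type u} [Category.{v} C] [Preadditive C]
variable {S : ObjectProperty (ShortComplex C)}

lemma projectives_lift {P Y Z : C} (hP : projectives S P) {p : Y ⟶ Z} (hp : AdmissibleEpi S p)
    (f : P ⟶ Z) : ∃ g : P ⟶ Y, g ≫ p = f := by
  obtain ⟨_, _, _, h⟩ := hp
  exact hP _ h f

lemma injectives_extend {I X Y : C} (hI : injectives S I) {i : X ⟶ Y} (hi : AdmissibleMono S i)
    (f : X ⟶ I) : ∃ g : Y ⟶ I, i ≫ g = f := by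
  obtain ⟨_, _, _, h⟩ := hi
  exact hI _ h f

lemma projectives_of_retract {P Q : C} (hQ : projectives S Q) (i : P ⟶ Q) (r : Q ⟶ P)
    (h : i ≫ r = 𝟙 P) : projectives S P := by
  intro T hT f
  obtain ⟨g, hg⟩ := hQ T hT (r ≫ f)
  exact ⟨i ≫ g, by rw [Category.assoc, hg, reassoc_of% h]⟩

variable [HasZeroObject C] [HasBinaryBiproducts C]

lemma exists_projective_cover [IsFrobenius S] (X : C) :
    ∃ (K P : C) (i : K ⟶ P) (p : P ⟶ X) (w : i ≫ p = 0),
      projectives S P ∧ S (ShortComplex.mk i p w) :=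
  IsFrobenius.enough_projectives X

lemma exists_injective_hull [IsFrobenius S] (X : C) :
    ∃ (I Z : C) (i : X ⟶ I) (p : I ⟶ Z) (w : i ≫ p = 0),
      projectives S I ∧ S (ShortComplex.mk i p w) := by
  rw [IsFrobenius.projectives_eq_injectives (S := S)]
  exact IsFrobenius.enough_injectives X

lemma projectives_extend [IsFrobenius S] {I X Y : C} (hI : projectives S I) {i : X ⟶ Y}
    (hi : AdmissibleMono S i) (f : X ⟶ I) : ∃ g : Y ⟶ I, i ≫ g = f := by
  rw [IsFrobenius.projectives_eq_injectives] at hI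
  exact injectives_extend hI hi f

/-- After lifting the target component to `r`, the source component must be compatible with both `r`
and `f`, which means that it lifts a map to the pullback `D`. The source of `T.X₂` maps to `D` by a
deflation, so projectivity of `α.obj.left` suffices. -/
lemma morEpi_projective [IsExactStructure S] {α : MorEpi S} (h₁ : projectives S α.obj.left)
    (h₂ : projectives S α.obj.right) : projectives (morEpiConflations S) α := by
  intro T hT f
  obtain ⟨_, _, _, k₁⟩ := T.X₁.property
  obtain ⟨_, _, _, k₃⟩ := T.X₃.property
  let φ : ShortComplex.mk T.f.hom.left T.g.hom.left
      (congrArg (fun k : T.X₁ ⟶ T.X₃ => k.hom.left) T.zero) ⟶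
      ShortComplex.mk T.f.hom.right T.g.hom.right
      (congrArg (fun k : T.X₁ ⟶ T.X₃ => k.hom.right) T.zero) :=
    { τ₁ := T.X₁.obj.hom
      τ₂ := T.X₂.obj.hom
      τ₃ := T.X₃.obj.hom
      comm₁₂ := (MorEpi.w T.f).symm
      comm₂₃ := (MorEpi.w T.g).symm }
  obtain ⟨D, u, d₁, d₂, l, wu, wl, sq, hd₁, hd₂, -, hu, hd⟩ :=
    exists_factorization_τ₂ hT.1 hT.2 φ k₁ k₃
  obtain ⟨r, hr⟩ := h₂ _ hT.2 f.hom.right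
  obtain ⟨a, ha, ha'⟩ : ∃ a : α.obj.left ⟶ D, a ≫ d₁ = α.obj.hom ≫ r ∧ a ≫ d₂ = f.hom.left :=
    ⟨sq.lift (α.obj.hom ≫ r) f.hom.left (by
      rw [Category.assoc]
      exact (α.obj.hom ≫= hr).trans (MorEpi.w f).symm), sq.lift_fst _ _ _, sq.lift_snd _ _ _⟩
  obtain ⟨b, hb⟩ := h₁ _ hu a
  dsimp at hb hd₁ hd₂ hr
  have hbr : b ≫ T.X₂.obj.hom = α.obj.hom ≫ r := by
    rw [← ha, ← hb, Category.assoc]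
    exact b ≫= hd₁.symm
  refine ⟨MorEpi.ofHom b r hbr, MorEpi.hom_ext ?_ hr⟩
  change b ≫ T.g.hom.left = f.hom.left
  rw [← ha', ← hb, Category.assoc]
  exact b ≫= hd₂.symm

/-- Extensions of the two components, chosen separately, fail to commute by a map `c` from the
source of `T.X₃`. Since `α.obj.right` is projective, `α` has a section `s`; subtracting `c ≫ s`
repairs the square without changing the values on `T.X₁`. -/
lemma morEpi_injective [IsFrobenius S] {α : MorEpi S} (h₁ : projectives S α.obj.left)
    (h₂ : projectives S α.obj.right) : injectives (morEpiConflations S) α := by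
  intro T hT f
  obtain ⟨r, hr⟩ := projectives_extend h₂ ⟨_, _, _, hT.2⟩ f.hom.right
  obtain ⟨l, hl⟩ := projectives_extend h₁ ⟨_, _, _, hT.1⟩ f.hom.left
  obtain ⟨s, hs⟩ := projectives_lift h₂ α.property (𝟙 _)
  obtain ⟨c, hc⟩ := conflation_desc hT.1 (l ≫ α.obj.hom - T.X₂.obj.hom ≫ r) (by
    rw [Preadditive.comp_sub, reassoc_of% hl, reassoc_of% (MorEpi.w T.f), hr, MorEpi.w f, sub_self])
  have hlr : (l - T.g.hom.left ≫ c ≫ s) ≫ α.obj.hom = T.X₂.obj.hom ≫ r := by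
    simp only [Preadditive.sub_comp, Category.assoc, hs, Category.comp_id, hc]
    abel
  refine ⟨MorEpi.ofHom (l - T.g.hom.left ≫ c ≫ s) r hlr, MorEpi.hom_ext ?_ hr⟩
  change T.f.hom.left ≫ (l - T.g.hom.left ≫ c ≫ s) = f.hom.left
  have h : T.f.hom.left ≫ T.g.hom.left = 0 :=
    congrArg (fun k : T.X₁ ⟶ T.X₃ => k.hom.left) T.zero
  rw [Preadditive.comp_sub, hl, reassoc_of% h, zero_comp, sub_zero]

lemma morEpi_enough_projectives [IsFrobenius S] (α : MorEpi S) :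
    ∃ (K P : MorEpi S) (i : K ⟶ P) (p : P ⟶ α) (w : i ≫ p = 0),
      (projectives S P.obj.left ∧ projectives S P.obj.right) ∧
        morEpiConflations S (ShortComplex.mk i p w) := by
  obtain ⟨L, Q, j, q, wq, hQ, hq⟩ := exists_projective_cover (S := S) α.obj.right
  obtain ⟨E, e₁, e₂, sq, he₂⟩ := IsExactStructure.pullback α.obj.hom q α.property
  obtain ⟨l, wl, hl, hl'⟩ := conflation_pullback hq sq.flip
  -- Covering the pullback `E`, and not just the source of `α`, makes `P ⟶ Q` a deflation.
  obtain ⟨K, P, i, p, wp, hP, hp⟩ := exists_projective_cover (S := S) E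
  obtain ⟨M, m, wm, hm⟩ := IsExactStructure.comp_epi (S := S) p e₁ ⟨_, _, _, hp⟩ ⟨_, _, _, hl⟩
  obtain ⟨a, b, wab, hab, ha, hb⟩ := conflation_kernels_comp hp hl hm rfl
  have hPQ : AdmissibleEpi S (p ≫ e₂) :=
    IsExactStructure.comp_epi p e₂ ⟨_, _, _, hp⟩ he₂
  have hML : AdmissibleEpi S b := ⟨_, _, _, hab⟩
  exact ⟨MorEpi.of hML, MorEpi.of hPQ,
    MorEpi.ofHom m j (show m ≫ p ≫ e₂ = b ≫ j by rw [reassoc_of% hb, hl']),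
    MorEpi.ofHom (p ≫ e₁) q (show (p ≫ e₁) ≫ α.obj.hom = (p ≫ e₂) ≫ q by
      rw [Category.assoc, Category.assoc, sq.w]),
    MorEpi.hom_ext wm wq, ⟨hP, hQ⟩, hm, hq⟩

lemma isPushout_biprod_map {X Y : C} (f : X ⟶ Y) (Z : C) :
    IsPushout f (biprod.inl : X ⟶ X ⊞ Z) biprod.inl (biprod.map f (𝟙 Z)) :=
  isPushout_of_exists_desc (by simp)
    (fun a b h => ⟨biprod.desc a (biprod.inr ≫ b), by simp, by ext <;> simp [h]⟩)
    (fun l h h' => by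
      ext
      · simpa using h
      · simpa using biprod.inr ≫= h')

/-- Two inflations are composed: `α` embeds in the split deflation `Y ⊞ I ⟶ Y` with cokernel `D ⟶
0`, and this embeds in `J ⊞ I ⟶ J` with cokernel an identity. Here `I` and `J` are hulls of the
source and of the target. -/
lemma morEpi_enough_injectives [IsFrobenius S] (α : MorEpi S) :
    ∃ (I Z : MorEpi S) (i : α ⟶ I) (p : I ⟶ Z) (w : i ≫ p = 0),
      (projectives S I.obj.left ∧ projectives S I.obj.right) ∧
        morEpiConflations S (ShortComplex.mk i p w) := by
  obtain ⟨I, A', ι, π, wι, hI, hι⟩ := exists_injective_hull (S := S) α.obj.left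
  obtain ⟨J, B', j, q, wj, hJ, hj⟩ := exists_injective_hull (S := S) α.obj.right
  have hfst (B : C) : AdmissibleEpi S (biprod.fst : B ⊞ I ⟶ B) := by
    have := AdmissibleEpi.iso_comp (S := S) ⟨_, _, _, conflation_biprod S I B⟩
      (biprod.braiding B I)
    convert this using 1
    simp
  obtain ⟨D, d, wd, hd⟩ := AdmissibleMono.biprod_lift (S := S) ⟨_, _, _, hι⟩ α.obj.hom
  obtain ⟨c, wc, hc, hc'⟩ := conflation_pushout hj (isPushout_biprod_map j I)
  let β : MorEpi S := MorEpi.of (hfst α.obj.right)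
  let i₁ : α ⟶ β := MorEpi.ofHom (biprod.lift α.obj.hom ι) (𝟙 _)
    (show biprod.lift α.obj.hom ι ≫ biprod.fst = α.obj.hom ≫ 𝟙 _ by simp)
  let i₂ : β ⟶ MorEpi.of (hfst J) := MorEpi.ofHom (biprod.map j (𝟙 I)) j
    (show biprod.map j (𝟙 I) ≫ biprod.fst = biprod.fst ≫ j by simp)
  have hi₁ : AdmissibleMono (morEpiConflations S) i₁ :=
    morEpi_admissibleMono i₁ hd (conflation_zero_right S _ (isZero_zero C))
      (c := 0) ⟨_, _, _, conflation_zero_right S _ (isZero_zero C)⟩ (by simp)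
  have hi₂ : AdmissibleMono (morEpiConflations S) i₂ :=
    morEpi_admissibleMono i₂ hc hj (IsExactStructure.id_epi _)
      (show c ≫ 𝟙 _ = biprod.fst ≫ q by
        ext
        · simp [hc']
        · simpa using biprod.inr ≫= wc)
  obtain ⟨Z, p, w, h⟩ := IsExactStructure.comp_mono _ _ hi₁ hi₂
  exact ⟨_, Z, _, p, w, ⟨projectives_biprod S hJ hI, hJ⟩, h⟩

lemma morEpi_projectives_iff [IsFrobenius S] (α : MorEpi S) :
    projectives (morEpiConflations S) α ↔
      projectives S α.obj.left ∧ projectives S α.obj.right := by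
  refine ⟨fun h => ?_, fun h => morEpi_projective h.1 h.2⟩
  obtain ⟨K, P, i, p, w, ⟨hP, hP'⟩, hp⟩ := morEpi_enough_projectives α
  obtain ⟨s, hs⟩ := h _ hp (𝟙 _)
  exact ⟨projectives_of_retract hP s.hom.left p.hom.left
      (congrArg (fun k : α ⟶ α => k.hom.left) hs),
    projectives_of_retract hP' s.hom.right p.hom.right
      (congrArg (fun k : α ⟶ α => k.hom.right) hs)⟩

lemma morEpi_injectives_iff [IsFrobenius S] (α : MorEpi S) :
    injectives (morEpiConflations S) α ↔
      projectives S α.obj.left ∧ projectives S α.obj.right := by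
  refine ⟨fun h => ?_, fun h => morEpi_injective h.1 h.2⟩
  obtain ⟨I, Z, i, p, w, ⟨hI, hI'⟩, hi⟩ := morEpi_enough_injectives α
  obtain ⟨r, hr⟩ := h _ hi (𝟙 _)
  exact ⟨projectives_of_retract hI i.hom.left r.hom.left
      (congrArg (fun k : α ⟶ α => k.hom.left) hr),
    projectives_of_retract hI' i.hom.right r.hom.right
      (congrArg (fun k : α ⟶ α => k.hom.right) hr)⟩

instance [IsFrobenius S] : IsFrobenius (morEpiConflations S) where
  projectives_eq_injectives := by
    ext α
    rw [morEpi_projectives_iff, morEpi_injectives_iff]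
  enough_projectives α := by
    obtain ⟨K, P, i, p, w, hP, h⟩ := morEpi_enough_projectives α
    exact ⟨K, P, i, p, w, (morEpi_projectives_iff P).2 hP, h⟩
  enough_injectives α := by
    obtain ⟨I, Z, i, p, w, hI, h⟩ := morEpi_enough_injectives α
    exact ⟨I, Z, i, p, w, (morEpi_injectives_iff I).2 hI, h⟩

end MorEpiFrobenius

end ExactCat

namespace ExactCat

/-! ### Sequences indexed by the integers, chain maps and homotopies -/

section Sequences

variable {D : ℤ → Type*}

/-- The sequence which extends `g₀` to the right of `q` by iteration of `f`. -/
def seqRight (f : ∀ i j : ℤ, i + 1 = j → D i → D j) (q : ℤ) (g₀ : ∀ i, D i) (i : ℤ) : D i :=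
  if i ≤ q then g₀ i else f (i - 1) i (by lia) (seqRight f q g₀ (i - 1))
termination_by (i - q).toNat
decreasing_by lia

/-- The sequence which extends `g₀` to the left of `p` by iteration of `f`. -/
def seqLeft (f : ∀ i j : ℤ, i + 1 = j → D j → D i) (p : ℤ) (g₀ : ∀ i, D i) (i : ℤ) : D i :=
  if p ≤ i then g₀ i else f i (i + 1) rfl (seqLeft f p g₀ (i + 1))
termination_by (p - i).toNat
decreasing_by lia

variable (R : ∀ i j : ℤ, i + 1 = j → D i → D j → Prop) (Q : ∀ i, D i → Prop)

/-- Dependent choice from degree `q` on: `Q` is the invariant under which a next term exists, `R`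
the relation wanted between neighbours. -/
lemma exists_seq_right (q : ℤ)
    (hex : ∀ i j h, q ≤ i → ∀ x, Q i x → ∃ y, R i j h x y ∧ Q j y)
    (g₀ : ∀ i, D i) (h₀ : Q q (g₀ q)) :
    ∃ g : ∀ i, D i, (∀ i ≤ q, g i = g₀ i) ∧ ∀ i j h, q ≤ i → R i j h (g i) (g j) := by
  classical
  -- The value `g₀ j` is a default; by `hQ` the recursion only meets terms that satisfy `Q`.
  let f : ∀ i j : ℤ, i + 1 = j → D i → D j := fun i j h x =>
    if hx : ∃ y, R i j h x y ∧ Q j y then hx.choose else g₀ j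
  have hf (i j h) (hi : q ≤ i) (x) (hx : Q i x) : R i j h x (f i j h x) ∧ Q j (f i j h x) := by
    have hx' := hex i j h hi x hx
    simp only [f, dif_pos hx']
    exact hx'.choose_spec
  let g := seqRight f q g₀
  have hg (i : ℤ) (hi : i ≤ q) : g i = g₀ i := by
    dsimp only [g]; rw [seqRight, if_pos hi]
  have hg' (i j : ℤ) (h : i + 1 = j) (hi : q ≤ i) : g j = f i j h (g i) := by
    obtain rfl : i = j - 1 := by lia
    dsimp only [g]
    rw [seqRight, if_neg (by lia)]
  have hQ (n : ℕ) : ∀ i, i = q + n → Q i (g i) := by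
    induction n with
    | zero =>
      intro i hi
      obtain rfl : i = q := by simpa using hi
      rw [hg i le_rfl]; exact h₀
    | succ n hn =>
      intro i hi
      rw [hg' (i - 1) i (by lia) (by lia)]
      exact (hf _ _ _ (by lia) _ (hn _ (by push_cast at hi; lia))).2
  refine ⟨g, hg, fun i j h hi => ?_⟩
  rw [hg' i j h hi]
  exact (hf i j h hi _ (hQ (i - q).toNat i (by lia))).1

lemma exists_seq_left (p : ℤ)
    (hex : ∀ i j h, j ≤ p → ∀ y, Q j y → ∃ x, R i j h x y ∧ Q i x)
    (g₀ : ∀ i, D i) (h₀ : Q p (g₀ p)) :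
    ∃ g : ∀ i, D i, (∀ i, p ≤ i → g i = g₀ i) ∧ ∀ i j h, j ≤ p → R i j h (g i) (g j) := by
  classical
  let f : ∀ i j : ℤ, i + 1 = j → D j → D i := fun i j h y =>
    if hy : ∃ x, R i j h x y ∧ Q i x then hy.choose else g₀ i
  have hf (i j h) (hj : j ≤ p) (y) (hy : Q j y) : R i j h (f i j h y) y ∧ Q i (f i j h y) := by
    have hy' := hex i j h hj y hy
    simp only [f, dif_pos hy']
    exact hy'.choose_spec
  let g := seqLeft f p g₀
  have hg (i : ℤ) (hi : p ≤ i) : g i = g₀ i := by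
    dsimp only [g]; rw [seqLeft, if_pos hi]
  have hg' (i j : ℤ) (h : i + 1 = j) (hj : j ≤ p) : g i = f i j h (g j) := by
    subst h
    dsimp only [g]
    rw [seqLeft, if_neg (by lia)]
  have hQ (n : ℕ) : ∀ i, i = p - n → Q i (g i) := by
    induction n with
    | zero =>
      intro i hi
      obtain rfl : i = p := by simpa using hi
      rw [hg i le_rfl]; exact h₀
    | succ n hn =>
      intro i hi
      rw [hg' i (i + 1) rfl (by lia)]
      exact (hf _ _ _ (by lia) _ (hn _ (by push_cast at hi; lia))).2
  refine ⟨g, hg, fun i j h hj => ?_⟩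
  rw [hg' i j h hj]
  exact (hf i j h hj _ (hQ (p - j).toNat j (by lia))).1

end Sequences

section ChainMaps

variable {V : Type u} [Category.{v} V] [Preadditive V]

/-- Every morphism from `Wⁱ` which vanishes on the boundaries extends along the differential. -/
def ExtendsFrom (W : CochainComplex V ℤ) (i : ℤ) : Prop :=
  ∀ (a b : ℤ), a + 1 = i → i + 1 = b → ∀ ⦃Q : V⦄ (k : W.X i ⟶ Q), W.d a i ≫ k = 0 →
    ∃ h : W.X b ⟶ Q, W.d i b ≫ h = k

/-- Every morphism to `Wⁱ` with values in the cycles lifts along the differential. -/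
def LiftsTo (W : CochainComplex V ℤ) (i : ℤ) : Prop :=
  ∀ (a b : ℤ), a + 1 = i → i + 1 = b → ∀ ⦃P : V⦄ (k : P ⟶ W.X i), k ≫ W.d i b = 0 →
    ∃ h : P ⟶ W.X a, h ≫ W.d a i = k

lemma extendsFrom_of_isZero (W : CochainComplex V ℤ) (i : ℤ) (h : IsZero (W.X i)) :
    ExtendsFrom W i :=
  fun _ _ _ _ _ _ _ => ⟨0, h.eq_of_src _ _⟩

lemma liftsTo_of_isZero (W : CochainComplex V ℤ) (i : ℤ) (h : IsZero (W.X i)) :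
    LiftsTo W i :=
  fun _ _ _ _ _ _ _ => ⟨0, h.eq_of_tgt _ _⟩

variable {W W' : CochainComplex V ℤ}

/-- The invariant of the recursion says that the last component, followed by the differential of
`W'`, vanishes on boundaries. `ExtendsFrom` then produces the next component, and commutation of the
new square restores the invariant. -/
lemma exists_extension_right (q : ℤ) (g₀ : ∀ i, W.X i ⟶ W'.X i)
    (h₀ : g₀ (q - 1) ≫ W'.d (q - 1) q = W.d (q - 1) q ≫ g₀ q)
    (hW : ∀ i, q ≤ i → ExtendsFrom W i) :
    ∃ g : ∀ i, W.X i ⟶ W'.X i, (∀ i ≤ q, g i = g₀ i) ∧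
      ∀ i j, i + 1 = j → q ≤ i → g i ≫ W'.d i j = W.d i j ≫ g j :=
  exists_seq_right (D := fun i => W.X i ⟶ W'.X i) (fun i j _ x y => x ≫ W'.d i j = W.d i j ≫ y)
    (fun i x => W.d (i - 1) i ≫ x ≫ W'.d i (i + 1) = 0) q
    (fun i j h hi x hx => by
      subst h
      obtain ⟨y, hy⟩ := hW i hi (i - 1) (i + 1) (by lia) rfl _ hx
      refine ⟨y, hy.symm, ?_⟩
      rw [show i + 1 - 1 = i by lia, reassoc_of% hy]
      simp) g₀ (by
      rw [← reassoc_of% h₀]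
      simp)

lemma exists_extension_left (p : ℤ) (g₀ : ∀ i, W.X i ⟶ W'.X i)
    (h₀ : g₀ p ≫ W'.d p (p + 1) = W.d p (p + 1) ≫ g₀ (p + 1))
    (hW : ∀ i, i ≤ p → LiftsTo W' i) :
    ∃ g : ∀ i, W.X i ⟶ W'.X i, (∀ i, p ≤ i → g i = g₀ i) ∧
      ∀ i j, i + 1 = j → j ≤ p → g i ≫ W'.d i j = W.d i j ≫ g j :=
  exists_seq_left (D := fun i => W.X i ⟶ W'.X i) (fun i j _ x y => x ≫ W'.d i j = W.d i j ≫ y)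
    (fun i x => W.d (i - 1) i ≫ x ≫ W'.d i (i + 1) = 0) p
    (fun i j h hi y hy => by
      subst h
      rw [show i + 1 - 1 = i by lia, ← Category.assoc] at hy
      obtain ⟨x, hx⟩ := hW (i + 1) hi i (i + 1 + 1) rfl rfl _ hy
      refine ⟨x, hx, ?_⟩
      rw [hx]
      simp) g₀ (by
      rw [h₀]
      simp)

/-- A chain map defined in the degrees `≤ q` extends if the source is exact in degrees `≥ q`. -/
lemma exists_hom_of_extendsFrom (q : ℤ) (g₀ : ∀ i, W.X i ⟶ W'.X i)
    (h₀ : ∀ i j, i + 1 = j → j ≤ q → g₀ i ≫ W'.d i j = W.d i j ≫ g₀ j)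
    (hW : ∀ i, q ≤ i → ExtendsFrom W i) :
    ∃ φ : W ⟶ W', ∀ i ≤ q, φ.f i = g₀ i := by
  obtain ⟨g, hg, hg'⟩ := exists_extension_right q g₀ (h₀ _ _ (by lia) le_rfl) hW
  refine ⟨{ f := g, comm' := fun i j hij => ?_ }, hg⟩
  by_cases hi : q ≤ i
  · exact hg' i j hij hi
  · have hij' : i + 1 = j := hij
    rw [hg i (by lia), hg j (by lia), h₀ i j hij (by lia)]

/-- A chain map defined in the degrees `≥ p` extends if the target is exact in degrees `≤ p`. -/
lemma exists_hom_of_liftsTo (p : ℤ) (g₀ : ∀ i, W.X i ⟶ W'.X i)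
    (h₀ : ∀ i j, i + 1 = j → p ≤ i → g₀ i ≫ W'.d i j = W.d i j ≫ g₀ j)
    (hW : ∀ i, i ≤ p → LiftsTo W' i) :
    ∃ φ : W ⟶ W', ∀ i, p ≤ i → φ.f i = g₀ i := by
  obtain ⟨g, hg, hg'⟩ := exists_extension_left p g₀ (h₀ _ _ rfl le_rfl) hW
  refine ⟨{ f := g, comm' := fun i j hij => ?_ }, hg⟩
  have hij' : i + 1 = j := hij
  by_cases hj : j ≤ p
  · exact hg' i j hij hj
  · rw [hg i (by lia), hg j (by lia), h₀ i j hij (by lia)]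

/-- A chain map defined in the degrees in `[p, q]` extends if the source is exact in degrees
`≥ q` and the target is exact in degrees `≤ p`. -/
lemma exists_hom_of_extendsFrom_of_liftsTo (p q : ℤ) (hpq : p < q) (g₀ : ∀ i, W.X i ⟶ W'.X i)
    (h₀ : ∀ i j, i + 1 = j → p ≤ i → j ≤ q → g₀ i ≫ W'.d i j = W.d i j ≫ g₀ j)
    (hW : ∀ i, q ≤ i → ExtendsFrom W i) (hW' : ∀ i, i ≤ p → LiftsTo W' i) :
    ∃ φ : W ⟶ W', ∀ i, p ≤ i → i ≤ q → φ.f i = g₀ i := by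
  obtain ⟨g, hg, hg'⟩ := exists_extension_right q g₀ (h₀ _ _ (by lia) (by lia) le_rfl) hW
  obtain ⟨φ, hφ⟩ := exists_hom_of_liftsTo p g (fun i j hij hi => by
    by_cases hi : q ≤ i
    · exact hg' i j hij hi
    · rw [hg i (by lia), hg j (by lia), h₀ i j hij (by lia) (by lia)]) hW'
  exact ⟨φ, fun i hi hi' => by rw [hφ i hi, hg i hi']⟩

/-- A homotopy to zero given around the degree `s` extends if the source is exact in degrees `> s`
and the target is exact in degrees `< s`, except where the target, respectively the source,
vanishes. -/
lemma exists_homotopy_zero (φ : W ⟶ W') (s : ℤ)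
    (x : W.X s ⟶ W'.X (s - 1)) (y : W.X (s + 1) ⟶ W'.X s)
    (h₀ : φ.f s = W.d s (s + 1) ≫ y + x ≫ W'.d (s - 1) s)
    (hW : ∀ i, s < i → ExtendsFrom W i ∨ IsZero (W'.X i))
    (hW' : ∀ i, i < s → LiftsTo W' i ∨ IsZero (W.X i)) :
    Nonempty (Homotopy φ 0) := by
  -- A term of index `i` is the homotopy component from degree `i` to degree `i - 1`; quantifying
  -- over `k` with `k + 1 = i` avoids transports along equalities of degrees.
  let D : ℤ → Type v := fun i => ∀ k, k + 1 = i → (W.X i ⟶ W'.X k)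
  let R : ∀ i j : ℤ, i + 1 = j → D i → D j → Prop := fun i j h x y =>
    φ.f i = W.d i j ≫ y i h + x (i - 1) (by omega) ≫ W'.d (i - 1) i
  -- Only the values at `s` and `s + 1` survive; the zeros are overwritten by the two recursions.
  let g₀ : ∀ i, D i := fun i k h =>
    if hi : i = s then (W.XIsoOfEq hi).hom ≫ x ≫ (W'.XIsoOfEq (by omega)).hom
    else if hi : i = s + 1 then (W.XIsoOfEq hi).hom ≫ y ≫ (W'.XIsoOfEq (by omega)).hom
    else 0
  have hg₀ : R s (s + 1) rfl (g₀ s) (g₀ (s + 1)) := by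
    simp [R, g₀, h₀]
  obtain ⟨g, hg, hg'⟩ := exists_seq_right R
    (fun i x => W.d (i - 1) i ≫ (φ.f i - x (i - 1) (by omega) ≫ W'.d (i - 1) i) = 0) (s + 1)
    (fun i j h hi x hx => by
      subst h
      obtain ⟨y, hy⟩ : ∃ y : W.X (i + 1) ⟶ W'.X i,
          W.d i (i + 1) ≫ y = φ.f i - x (i - 1) (by omega) ≫ W'.d (i - 1) i := by
        obtain h | h := hW i (by omega)
        · exact h (i - 1) (i + 1) (by omega) rfl _ hx
        · exact ⟨0, h.eq_of_tgt _ _⟩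
      refine ⟨fun k hk => y ≫ (W'.XIsoOfEq (by omega)).hom, ?_, ?_⟩
      · simp [R, hy]
      · have hk (k : ℤ) (hk : k = i) : W.d k (i + 1) ≫ (φ.f (i + 1) -
            (y ≫ (W'.XIsoOfEq (show i = k by omega)).hom) ≫ W'.d k (i + 1)) = 0 := by
          subst hk
          simp only [HomologicalComplex.XIsoOfEq_rfl, Iso.refl_hom, Category.comp_id]
          rw [Preadditive.comp_sub, reassoc_of% hy, Preadditive.sub_comp, φ.comm]
          simp
        exact hk _ (by omega)) g₀ (by
      have hk (k : ℤ) (hk : k = s) : W.d k (s + 1) ≫ (φ.f (s + 1) -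
            (g₀ (s + 1) k (by omega)) ≫ W'.d k (s + 1)) = 0 := by
        subst hk
        have : W.d k (k + 1) ≫ g₀ (k + 1) k rfl =
            φ.f k - g₀ k (k - 1) (by omega) ≫ W'.d (k - 1) k := by
          rw [eq_sub_iff_add_eq]; exact hg₀.symm
        simp [Preadditive.comp_sub, reassoc_of% this, Preadditive.sub_comp]
      exact hk _ (by omega))
  have hgs : R s (s + 1) rfl (g s) (g (s + 1)) := by
    rw [hg s (by omega), hg (s + 1) le_rfl]; exact hg₀
  obtain ⟨h, hh, hh'⟩ := exists_seq_left R
    (fun i x => (φ.f (i - 1) - W.d (i - 1) i ≫ x (i - 1) (by omega)) ≫ W'.d (i - 1) i = 0) s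
    (fun i j h hi y hy => by
      subst h
      have hy' : (φ.f i - W.d i (i + 1) ≫ y i rfl) ≫ W'.d i (i + 1) = 0 := by
        have hk (k : ℤ) (hk : k = i) (hy : (φ.f k - W.d k (i + 1) ≫ y k (by omega)) ≫
            W'.d k (i + 1) = 0) :
            (φ.f i - W.d i (i + 1) ≫ y i rfl) ≫ W'.d i (i + 1) = 0 := by
          subst hk; exact hy
        exact hk _ (by omega) hy
      obtain ⟨x, hx⟩ : ∃ x : W.X i ⟶ W'.X (i - 1),
          x ≫ W'.d (i - 1) i = φ.f i - W.d i (i + 1) ≫ y i rfl := by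
        obtain h | h := hW' i (by omega)
        · exact h (i - 1) (i + 1) (by omega) rfl _ hy'
        · exact ⟨0, h.eq_of_src _ _⟩
      refine ⟨fun k hk => x ≫ (W'.XIsoOfEq (by omega)).hom, ?_, ?_⟩
      · simp [R, hx]
      · simp only [HomologicalComplex.XIsoOfEq_rfl, Iso.refl_hom, Category.comp_id,
          Preadditive.sub_comp, Category.assoc, hx, Preadditive.comp_sub]
        simp) g (by
      have : g s (s - 1) (by omega) ≫ W'.d (s - 1) s =
            φ.f s - W.d s (s + 1) ≫ g (s + 1) s rfl := by
        rw [eq_sub_iff_add_eq, add_comm]; exact hgs.symm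
      simp [Preadditive.sub_comp, this, Preadditive.comp_sub])
  have key (i j : ℤ) (hij : i + 1 = j) : R i j hij (h i) (h j) := by
    by_cases hj : j ≤ s
    · exact hh' i j hij hj
    · rw [hh i (by omega), hh j (by omega)]
      by_cases hi : s + 1 ≤ i
      · exact hg' i j hij hi
      · obtain rfl : i = s := by omega
        subst hij
        exact hgs
  refine ⟨{ hom := fun i j => if hij : j + 1 = i then h i j hij else 0
            zero := fun i j hij => dif_neg hij
            comm := fun i => ?_ }⟩
  rw [dNext_eq _ (show (ComplexShape.up ℤ).Rel i (i + 1) from rfl),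
    prevD_eq _ (show (ComplexShape.up ℤ).Rel (i - 1) i from by simp)]
  simp only [HomologicalComplex.zero_f, add_zero]
  rw [dif_pos trivial, dif_pos (by omega)]
  exact key i (i + 1) rfl

end ChainMaps

end ExactCat

namespace ExactCat

/-! ### Models of an arrow by complexes of projective-injective objects -/

section Model

variable {C : Type u} [Category.{v} C] [Preadditive C]

/-- A complex `W` of projective-injective objects, obtained by splicing a projective resolution of
the source of the arrow `α` (in degrees `< 0`) and an injective coresolution of its target
(in degrees `≥ 0`). -/
structure Model (S : ObjectProperty (ShortComplex C)) (α : Arrow C) where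
  W : ProjComplex S
  -- The differential into degree `i` is `π`, then `γ i`, then `ι i`, and only `γ 0`, the arrow
  -- itself, may fail to be invertible. Keeping `A` and `B` apart lets models be transported by
  -- exact functors with no case distinction at degree `0`.
  A : ℤ → C
  B : ℤ → C
  γ : ∀ i, A i ⟶ B i
  ι : ∀ i, B i ⟶ (W.X i).obj
  π : ∀ i, (W.X i).obj ⟶ A (i + 1)
  w : ∀ i, ι i ≫ π i = 0
  conflation : ∀ i, S (ShortComplex.mk (ι i) (π i) (w i))
  d_eq : ∀ i, (W.d i (i + 1)).hom = π i ≫ γ (i + 1) ≫ ι (i + 1)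
  isIso : ∀ i, i ≠ 0 → IsIso (γ i)
  e : Arrow.mk (γ 0) ≅ α

variable {S : ObjectProperty (ShortComplex C)}

/-- Constructor for models, from the conflations and the maps `γ`. -/
def Model.mk' (α : Arrow C) (W : ℤ → (projectives S).FullSubcategory) (A B : ℤ → C)
    (γ : ∀ i, A i ⟶ B i) (ι : ∀ i, B i ⟶ (W i).obj) (π : ∀ i, (W i).obj ⟶ A (i + 1))
    (w : ∀ i, ι i ≫ π i = 0) (conflation : ∀ i, S (ShortComplex.mk (ι i) (π i) (w i)))
    (isIso : ∀ i, i ≠ 0 → IsIso (γ i)) (e : Arrow.mk (γ 0) ≅ α) : Model S α where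
  W := CochainComplex.of W (fun i => ObjectProperty.homMk (π i ≫ γ (i + 1) ≫ ι (i + 1)))
    (fun i => by
      ext
      simp [reassoc_of% (w (i + 1))])
  A := A
  B := B
  γ := γ
  ι := ι
  π := π
  w := w
  conflation := conflation
  d_eq i :=
    congrArg (fun k : W i ⟶ W (i + 1) => k.hom) (CochainComplex.of_d W
      (fun i => ObjectProperty.homMk (π i ≫ γ (i + 1) ≫ ι (i + 1))) i)
  isIso := isIso
  e := e

namespace Model

variable [HasZeroObject C] [HasBinaryBiproducts C] [IsExactStructure S]
variable {α β : Arrow C} (M : Model S α) (N : Model S β)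

/-- The deflation from the component of degree `-1` to the source of the arrow. -/
def p : (M.W.X (-1)).obj ⟶ α.left := M.π (-1) ≫ M.e.hom.left

/-- The inflation from the target of the arrow to the component of degree `0`. -/
def j : α.right ⟶ (M.W.X 0).obj := M.e.inv.right ≫ M.ι 0

lemma d_eq' (i k : ℤ) (h : i + 1 = k) :
    (M.W.d i k).hom = M.π i ≫ eqToHom (by rw [h]) ≫ M.γ k ≫ M.ι k := by
  subst h
  simpa using M.d_eq i

lemma d_neg_one_zero : (M.W.d (-1) 0).hom = M.p ≫ α.hom ≫ M.j := by
  have h : (M.W.d (-1) 0).hom = M.π (-1) ≫ M.γ 0 ≫ M.ι 0 := M.d_eq (-1)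
  have h' : M.e.hom.left ≫ α.hom = M.γ 0 ≫ M.e.hom.right := Arrow.w M.e.hom
  have h'' : M.e.hom.right ≫ M.e.inv.right = 𝟙 _ := by
    rw [← Arrow.comp_right, M.e.hom_inv_id]; rfl
  rw [h, p, j, Category.assoc, reassoc_of% h', reassoc_of% h'']

lemma admissibleEpi_p : AdmissibleEpi S M.p := by
  have h : AdmissibleEpi S (M.π (-1)) := ⟨_, _, _, M.conflation (-1)⟩
  exact h.comp_iso (Arrow.leftFunc.mapIso M.e)

lemma admissibleMono_j : AdmissibleMono S M.j := by
  have h : AdmissibleMono S (M.ι 0) := ⟨_, _, _, M.conflation 0⟩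
  exact IsExactStructure.comp_mono _ _
    (admissibleMono_of_isIso S (Arrow.rightFunc.mapIso M.e).inv) h

instance : Epi M.p := M.admissibleEpi_p.epi

instance : Mono M.j := M.admissibleMono_j.mono

instance (i : ℤ) : Epi (M.π i) := conflation_epi (M.conflation i)

instance (i : ℤ) : Mono (M.ι i) := conflation_mono (M.conflation i)

lemma ι_d (i k : ℤ) : M.ι i ≫ (M.W.d i k).hom = 0 := by
  by_cases h : i + 1 = k
  · rw [M.d_eq' i k h, reassoc_of% (M.w i), zero_comp]
  · rw [M.W.shape _ _ h]
    exact comp_zero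

lemma d_π (i k : ℤ) : (M.W.d k i).hom ≫ M.π i = 0 := by
  by_cases h : k + 1 = i
  · rw [M.d_eq' k i h, Category.assoc, Category.assoc, Category.assoc, M.w i]
    simp
  · rw [M.W.shape _ _ h]
    exact zero_comp

lemma d_p (k : ℤ) : (M.W.d k (-1)).hom ≫ M.p = 0 := by
  rw [p, reassoc_of% (M.d_π (-1) k), zero_comp]

lemma j_d (k : ℤ) : M.j ≫ (M.W.d 0 k).hom = 0 := by
  rw [j, Category.assoc, M.ι_d 0 k, comp_zero]

/-- Morphisms vanishing on `Bⁱ` extend along the differential, if `i ≠ -1`. -/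
lemma exists_extension {i k : ℤ} (hik : i + 1 = k) (hk : k ≠ 0) {Q : C} (hQ : injectives S Q)
    (f : (M.W.X i).obj ⟶ Q) (hf : M.ι i ≫ f = 0) :
    ∃ g : (M.W.X k).obj ⟶ Q, (M.W.d i k).hom ≫ g = f := by
  subst hik
  have := M.isIso _ hk
  obtain ⟨l, hl⟩ := conflation_desc (M.conflation i) f hf
  obtain ⟨g, hg⟩ := injectives_extend hQ (⟨_, _, _, M.conflation (i + 1)⟩ :
    AdmissibleMono S (M.ι (i + 1))) (inv (M.γ (i + 1)) ≫ l)
  exact ⟨g, by rw [M.d_eq, Category.assoc, Category.assoc, hg, IsIso.hom_inv_id_assoc, hl]⟩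

/-- Morphisms vanishing in `Aⁱ⁺¹` lift along the differential, if `γ` is a deflation in
degree `i`. -/
lemma exists_lift_of_admissibleEpi {i k : ℤ} (hik : k + 1 = i) (hi : AdmissibleEpi S (M.γ i))
    {P : C} (hP : projectives S P) (f : P ⟶ (M.W.X i).obj) (hf : f ≫ M.π i = 0) :
    ∃ g : P ⟶ (M.W.X k).obj, g ≫ (M.W.d k i).hom = f := by
  subst hik
  obtain ⟨l, hl⟩ := conflation_lift (M.conflation (k + 1)) f hf
  obtain ⟨g, hg⟩ := projectives_lift hP (IsExactStructure.comp_epi _ _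
    (⟨_, _, _, M.conflation k⟩ : AdmissibleEpi S (M.π k)) hi) l
  exact ⟨g, by rw [M.d_eq, ← hl, ← hg]; simp⟩

/-- Morphisms vanishing in `Aⁱ⁺¹` lift along the differential, if `i ≠ 0`. -/
lemma exists_lift {i k : ℤ} (hik : k + 1 = i) (hi : i ≠ 0) {P : C} (hP : projectives S P)
    (f : P ⟶ (M.W.X i).obj) (hf : f ≫ M.π i = 0) :
    ∃ g : P ⟶ (M.W.X k).obj, g ≫ (M.W.d k i).hom = f := by
  have := M.isIso _ hi
  exact M.exists_lift_of_admissibleEpi hik (admissibleEpi_of_isIso S _) hP f hf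

/-- The differential into degree `i` is an epimorphism onto `B i` followed by `ι i`, so vanishing on
boundaries means vanishing on `B i`. -/
lemma ι_comp_eq_zero {i k : ℤ} (hik : k + 1 = i) [Epi (M.γ i)] {Q : C}
    (f : (M.W.X i).obj ⟶ Q) (hf : (M.W.d k i).hom ≫ f = 0) : M.ι i ≫ f = 0 := by
  subst hik
  rw [← cancel_epi (M.γ (k + 1)), ← cancel_epi (M.π k)]
  rw [M.d_eq, Category.assoc, Category.assoc] at hf
  simpa using hf

/-- The differential out of degree `i` is `π i` followed by a monomorphism, so cycles are killed by
`π i` already. -/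
lemma comp_π_eq_zero {i k : ℤ} (hik : i + 1 = k) [Mono (M.γ k)] {P : C}
    (f : P ⟶ (M.W.X i).obj) (hf : f ≫ (M.W.d i k).hom = 0) : f ≫ M.π i = 0 := by
  subst hik
  rw [← cancel_mono (M.γ (i + 1)), ← cancel_mono (M.ι (i + 1))]
  rw [M.d_eq] at hf
  simpa using hf

lemma γ_zero : M.γ 0 = M.e.hom.left ≫ α.hom ≫ M.e.inv.right := by
  have h' : M.e.hom.left ≫ α.hom = M.γ 0 ≫ M.e.hom.right := Arrow.w M.e.hom
  have h'' : M.e.hom.right ≫ M.e.inv.right = 𝟙 _ := by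
    rw [← Arrow.comp_right, M.e.hom_inv_id]; rfl
  rw [reassoc_of% h', h'']
  exact (Category.comp_id _).symm

lemma epi_γ [Epi α.hom] (i : ℤ) : Epi (M.γ i) := by
  by_cases hi : i = 0
  · subst hi
    rw [M.γ_zero]
    infer_instance
  · have := M.isIso i hi
    infer_instance

lemma isIso_γ [IsIso α.hom] (i : ℤ) : IsIso (M.γ i) := by
  by_cases hi : i = 0
  · subst hi
    rw [M.γ_zero]
    infer_instance
  · exact M.isIso i hi

/-- The target of the arrow is the kernel of `d⁰`, since `γ 1` is invertible. With the dual
statement for the source, it recovers a morphism of arrows from a chain map. -/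
lemma exists_comp_j_eq {Z : C} (f : Z ⟶ (M.W.X 0).obj) (hf : f ≫ (M.W.d 0 1).hom = 0) :
    ∃ g : Z ⟶ α.right, g ≫ M.j = f := by
  have : Mono (M.γ 1) := by
    have := M.isIso 1 (by simp)
    infer_instance
  obtain ⟨l, hl⟩ := conflation_lift (M.conflation 0) f
    (M.comp_π_eq_zero (i := 0) (k := 1) rfl f hf)
  refine ⟨l ≫ M.e.hom.right, ?_⟩
  have h'' : M.e.hom.right ≫ M.e.inv.right = 𝟙 _ := by
    rw [← Arrow.comp_right, M.e.hom_inv_id]; rfl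
  rw [j, Category.assoc, reassoc_of% h'', hl]

lemma exists_p_comp_eq {Z : C} (f : (M.W.X (-1)).obj ⟶ Z) (hf : (M.W.d (-2) (-1)).hom ≫ f = 0) :
    ∃ g : α.left ⟶ Z, M.p ≫ g = f := by
  have : Epi (M.γ (-1)) := by
    have := M.isIso (-1) (by simp)
    infer_instance
  obtain ⟨l, hl⟩ : ∃ l : M.A 0 ⟶ Z, M.π (-1) ≫ l = f := conflation_desc (M.conflation (-1)) f
    (M.ι_comp_eq_zero (i := -1) (k := -2) rfl f hf)
  refine ⟨M.e.inv.left ≫ l, ?_⟩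
  have h'' : M.e.hom.left ≫ M.e.inv.left = 𝟙 _ := by
    rw [← Arrow.comp_left, M.e.hom_inv_id]; rfl
  rw [p, Category.assoc, reassoc_of% h'', hl]

lemma p_eq_zero_iff {Z : C} (f : Z ⟶ (M.W.X (-1)).obj) : f ≫ M.p = 0 ↔ f ≫ M.π (-1) = 0 := by
  have : Mono M.e.hom.left := (Arrow.leftFunc.mapIso M.e).isIso_hom.mono_of_iso
  rw [p, ← Category.assoc]
  constructor
  · intro h
    rw [← cancel_mono M.e.hom.left, h, zero_comp]
  · intro h
    rw [h, zero_comp]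

lemma admissibleEpi_γ (hα : AdmissibleEpi S α.hom) (i : ℤ) : AdmissibleEpi S (M.γ i) := by
  by_cases hi : i = 0
  · subst hi
    rw [M.γ_zero]
    have := (hα.iso_comp (Arrow.leftFunc.mapIso M.e)).comp_iso (Arrow.rightFunc.mapIso M.e).symm
    rw [Category.assoc] at this
    exact this
  · have := M.isIso i hi
    exact admissibleEpi_of_isIso S _

/-- Degree `-1` is excluded because the differential leaving it passes through `γ 0`, which need not
be a monomorphism, so there may be more cycles than `B (-1)`. In degree `0` the lift exists because
`γ 0` is a deflation. -/
lemma liftsTo_of_admissibleEpi {i : ℤ} (hi : i ≠ -1) (h : AdmissibleEpi S (M.γ i)) :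
    LiftsTo M.W i := by
  intro a b ha hb P k hk
  have : Mono (M.γ b) := by
    have := M.isIso b (by omega)
    infer_instance
  obtain ⟨g, hg⟩ := M.exists_lift_of_admissibleEpi ha h P.property k.hom
    (M.comp_π_eq_zero hb k.hom (congrArg (fun k => k.hom) hk))
  exact ⟨ObjectProperty.homMk g, by ext; exact hg⟩

lemma liftsTo {i : ℤ} (hi : i < -1) : LiftsTo M.W i := by
  have := M.isIso i (by omega)
  exact M.liftsTo_of_admissibleEpi (by omega) (admissibleEpi_of_isIso S _)

end Model

namespace Model

variable [HasZeroObject C] [HasBinaryBiproducts C] [IsFrobenius S]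
variable {α β : Arrow C} (M : Model S α) (N : Model S β)

/-- An epimorphism `α` is enough here: boundaries then fill `B i` in every degree. Degree `-1` is
excluded because an extension along `d⁻¹` would require inverting `γ 0`. -/
lemma extendsFrom [Epi α.hom] {i : ℤ} (hi : i ≠ -1) : ExtendsFrom M.W i := by
  intro a b ha hb Q k hk
  have := M.epi_γ i
  obtain ⟨g, hg⟩ := M.exists_extension hb (by omega)
    (by rw [← IsFrobenius.projectives_eq_injectives (S := S)]; exact Q.property) k.hom
    (M.ι_comp_eq_zero ha k.hom (congrArg (fun k => k.hom) hk))
  exact ⟨ObjectProperty.homMk g, by ext; exact hg⟩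

/-- The chain map `φ` between models lifts the morphism of arrows `f`. -/
structure IsLift (f : α ⟶ β) (φ : M.W ⟶ N.W) : Prop where
  p : (φ.f (-1)).hom ≫ N.p = M.p ≫ f.left
  j : M.j ≫ (φ.f 0).hom = f.right ≫ N.j

variable {M N} in
lemma IsLift.comp {δ : Arrow C} {O : Model S δ} {f : α ⟶ β} {g : β ⟶ δ} {φ : M.W ⟶ N.W}
    {ψ : N.W ⟶ O.W} (h : IsLift M N f φ) (h' : IsLift N O g ψ) :
    IsLift M O (f ≫ g) (φ ≫ ψ) where
  p := by simp [h'.p, reassoc_of% h.p]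
  j := by simp [h'.j, reassoc_of% h.j]

lemma IsLift.add {M : Model S α} {N : Model S β} {f g : α ⟶ β} {φ ψ : M.W ⟶ N.W}
    (h : IsLift M N f φ) (h' : IsLift M N g ψ) {k : α ⟶ β} (hl : k.left = f.left + g.left)
    (hr : k.right = f.right + g.right) : IsLift M N k (φ + ψ) where
  p := by
    change ((φ.f (-1)).hom + (ψ.f (-1)).hom) ≫ _ = _
    rw [Preadditive.add_comp, h.p, h'.p, hl, Preadditive.comp_add]
  j := by
    change _ ≫ ((φ.f 0).hom + (ψ.f 0).hom) = _
    rw [Preadditive.comp_add, h.j, h'.j, hr, Preadditive.add_comp]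

lemma IsLift.neg {M : Model S α} {N : Model S β} {f : α ⟶ β} {φ : M.W ⟶ N.W}
    (h : IsLift M N f φ) {k : α ⟶ β} (hl : k.left = -f.left) (hr : k.right = -f.right) :
    IsLift M N k (-φ) where
  p := by
    change (-(φ.f (-1)).hom) ≫ _ = _
    rw [Preadditive.neg_comp, h.p, hl, Preadditive.comp_neg]
  j := by
    change _ ≫ (-(φ.f 0).hom) = _
    rw [Preadditive.comp_neg, h.j, hr, Preadditive.neg_comp]

lemma IsLift.id : IsLift M M (𝟙 α) (𝟙 M.W) where
  p := by simp
  j := by simp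

/-- Every morphism of arrows lifts to a morphism of models. -/
lemma exists_isLift [Epi α.hom] (f : α ⟶ β) : ∃ φ : M.W ⟶ N.W, IsLift M N f φ := by
  obtain ⟨y, hy⟩ := projectives_lift (M.W.X (-1)).property N.admissibleEpi_p (M.p ≫ f.left)
  obtain ⟨z, hz⟩ := projectives_extend (N.W.X 0).property M.admissibleMono_j (f.right ≫ N.j)
  have hyz : y ≫ (N.W.d (-1) 0).hom = (M.W.d (-1) 0).hom ≫ z := by
    rw [M.d_neg_one_zero, N.d_neg_one_zero, reassoc_of% hy, Category.assoc, Category.assoc, hz,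
      Arrow.w_assoc]
  -- Degree `-2` needs care: cycles of `N` in degree `-1` do not lift in general, but `d ≫ y` is
  -- killed by `N.p` and therefore does. Below and above the window `[-2, 0]` plain exactness takes
  -- over.
  obtain ⟨x, hx⟩ := N.exists_lift (i := -1) (k := -2) rfl (by simp) (M.W.X (-2)).property
    ((M.W.d (-2) (-1)).hom ≫ y) (by
      rw [← N.p_eq_zero_iff, Category.assoc, hy, reassoc_of% (M.d_p), zero_comp])
  let g₀ : ∀ i, M.W.X i ⟶ N.W.X i := fun i =>
    if h : i = -2 then (M.W.XIsoOfEq h).hom ≫ ObjectProperty.homMk x ≫ (N.W.XIsoOfEq h.symm).hom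
    else if h : i = -1 then
      (M.W.XIsoOfEq h).hom ≫ ObjectProperty.homMk y ≫ (N.W.XIsoOfEq h.symm).hom
    else if h : i = 0 then
      (M.W.XIsoOfEq h).hom ≫ ObjectProperty.homMk z ≫ (N.W.XIsoOfEq h.symm).hom
    else 0
  have h₂ : g₀ (-2) = ObjectProperty.homMk x := by simp [g₀]
  have h₁ : g₀ (-1) = ObjectProperty.homMk y := by simp [g₀]
  have h₀ : g₀ 0 = ObjectProperty.homMk z := by simp [g₀]
  obtain ⟨φ, hφ⟩ := exists_hom_of_extendsFrom_of_liftsTo (-2) 0 (by simp) g₀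
    (fun i k hik hi hk => by
      obtain rfl | rfl : i = -2 ∨ i = -1 := by omega
      · obtain rfl : k = -1 := by omega
        rw [h₂, h₁]
        ext
        exact hx
      · obtain rfl : k = 0 := by omega
        rw [h₁, h₀]
        ext
        exact hyz)
    (fun i hi => M.extendsFrom (by omega)) (fun i hi => N.liftsTo (by omega))
  refine ⟨φ, ?_, ?_⟩
  · rw [hφ (-1) (by simp) (by simp), h₁]
    exact hy
  · rw [hφ 0 (by simp) le_rfl, h₀]
    exact hz

/-- Every chain map between models lifts a morphism of arrows. -/
lemma exists_isLift_hom (φ : M.W ⟶ N.W) : ∃ f : α ⟶ β, IsLift M N f φ := by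
  have h₀ : (φ.f 0).hom ≫ (N.W.d 0 1).hom = (M.W.d 0 1).hom ≫ (φ.f 1).hom :=
    congrArg (fun k => k.hom) (φ.comm 0 1)
  have h₁ : (φ.f (-1)).hom ≫ (N.W.d (-1) 0).hom = (M.W.d (-1) 0).hom ≫ (φ.f 0).hom :=
    congrArg (fun k => k.hom) (φ.comm (-1) 0)
  have h₂ : (φ.f (-2)).hom ≫ (N.W.d (-2) (-1)).hom = (M.W.d (-2) (-1)).hom ≫ (φ.f (-1)).hom :=
    congrArg (fun k => k.hom) (φ.comm (-2) (-1))
  obtain ⟨r, hr⟩ := N.exists_comp_j_eq (M.j ≫ (φ.f 0).hom) (by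
    rw [Category.assoc, h₀, reassoc_of% (M.j_d), zero_comp])
  obtain ⟨l, hl⟩ := M.exists_p_comp_eq ((φ.f (-1)).hom ≫ N.p) (by
    rw [← reassoc_of% h₂, N.d_p, comp_zero])
  refine ⟨Arrow.homMk l r ?_, hl.symm, hr.symm⟩
  rw [← cancel_epi M.p, ← cancel_mono N.j, reassoc_of% hl, Category.assoc, Category.assoc,
    Category.assoc, Category.assoc, hr, ← N.d_neg_one_zero, h₁, M.d_neg_one_zero]
  simp

/-- The lifts of the zero morphism are homotopic to zero. -/
lemma IsLift.homotopy_zero [Epi α.hom] {M : Model S α} {N : Model S β} {φ : M.W ⟶ N.W}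
    {f : α ⟶ β} (h : IsLift M N f φ) (h₁ : f.left = 0) : Nonempty (Homotopy φ 0) := by
  have hp := h.p
  rw [h₁, comp_zero, N.p_eq_zero_iff] at hp
  obtain ⟨x, hx⟩ := N.exists_lift (i := -1) (k := -1 - 1) rfl (by simp) (M.W.X (-1)).property _ hp
  -- The component out of degree `0` is taken to be zero; everything to the right is then supplied
  -- by the exactness of `M` in degrees `≥ 0`.
  refine exists_homotopy_zero φ (-1) (ObjectProperty.homMk x) 0
    (by ext; rw [comp_zero, zero_add]; exact hx.symm)
    (fun i hi => .inl (M.extendsFrom (by omega))) (fun i hi => .inl (N.liftsTo hi))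

/-- If a lift of a morphism of arrows is homotopic to zero, then this morphism factors through
the identity of a projective object. -/
lemma IsLift.exists_factorization {M : Model S α} {N : Model S β} {φ : M.W ⟶ N.W} {f : α ⟶ β}
    (h : IsLift M N f φ) (H : Homotopy φ 0) :
    ∃ (Q : C) (_ : projectives S Q) (a : α.right ⟶ Q) (b : Q ⟶ β.left),
      f.left = α.hom ≫ a ≫ b ∧ f.right = a ≫ b ≫ β.hom := by
  have h₀ := H.comm 0
  have h₁ := H.comm (-1)
  rw [dNext_eq _ (show (ComplexShape.up ℤ).Rel 0 1 from rfl),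
    prevD_eq _ (show (ComplexShape.up ℤ).Rel (-1) 0 from rfl)] at h₀
  rw [dNext_eq _ (show (ComplexShape.up ℤ).Rel (-1) 0 from rfl),
    prevD_eq _ (show (ComplexShape.up ℤ).Rel (-2) (-1) from rfl)] at h₁
  have hp := h.p
  have hj := h.j
  rw [h₁.trans (add_zero _)] at hp
  rw [h₀.trans (add_zero _)] at hj
  change ((M.W.d (-1) 0).hom ≫ (H.hom 0 (-1)).hom +
    (H.hom (-1) (-2)).hom ≫ (N.W.d (-2) (-1)).hom) ≫ _ = _ at hp
  change _ ≫ ((M.W.d 0 1).hom ≫ (H.hom 1 0).hom +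
    (H.hom 0 (-1)).hom ≫ (N.W.d (-1) 0).hom) = _ at hj
  -- Only the component of the homotopy from degree `0` to degree `-1` matters: the other terms
  -- vanish after `N.p`, respectively after precomposition with `M.j`.
  refine ⟨_, (M.W.X 0).property, M.j, (H.hom 0 (-1)).hom ≫ N.p, ?_, ?_⟩
  · rw [← cancel_epi M.p, ← hp]
    simp [Preadditive.add_comp, N.d_p, M.d_neg_one_zero]
  · rw [← cancel_mono N.j, ← hj]
    simp [Preadditive.comp_add, reassoc_of% (M.j_d), N.d_neg_one_zero]

end Model

end Model

end ExactCat

namespace ExactCat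

/-! ### Resolutions, and the existence of models -/

section Resolutions

variable {C : Type u} [Category.{v} C] [Preadditive C]

/-- A resolution of `X` by projective-injective objects. -/
structure LeftRes (S : ObjectProperty (ShortComplex C)) (X : C) where
  Z : ℕ → C
  P : ℕ → (projectives S).FullSubcategory
  ι : ∀ n, Z (n + 1) ⟶ (P n).obj
  π : ∀ n, (P n).obj ⟶ Z n
  w : ∀ n, ι n ≫ π n = 0
  conflation : ∀ n, S (ShortComplex.mk (ι n) (π n) (w n))
  e : Z 0 ≅ X

/-- A coresolution of `X` by projective-injective objects. -/
structure RightRes (S : ObjectProperty (ShortComplex C)) (X : C) where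
  Z : ℕ → C
  I : ℕ → (projectives S).FullSubcategory
  ι : ∀ n, Z n ⟶ (I n).obj
  π : ∀ n, (I n).obj ⟶ Z (n + 1)
  w : ∀ n, ι n ≫ π n = 0
  conflation : ∀ n, S (ShortComplex.mk (ι n) (π n) (w n))
  e : Z 0 ≅ X

variable {S : ObjectProperty (ShortComplex C)}

namespace LeftRes

variable {X Y : C} (L : LeftRes S X) (R : RightRes S Y)

/-- The objects of the complex obtained by splicing a resolution and a coresolution. -/
def spliceX : ℤ → (projectives S).FullSubcategory
  | Int.ofNat n => R.I n
  | Int.negSucc n => L.P n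

/-- The sources of the maps `γ` of the model obtained by splicing. -/
def spliceA : ℤ → C
  | Int.ofNat 0 => L.Z 0
  | Int.ofNat (n + 1) => R.Z (n + 1)
  | Int.negSucc n => L.Z (n + 1)

/-- The targets of the maps `γ` of the model obtained by splicing. -/
def spliceB : ℤ → C
  | Int.ofNat n => R.Z n
  | Int.negSucc n => L.Z (n + 1)

/-- The maps `γ` of the model obtained by splicing. -/
def spliceγ (f : X ⟶ Y) : ∀ i, L.spliceA R i ⟶ L.spliceB R i
  | Int.ofNat 0 => L.e.hom ≫ f ≫ R.e.inv
  | Int.ofNat (n + 1) => 𝟙 (R.Z (n + 1))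
  | Int.negSucc n => 𝟙 (L.Z (n + 1))

/-- The inflations of the model obtained by splicing. -/
def spliceι : ∀ i, L.spliceB R i ⟶ (L.spliceX R i).obj
  | Int.ofNat n => R.ι n
  | Int.negSucc n => L.ι n

/-- The deflations of the model obtained by splicing. -/
def spliceπ : ∀ i : ℤ, (L.spliceX R i).obj ⟶ L.spliceA R (i + 1)
  | Int.ofNat n => R.π n
  | Int.negSucc 0 => L.π 0
  | Int.negSucc (n + 1) => L.π (n + 1)

lemma splice_w : ∀ i : ℤ, L.spliceι R i ≫ L.spliceπ R i = 0
  | Int.ofNat n => R.w n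
  | Int.negSucc 0 => L.w 0
  | Int.negSucc (n + 1) => L.w (n + 1)

lemma splice_conflation : ∀ i : ℤ,
    S (ShortComplex.mk (L.spliceι R i) (L.spliceπ R i) (L.splice_w R i))
  | Int.ofNat n => R.conflation n
  | Int.negSucc 0 => L.conflation 0
  | Int.negSucc (n + 1) => L.conflation (n + 1)

lemma isIso_spliceγ (f : X ⟶ Y) : ∀ i : ℤ, i ≠ 0 → IsIso (L.spliceγ R f i)
  | Int.ofNat 0, h => (h rfl).elim
  | Int.ofNat (n + 1), _ => inferInstanceAs (IsIso (𝟙 (R.Z (n + 1))))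
  | Int.negSucc n, _ => inferInstanceAs (IsIso (𝟙 (L.Z (n + 1))))

/-- The model obtained by splicing a resolution and a coresolution. -/
def splice (f : X ⟶ Y) : Model S (Arrow.mk f) :=
  Model.mk' _ (L.spliceX R) (L.spliceA R) (L.spliceB R) (L.spliceγ R f) (L.spliceι R)
    (L.spliceπ R) (L.splice_w R) (L.splice_conflation R) (L.isIso_spliceγ R f)
    (Arrow.isoMk L.e R.e (by
      change L.e.hom ≫ f = (L.e.hom ≫ f ≫ R.e.inv) ≫ R.e.hom
      simp))

end LeftRes

variable [HasZeroObject C] [HasBinaryBiproducts C] [IsFrobenius S]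

variable (S) in
lemma nonempty_leftRes (X : C) : Nonempty (LeftRes S X) := by
  choose K P i p w hP h using exists_projective_cover (S := S)
  let Z : ℕ → C := fun n => Nat.rec X (fun _ Z => K Z) n
  exact ⟨{ Z := Z
           P := fun n => ⟨P (Z n), hP _⟩
           ι := fun n => i (Z n)
           π := fun n => p (Z n)
           w := fun n => w _
           conflation := fun n => h _
           e := Iso.refl _ }⟩

variable (S) in
lemma nonempty_rightRes (X : C) : Nonempty (RightRes S X) := by
  choose I K i p w hI h using exists_injective_hull (S := S)
  let Z : ℕ → C := fun n => Nat.rec X (fun _ Z => K Z) n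
  exact ⟨{ Z := Z
           I := fun n => ⟨I (Z n), hI _⟩
           ι := fun n => i (Z n)
           π := fun n => p (Z n)
           w := fun n => w _
           conflation := fun n => h _
           e := Iso.refl _ }⟩

variable (S) in
lemma nonempty_model (α : Arrow C) : Nonempty (Model S α) :=
  ⟨(nonempty_leftRes S α.left).some.splice (nonempty_rightRes S α.right).some α.hom⟩

/-- A chosen model of an arrow. -/
def model (S : ObjectProperty (ShortComplex C)) [IsFrobenius S] (α : Arrow C) : Model S α :=
  (nonempty_model S α).some

end Resolutions

/-! ### Acyclicity in a given degree -/

section Acyclic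

variable {C : Type u} [Category.{v} C] [Preadditive C] {S : ObjectProperty (ShortComplex C)}

/-- The complex `X` is acyclic in degree `j`: the differentials starting and ending in degree `j`
are composites of deflations and inflations, which form a conflation in degree `j`. -/
def AcyclicAt (X : ProjComplex S) (j : ℤ) : Prop :=
  ∀ i k, i + 1 = j → j + 1 = k →
    ∃ (Z Z' : C) (q : (X.X i).obj ⟶ Z) (ι : Z ⟶ (X.X j).obj) (π : (X.X j).obj ⟶ Z')
      (κ : Z' ⟶ (X.X k).obj) (w : ι ≫ π = 0), S (ShortComplex.mk ι π w) ∧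
      AdmissibleEpi S q ∧ AdmissibleMono S κ ∧
      (X.d i j).hom = q ≫ ι ∧ (X.d j k).hom = π ≫ κ

lemma IsAcyclicComplex.acyclicAt {X : ProjComplex S} (hX : IsAcyclicComplex S X) (j : ℤ) :
    AcyclicAt X j := by
  obtain ⟨Z, ι, π, w, h⟩ := hX
  rintro i k rfl rfl
  exact ⟨_, _, π i, ι (i + 1), π (i + 1), ι (i + 1 + 1), w _, (h _).1, ⟨_, _, _, (h i).1⟩,
    ⟨_, _, _, (h (i + 1 + 1)).1⟩, (h i).2, (h (i + 1)).2⟩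

section

variable [HasZeroObject C] [HasBinaryBiproducts C] [IsExactStructure S]

lemma Model.isAcyclicComplex {α : Arrow C} (M : Model S α) [IsIso α.hom] :
    IsAcyclicComplex S M.W := by
  have := M.isIso_γ
  refine ⟨M.B, M.ι, fun i => M.π i ≫ M.γ (i + 1), fun i => by rw [reassoc_of% (M.w i), zero_comp],
    fun i => ⟨?_, by rw [M.d_eq, Category.assoc]⟩⟩
  exact conflation_of_iso (M.conflation i) _ (Iso.refl _) (Iso.refl _) (asIso (M.γ (i + 1)))
    (by simp) (by simp)

lemma Model.acyclicAt {α : Arrow C} (M : Model S α) {j : ℤ} (hj : j ≠ -1) (hj' : j ≠ 0) :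
    AcyclicAt M.W j := by
  rintro i k rfl rfl
  have := M.isIso (i + 1) hj'
  have := M.isIso (i + 1 + 1) (by omega)
  have h : AdmissibleEpi S (M.π i) := ⟨_, _, _, M.conflation i⟩
  have h' : AdmissibleMono S (M.ι (i + 1 + 1)) := ⟨_, _, _, M.conflation (i + 1 + 1)⟩
  exact ⟨_, _, M.π i ≫ M.γ (i + 1), M.ι (i + 1), M.π (i + 1), M.γ (i + 1 + 1) ≫ M.ι (i + 1 + 1),
    M.w _, M.conflation _, h.comp_iso (asIso (M.γ (i + 1))),
    IsExactStructure.comp_mono _ _ (admissibleMono_of_isIso S _) h',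
    by rw [M.d_eq, Category.assoc], M.d_eq _⟩

/-- As `j` and `k` are monomorphisms, `p` and `q` both have the kernel of the common composite. This
allows data of `AcyclicAt` chosen in neighbouring degrees to be matched. -/
lemma conflation_of_comp_eq {X Y Z Z' W : C} {i : X ⟶ Y} {p : Y ⟶ Z} {w : i ≫ p = 0}
    (h : S (ShortComplex.mk i p w)) {q : Y ⟶ Z'} {j : Z ⟶ W} {k : Z' ⟶ W} [Mono j] [Mono k]
    (hq : AdmissibleEpi S q) (e : p ≫ j = q ≫ k) :
    ∃ (w' : i ≫ q = 0), S (ShortComplex.mk i q w') := by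
  have hw : i ≫ q = 0 := by
    rw [← cancel_mono k, Category.assoc, ← e, reassoc_of% w, zero_comp, zero_comp]
  refine ⟨hw, conflation_of_admissibleEpi hw hq (conflation_mono h) fun f hf =>
    conflation_lift h f ?_⟩
  rw [← cancel_mono j, Category.assoc, e, reassoc_of% hf, zero_comp, zero_comp]

lemma AcyclicAt.of_iso_d {X Y : ProjComplex S} {j : ℤ} (hX : AcyclicAt X j) (n : ℤ)
    (e : ∀ i, X.X i ≅ Y.X (i + n))
    (he : ∀ i k, i + 1 = j ∨ i = j → i + 1 = k →
      (e i).hom ≫ Y.d (i + n) (k + n) = X.d i k ≫ (e k).hom) :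
    AcyclicAt Y (j + n) := by
  intro i k hi hk
  obtain ⟨i, rfl⟩ : ∃ i', i = i' + n := ⟨i - n, by omega⟩
  obtain ⟨k, rfl⟩ : ∃ k', k = k' + n := ⟨k - n, by omega⟩
  obtain ⟨Z, Z', q, ι, π, κ, w, h, hq, hκ, h₁, h₂⟩ := hX i k (by omega) (by omega)
  let e' (i : ℤ) : (X.X i).obj ≅ (Y.X (i + n)).obj := (projectives S).ι.mapIso (e i)
  have he' (i k) (h : i + 1 = j ∨ i = j) (h' : i + 1 = k) :
      (e' i).hom ≫ (Y.d (i + n) (k + n)).hom = (X.d i k).hom ≫ (e' k).hom :=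
    congrArg (fun k => k.hom) (he i k h h')
  refine ⟨Z, Z', (e' i).inv ≫ q, ι ≫ (e' j).hom, (e' j).inv ≫ π, κ ≫ (e' k).hom, by simp [w],
    conflation_of_iso h _ (Iso.refl _) (e' j) (Iso.refl _) (by simp) (by simp),
    hq.iso_comp (e' i).symm, hκ.comp_iso _, ?_, ?_⟩
  · rw [← cancel_epi (e' i).hom, he' _ _ (by omega) (by omega), h₁]
    simp
  · rw [← cancel_epi (e' j).hom, he' _ _ (by omega) (by omega), h₂]
    simp

/-- Each degree carries its own choice of cycles. One keeps `ι i` and replaces the deflation out of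
degree `i` by the one chosen in degree `i + 1`, which ends at `Z (i + 1)`; both have the kernel of
the same differential. -/
lemma isAcyclicComplex_of_acyclicAt {X : ProjComplex S} (hX : ∀ j, AcyclicAt X j) :
    IsAcyclicComplex S X := by
  have h (j : ℤ) := hX j (j - 1) (j + 1) (by omega) rfl
  choose Z Z' q ι π κ w h hq hκ h₁ h₂ using h
  have : ∀ i, Mono (ι i) := fun i => conflation_mono (h i)
  have : ∀ i, Mono (κ i) := fun i => (hκ i).mono
  have hq' (i : ℤ) : ∃ (q' : (X.X i).obj ⟶ Z (i + 1)) , AdmissibleEpi S q' ∧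
      (X.d i (i + 1)).hom = q' ≫ ι (i + 1) := by
    obtain ⟨j, hj⟩ : ∃ j, i = j - 1 := ⟨i + 1, by omega⟩
    obtain rfl : i + 1 = j := by omega
    have e : i = i + 1 - 1 := by omega
    let e' : (X.X i).obj ≅ (X.X (i + 1 - 1)).obj := (projectives S).ι.mapIso (X.XIsoOfEq e)
    refine ⟨e'.hom ≫ q (i + 1), (hq (i + 1)).iso_comp e', ?_⟩
    rw [Category.assoc, ← h₁]
    exact congrArg (fun k => k.hom) (X.XIsoOfEq_hom_comp_d e (i + 1)).symm
  choose q' hq' h₁' using hq'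
  have h' (i : ℤ) := conflation_of_comp_eq (h i) (hq' i) ((h₂ i).symm.trans (h₁' i))
  exact ⟨Z, ι, q', fun i => (h' i).choose, fun i => ⟨(h' i).choose_spec, h₁' i⟩⟩

lemma AcyclicAt.shift {X : ProjComplex S} {j : ℤ} (n k : ℤ) (hX : AcyclicAt X j)
    (hk : k + n = j) : AcyclicAt (X⟦n⟧) k := by
  obtain rfl : k = j + (-n) := by omega
  have e (i : ℤ) : i = i + -n + n := by omega
  obtain h | h : n.negOnePow = 1 ∨ n.negOnePow = -1 := Int.units_eq_one_or _
  · exact hX.of_iso_d (-n) (fun i => X.XIsoOfEq (e i)) (fun i k _ _ => by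
      simp [CochainComplex.shiftFunctor_obj_d', h])
  -- For odd `n` the shift changes the sign of the differential, which the alternating signs absorb.
  · refine hX.of_iso_d (-n) (fun i => (Int.negOnePow i) • X.XIsoOfEq (e i)) (fun i k _ hik => by
      subst hik
      simp [CochainComplex.shiftFunctor_obj_d', h, Int.negOnePow_succ])

end

end Acyclic

end ExactCat

namespace ExactCat

/-! ### Completion of complexes which are acyclic on one side -/

section Completion

variable {C : Type u} [Category.{v} C] [Preadditive C] {S : ObjectProperty (ShortComplex C)}

/-- The complexes `X` and `Y` agree in the degrees satisfying `P`. -/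
def AgreeOn {V : Type u} [Category.{v} V] [Preadditive V] (P : ℤ → Prop)
    (X Y : CochainComplex V ℤ) : Prop :=
  ∃ f : ∀ i, X.X i ⟶ Y.X i, (∀ i, P i → IsIso (f i)) ∧
    ∀ i j, P i → P j → f i ≫ Y.d i j = X.d i j ≫ f j

section AgreeOn

variable {V : Type u} [Category.{v} V] [Preadditive V] {P : ℤ → Prop}

lemma AgreeOn.symm {X Y : CochainComplex V ℤ} (h : AgreeOn P X Y) : AgreeOn P Y X := by
  classical
  obtain ⟨f, hf, hf'⟩ := h
  refine ⟨fun i => if h : IsIso (f i) then inv (f i) else 0, fun i hi => ?_, fun i j hi hj => ?_⟩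
  · have := hf i hi
    dsimp only
    rw [dif_pos this]
    infer_instance
  · have := hf i hi
    have := hf j hj
    dsimp only
    rw [dif_pos (hf i hi), dif_pos (hf j hj), IsIso.inv_comp_eq, ← Category.assoc, hf' i j hi hj,
      Category.assoc, IsIso.hom_inv_id, Category.comp_id]

lemma AgreeOn.of_iff {Q : ℤ → Prop} {X Y : CochainComplex V ℤ} (h : AgreeOn P X Y)
    (hPQ : ∀ i, Q i → P i) : AgreeOn Q X Y := by
  obtain ⟨f, hf, hf'⟩ := h
  exact ⟨f, fun i hi => hf i (hPQ i hi), fun i j hi hj => hf' i j (hPQ i hi) (hPQ j hj)⟩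

lemma AgreeOn.of_shift {X Y : CochainComplex V ℤ} (n : ℤ)
    (h : AgreeOn (fun i => P (i + n)) (X⟦n⟧) Y) : AgreeOn P X (Y⟦-n⟧) := by
  obtain ⟨f, hf, hf'⟩ := h
  have e (i : ℤ) : i = i + -n + n := by omega
  have hn : (-n).negOnePow = n.negOnePow := by rw [Int.negOnePow_neg]
  have hP {i : ℤ} (hi : P i) : P (i + -n + n) := by rwa [← e]
  let g (i : ℤ) : X.X (i + -n + n) ⟶ Y.X (i + -n) := f (i + -n)
  have hg (i j : ℤ) (hi : P i) (hj : P j) : g i ≫ Y.d (i + -n) (j + -n) =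
      n.negOnePow • X.d (i + -n + n) (j + -n + n) ≫ g j :=
    (hf' (i + -n) (j + -n) (hP hi) (hP hj)).trans (Linear.units_smul_comp _ _ _)
  refine ⟨fun i => (X.XIsoOfEq (e i)).hom ≫ g i, fun i hi => ?_, fun i j hi hj => ?_⟩
  · have : IsIso (g i) := hf (i + -n) (hP hi)
    exact inferInstanceAs (IsIso ((X.XIsoOfEq (e i)).hom ≫ g i))
  · change ((X.XIsoOfEq (e i)).hom ≫ g i) ≫ ((-n).negOnePow • Y.d (i + -n) (j + -n)) =
      X.d i j ≫ (X.XIsoOfEq (e j)).hom ≫ g j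
    rw [hn, Linear.comp_units_smul, Category.assoc, hg i j hi hj, Linear.comp_units_smul,
      smul_smul, Int.units_mul_self, one_smul]
    simp

variable {ι : Type*} {c : ComplexShape ι} (e : c.Embedding (ComplexShape.up ℤ)) [e.IsRelIff]
  [HasZeroObject V]

/-- Extension by zero along an embedding is fully faithful, so an isomorphism of brutal truncations
is the same as an isomorphism of the restrictions to the degrees in the range. -/
lemma nonempty_stupidTrunc_iso_iff (X Y : CochainComplex V ℤ) :
    Nonempty (X.stupidTrunc e ≅ Y.stupidTrunc e) ↔ AgreeOn (fun i => ∃ a, e.f a = i) X Y := by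
  classical
  constructor
  · rintro ⟨φ⟩
    let ψ : HomologicalComplex.restriction X e ≅ HomologicalComplex.restriction Y e :=
      (e.fullyFaithfulExtendFunctor V).preimageIso φ
    let f (i : ℤ) : X.X i ⟶ Y.X i := if h : ∃ a, e.f a = i then
      (HomologicalComplex.restrictionXIso X e h.choose_spec).inv ≫ ψ.hom.f h.choose ≫
        (HomologicalComplex.restrictionXIso Y e h.choose_spec).hom else 0
    have hf (a : ι) : f (e.f a) = ψ.hom.f a := by
      have h : ∃ a', e.f a' = e.f a := ⟨a, rfl⟩
      have h' : h.choose = a := e.injective_f h.choose_spec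
      have (b : ι) (hb : b = a) (hb' : e.f b = e.f a) :
          (HomologicalComplex.restrictionXIso X e hb').inv ≫ ψ.hom.f b ≫
            (HomologicalComplex.restrictionXIso Y e hb').hom = ψ.hom.f a := by
        subst hb
        exact (Category.id_comp _).trans (Category.comp_id _)
      dsimp only [f]
      rw [dif_pos h]
      exact this _ h' _
    refine ⟨f, ?_, ?_⟩
    · rintro _ ⟨a, rfl⟩
      rw [hf]
      exact inferInstanceAs (IsIso (ψ.hom.f a))
    · rintro _ _ ⟨a, rfl⟩ ⟨b, rfl⟩
      rw [hf, hf]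
      exact ψ.hom.comm a b
  · rintro ⟨f, hf, hf'⟩
    have := fun a => hf (e.f a) ⟨a, rfl⟩
    refine ⟨(e.extendFunctor V).mapIso (HomologicalComplex.Hom.isoOfComponents
      (fun a => @asIso _ _ _ _ (f (e.f a)) (this a)) (fun a b _ => hf' (e.f a) (e.f b) ⟨a, rfl⟩ ⟨b, rfl⟩))⟩

end AgreeOn

lemma AgreeOn.acyclicAt [HasZeroObject C] [HasBinaryBiproducts C] [IsExactStructure S]
    {X Y : ProjComplex S} {P : ℤ → Prop} (h : AgreeOn P X Y) {j : ℤ}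
    (hj₁ : P (j - 1)) (hj : P j) (hj₂ : P (j + 1)) (hX : AcyclicAt X j) : AcyclicAt Y j := by
  obtain ⟨f, hf, hf'⟩ := h
  intro i k hi hk
  obtain rfl : i = j - 1 := by omega
  subst hk
  obtain ⟨Z, Z', q, ι, π, κ, w, h, hq, hκ, h₁, h₂⟩ := hX _ _ hi rfl
  have := hf _ hj₁
  have := hf _ hj
  have := hf _ hj₂
  let e (i : ℤ) (hi : P i) : (X.X i).obj ≅ (Y.X i).obj :=
    have := hf i hi
    (projectives S).ι.mapIso (asIso (f i))
  have he (i k) (hi : P i) (hk : P k) :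
      (e i hi).hom ≫ (Y.d i k).hom = (X.d i k).hom ≫ (e k hk).hom :=
    congrArg (fun k => k.hom) (hf' i k hi hk)
  refine ⟨Z, Z', (e _ hj₁).inv ≫ q, ι ≫ (e _ hj).hom, (e _ hj).inv ≫ π, κ ≫ (e _ hj₂).hom,
    by simp [w], conflation_of_iso h _ (Iso.refl _) (e _ hj) (Iso.refl _) (by simp) (by simp),
    hq.iso_comp (e _ hj₁).symm, hκ.comp_iso _, ?_, ?_⟩
  · rw [← cancel_epi (e _ hj₁).hom, he _ _ hj₁ hj, h₁]
    simp
  · rw [← cancel_epi (e _ hj).hom, he _ _ hj hj₂, h₂]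
    simp

variable [HasZeroObject C] [HasBinaryBiproducts C] [IsFrobenius S]

/-- In degrees `≤ -1` the complex is a resolution of `Z' 0`, the cokernel of the inflation into
degree `-1`. Splicing it with a coresolution of the same object gives a model of an identity arrow,
which is acyclic. -/
lemma exists_isAcyclicComplex_left_of_nonpos (X : ProjComplex S) (hX : ∀ j ≤ -1, AcyclicAt X j) :
    ∃ Y : ProjComplex S, IsAcyclicComplex S Y ∧ AgreeOn (· ≤ -1) X Y := by
  have h (n : ℕ) := hX (Int.negSucc n) (by omega) (Int.negSucc (n + 1)) (Int.negSucc n + 1)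
    (by omega) rfl
  choose Z Z' q ι π κ w h hq hκ h₁ h₂ using h
  have : ∀ i, Mono (ι i) := fun i => conflation_mono (h i)
  have : ∀ i, Mono (κ i) := fun i => (hκ i).mono
  have h' (n : ℕ) := conflation_of_comp_eq (h (n + 1)) (hq n) ((h₂ (n + 1)).symm.trans (h₁ n))
  let L : LeftRes S (Z' 0) :=
    { Z := fun | 0 => Z' 0 | n + 1 => Z n
      P := fun n => X.X (Int.negSucc n)
      ι := fun n => ι n
      π := fun | 0 => π 0 | n + 1 => q n
      w := fun | 0 => w 0 | n + 1 => (h' n).choose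
      conflation := fun | 0 => h 0 | n + 1 => (h' n).choose_spec
      e := Iso.refl _ }
  let M := L.splice (nonempty_rightRes S _).some (𝟙 _)
  have : IsIso (Arrow.mk (𝟙 (Z' 0))).hom := inferInstanceAs (IsIso (𝟙 _))
  refine ⟨M.W, M.isAcyclicComplex, fun | Int.ofNat n => 0 | Int.negSucc n => 𝟙 _, ?_, ?_⟩
  · rintro (n | n) hn
    · simp only [Int.ofNat_eq_natCast] at hn
      omega
    · exact inferInstanceAs (IsIso (𝟙 (X.X (Int.negSucc n))))
  · rintro (n | n) (m | m) hn hm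
    · simp only [Int.ofNat_eq_natCast] at hn
      omega
    · simp only [Int.ofNat_eq_natCast] at hn
      omega
    · simp only [Int.ofNat_eq_natCast] at hm
      omega
    · by_cases hnm : n = m + 1
      · subst hnm
        have h₃ : (M.W.d (Int.negSucc (m + 1)) (Int.negSucc m)).hom = q m ≫ 𝟙 _ ≫ ι m :=
          M.d_eq (Int.negSucc (m + 1))
        ext
        change 𝟙 _ ≫ _ = _ ≫ 𝟙 _
        rw [h₃, h₁ m]
        exact (Category.id_comp _).trans ((congrArg (q m ≫ ·) (Category.id_comp _)).trans
          (Category.comp_id (q m ≫ ι m)).symm)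
      · rw [M.W.shape, X.shape]
        · exact comp_zero.trans zero_comp.symm
        · simp only [ComplexShape.up_Rel]
          omega
        · simp only [ComplexShape.up_Rel]
          omega

/-- Dually, the part in degrees `≥ 0` is a coresolution of the cycles `Z 0`, and is completed by a
resolution of that object. -/
lemma exists_isAcyclicComplex_right_of_nonneg (X : ProjComplex S) (hX : ∀ j, 0 ≤ j → AcyclicAt X j) :
    ∃ Y : ProjComplex S, IsAcyclicComplex S Y ∧ AgreeOn (0 ≤ ·) X Y := by
  have h (n : ℕ) := hX (Int.ofNat n) (by simp) (Int.ofNat n - 1) (Int.ofNat (n + 1))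
    (by simp) rfl
  choose Z Z' q ι π κ w h hq hκ h₁ h₂ using h
  have : ∀ i, Mono (ι i) := fun i => conflation_mono (h i)
  have : ∀ i, Mono (κ i) := fun i => (hκ i).mono
  have h₀ (n : ℕ) : ∃ q' : (X.X (Int.ofNat n)).obj ⟶ Z (n + 1), AdmissibleEpi S q' ∧
      (X.d (Int.ofNat n) (Int.ofNat (n + 1))).hom = q' ≫ ι (n + 1) := by
    have e : Int.ofNat n = Int.ofNat (n + 1) - 1 := by simp
    let e' : (X.X (Int.ofNat n)).obj ≅ (X.X (Int.ofNat (n + 1) - 1)).obj :=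
      (projectives S).ι.mapIso (X.XIsoOfEq e)
    refine ⟨e'.hom ≫ q (n + 1), (hq (n + 1)).iso_comp e', ?_⟩
    rw [Category.assoc, ← h₁]
    exact congrArg (fun k => k.hom) (X.XIsoOfEq_hom_comp_d e (Int.ofNat (n + 1))).symm
  choose q' hq' h₁' using h₀
  have h' (n : ℕ) := conflation_of_comp_eq (h n) (hq' n) ((h₂ n).symm.trans (h₁' n))
  let R : RightRes S (Z 0) :=
    { Z := Z
      I := fun n => X.X (Int.ofNat n)
      ι := ι
      π := q'
      w := fun n => (h' n).choose
      conflation := fun n => (h' n).choose_spec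
      e := Iso.refl _ }
  let M := (nonempty_leftRes S _).some.splice R (𝟙 _)
  have : IsIso (Arrow.mk (𝟙 (Z 0))).hom := inferInstanceAs (IsIso (𝟙 _))
  refine ⟨M.W, M.isAcyclicComplex, fun | Int.ofNat n => 𝟙 _ | Int.negSucc n => 0, ?_, ?_⟩
  · rintro (n | n) hn
    · exact inferInstanceAs (IsIso (𝟙 (X.X (Int.ofNat n))))
    · omega
  · rintro (n | n) (m | m) hn hm
    · by_cases hnm : m = n + 1
      · subst hnm
        have h₃ : (M.W.d (Int.ofNat n) (Int.ofNat (n + 1))).hom = q' n ≫ 𝟙 _ ≫ ι (n + 1) :=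
          M.d_eq (Int.ofNat n)
        ext
        change 𝟙 _ ≫ _ = _ ≫ 𝟙 _
        rw [h₃, h₁' n]
        exact (Category.id_comp _).trans ((congrArg (q' n ≫ ·) (Category.id_comp _)).trans
          (Category.comp_id (q' n ≫ ι (n + 1))).symm)
      · rw [M.W.shape, X.shape]
        · exact comp_zero.trans zero_comp.symm
        · simp only [ComplexShape.up_Rel, Int.ofNat_eq_natCast]
          omega
        · simp only [ComplexShape.up_Rel, Int.ofNat_eq_natCast]
          omega
    · omega
    · omega
    · omega

lemma IsAcyclicComplex.shift {X : ProjComplex S} (hX : IsAcyclicComplex S X) (n : ℤ) :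
    IsAcyclicComplex S (X⟦n⟧) :=
  isAcyclicComplex_of_acyclicAt fun j => (hX.acyclicAt (j + n)).shift n j rfl

lemma exists_isAcyclicComplex_left (m : ℤ) (X : ProjComplex S) (hX : ∀ j ≤ m, AcyclicAt X j) :
    ∃ Y : ProjComplex S, IsAcyclicComplex S Y ∧ AgreeOn (· ≤ m) X Y := by
  obtain ⟨Y, hY, hXY⟩ := exists_isAcyclicComplex_left_of_nonpos (X⟦m + 1⟧) (fun j hj =>
    (hX (j + (m + 1)) (by omega)).shift (m + 1) j rfl)
  exact ⟨_, hY.shift (-(m + 1)), .of_shift _ (hXY.of_iff (fun i hi => by omega))⟩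

lemma exists_isAcyclicComplex_right (n : ℤ) (X : ProjComplex S)
    (hX : ∀ j, n ≤ j → AcyclicAt X j) :
    ∃ Y : ProjComplex S, IsAcyclicComplex S Y ∧ AgreeOn (n ≤ ·) X Y := by
  obtain ⟨Y, hY, hXY⟩ := exists_isAcyclicComplex_right_of_nonneg (X⟦n⟧) (fun j hj =>
    (hX (j + n) (by omega)).shift n j rfl)
  exact ⟨_, hY.shift (-n), .of_shift _ (hXY.of_iff (fun i hi => by omega))⟩

/-- Replaces the comparison with acyclic complexes by a condition on single degrees, which behaves
well under shifts, cones and glueing. The nontrivial direction is the completion of a half-acyclic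
complex to an acyclic one. -/
lemma isEventuallyAcyclic_iff (X : ProjComplex S) : IsEventuallyAcyclic S X ↔
    ∃ m n : ℤ, (∀ j ≤ m, AcyclicAt X j) ∧ (∀ j, n ≤ j → AcyclicAt X j) := by
  have hLE (m i : ℤ) : (∃ a, (ComplexShape.embeddingUpIntLE m).f a = i) ↔ i ≤ m := by
    have := ComplexShape.notMem_range_embeddingUpIntLE_iff m i
    rw [← not_iff_not]
    push Not
    exact this
  have hGE (m i : ℤ) : (∃ a, (ComplexShape.embeddingUpIntGE m).f a = i) ↔ m ≤ i := by
    have := ComplexShape.notMem_range_embeddingUpIntGE_iff m i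
    rw [← not_iff_not]
    push Not
    exact this
  constructor
  · rintro ⟨m, n, hmn, Y, Y', hY, hY', h, h'⟩
    rw [nonempty_stupidTrunc_iso_iff] at h h'
    -- One degree is lost on each side because acyclicity in degree `j` involves degrees `j - 1` and
    -- `j + 1`.
    refine ⟨m - 1, n + 1, fun j hj => ?_, fun j hj => ?_⟩
    · refine h.symm.acyclicAt ?_ ?_ ?_ (hY.acyclicAt j)
      all_goals
        rw [hLE]
        omega
    · refine h'.symm.acyclicAt ?_ ?_ ?_ (hY'.acyclicAt j)
      all_goals
        rw [hGE]
        omega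
  · rintro ⟨m, n, hm, hn⟩
    obtain ⟨Y, hY, h⟩ := exists_isAcyclicComplex_left m X hm
    obtain ⟨Y', hY', h'⟩ := exists_isAcyclicComplex_right (max m n) X
      (fun j hj => hn j (by omega))
    refine ⟨m, max m n, by omega, Y, Y', hY, hY', ?_, ?_⟩
    · rw [nonempty_stupidTrunc_iso_iff]
      exact h.of_iff (fun i hi => (hLE _ _).1 hi)
    · rw [nonempty_stupidTrunc_iso_iff]
      exact h'.of_iff (fun i hi => (hGE _ _).1 hi)

end Completion

end ExactCat

namespace ExactCat

/-! ### Acyclicity of mapping cones -/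

section Cone

variable {C : Type u} [Category.{v} C] [Preadditive C] {S : ObjectProperty (ShortComplex C)}

/-- The boundaries of `X` in degree `j` exist, and coincide with the cycles. -/
def BoundaryAt (X : ProjComplex S) (j : ℤ) : Prop :=
  ∀ i k, i + 1 = j → j + 1 = k → ∃ (Z : C) (q : (X.X i).obj ⟶ Z) (ι : Z ⟶ (X.X j).obj),
    AdmissibleEpi S q ∧ Mono ι ∧ (X.d i j).hom = q ≫ ι ∧
      ∀ ⦃W : C⦄ (f : W ⟶ (X.X j).obj), f ≫ (X.d j k).hom = 0 → ∃ l, l ≫ ι = f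

variable [HasZeroObject C] [HasBinaryBiproducts C] [IsExactStructure S]

lemma AcyclicAt.boundaryAt {X : ProjComplex S} {j : ℤ} (h : AcyclicAt X j) : BoundaryAt X j := by
  intro i k hi hk
  obtain ⟨Z, Z', q, ι, π, κ, w, h, hq, hκ, h₁, h₂⟩ := h i k hi hk
  have := hκ.mono
  refine ⟨Z, q, ι, hq, conflation_mono h, h₁, fun W f hf => conflation_lift h f ?_⟩
  rw [← cancel_mono κ, Category.assoc, ← h₂, hf, zero_comp]

lemma BoundaryAt.exists_conflation {X : ProjComplex S} {i j k l : ℤ} (hij : i + 1 = j)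
    (hjk : j + 1 = k) (hkl : k + 1 = l) (hj : BoundaryAt X j) (hk : BoundaryAt X k) :
    ∃ (Z Z' : C) (q : (X.X i).obj ⟶ Z) (ι : Z ⟶ (X.X j).obj) (q' : (X.X j).obj ⟶ Z')
      (ι' : Z' ⟶ (X.X k).obj) (w : ι ≫ q' = 0), AdmissibleEpi S q ∧
      S (ShortComplex.mk ι q' w) ∧ Mono ι' ∧ (X.d i j).hom = q ≫ ι ∧ (X.d j k).hom = q' ≫ ι' ∧
      ∀ ⦃W : C⦄ (f : W ⟶ (X.X k).obj), f ≫ (X.d k l).hom = 0 → ∃ l, l ≫ ι' = f := by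
  obtain ⟨Z, q, ι, hq, hι, h₁, h₂⟩ := hj _ _ hij hjk
  obtain ⟨Z', q', ι', hq', hι', h₁', h₂'⟩ := hk _ _ hjk hkl
  have := hq.epi
  have w : ι ≫ q' = 0 := by
    rw [← cancel_epi q, ← cancel_mono ι', Category.assoc, Category.assoc, ← h₁', ← Category.assoc,
      ← h₁, comp_zero, zero_comp]
    exact congrArg (fun k => k.hom) (X.d_comp_d i j k)
  refine ⟨Z, Z', q, ι, q', ι', w, hq, conflation_of_admissibleEpi w hq' hι fun f hf => ?_, hι', h₁,
    h₁', h₂'⟩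
  exact h₂ f (by rw [h₁', reassoc_of% hf, zero_comp])

/-- The data in degrees `j` and `k` give the conflation in degree `j`. Those in degrees `k` and `l`
identify the object of boundaries in degree `k` with the kernel of a deflation, which upgrades the
monomorphism `ι'` to an inflation. -/
lemma acyclicAt_of_boundaryAt {X : ProjComplex S} {j k l : ℤ} (hjk : j + 1 = k) (hkl : k + 1 = l)
    (hj : BoundaryAt X j) (hk : BoundaryAt X k) (hl : BoundaryAt X l) : AcyclicAt X j := by
  rintro i k hi rfl
  obtain rfl := hjk
  obtain ⟨Z, Z', q, ι, q', ι', w, hq, h, hι', h₁, h₂, h₃⟩ :=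
    BoundaryAt.exists_conflation hi rfl rfl hj hk
  obtain ⟨Y, Y', r, κ, r', κ', w', hr, h', hκ', h₁', h₂', h₃'⟩ :=
    BoundaryAt.exists_conflation rfl rfl rfl hk (hkl ▸ hl)
  have := conflation_mono h'
  have hr' := hr.epi
  obtain ⟨a, ha⟩ := conflation_lift h' ι' (by
    have := conflation_epi h
    rw [← cancel_epi q', ← cancel_mono κ', Category.assoc, Category.assoc, ← h₂',
      ← Category.assoc, ← h₂, comp_zero, zero_comp]
    exact congrArg (fun k => k.hom) (X.d_comp_d j (j + 1) (j + 1 + 1)))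
  obtain ⟨b, hb⟩ := h₃ κ (by rw [h₂', reassoc_of% w', zero_comp])
  let e : Z' ≅ Y :=
    ⟨a, b, by rw [← cancel_mono ι', Category.assoc, hb, ha, Category.id_comp],
      by rw [← cancel_mono κ, Category.assoc, ha, hb, Category.id_comp]⟩
  have : IsIso a := e.isIso_hom
  refine ⟨Z, Z', q, ι, q', ι', w, h, hq, ?_, h₁, h₂⟩
  rw [← ha]
  exact IsExactStructure.comp_mono _ _ (admissibleMono_of_isIso S a) ⟨_, _, _, h'⟩

/-- Up to sign, cycles of the cone are pairs of `x` in `Za` and `y` in `B₁` with `b' y = g x`, so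
they form the pullback `Z` of `b'` and `g`. It is an extension of `Za` by `Zb`, and `A₁ ⊞ B₀` maps
to it as an extension of `A₁` by `B₀`, through the deflations `a` and `b`; hence `q` is a deflation.
-/
lemma exists_boundary_cone {A₁ A₂ A₃ B₀ B₁ B₂ Za Zb Zb' : C} {a : A₁ ⟶ Za} {ia : Za ⟶ A₂}
    {dA : A₁ ⟶ A₂} {dA' : A₂ ⟶ A₃} (ha : AdmissibleEpi S a) [Mono ia] (hdA : dA = a ≫ ia)
    (hA : ∀ ⦃W : C⦄ (f : W ⟶ A₂), f ≫ dA' = 0 → ∃ l, l ≫ ia = f)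
    {b : B₀ ⟶ Zb} {ib : Zb ⟶ B₁} {dB : B₀ ⟶ B₁} (hb : AdmissibleEpi S b) (hdB : dB = b ≫ ib)
    {b' : B₁ ⟶ Zb'} {ib' : Zb' ⟶ B₂} {w : ib ≫ b' = 0} (hB : S (ShortComplex.mk ib b' w))
    [Mono ib'] {dB' : B₁ ⟶ B₂} (hdB' : dB' = b' ≫ ib') {f₁ : A₁ ⟶ B₁} {f₂ : A₂ ⟶ B₂}
    (hf : f₁ ≫ dB' = dA ≫ f₂) {g : Za ⟶ Zb'} (hg : g ≫ ib' = ia ≫ f₂) :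
    ∃ (Z : C) (q : A₁ ⊞ B₀ ⟶ Z) (ι : Z ⟶ A₂ ⊞ B₁), AdmissibleEpi S q ∧ Mono ι ∧
      biprod.lift (-(biprod.fst ≫ dA)) (biprod.fst ≫ f₁ + biprod.snd ≫ dB) = q ≫ ι ∧
      ∀ ⦃W : C⦄ (f : W ⟶ A₂ ⊞ B₁),
        f ≫ biprod.lift (-(biprod.fst ≫ dA')) (biprod.fst ≫ f₂ + biprod.snd ≫ dB') = 0 →
          ∃ l, l ≫ ι = f := by
  obtain ⟨Z, u, p, sq, hp⟩ := IsExactStructure.pullback (S := S) b' g ⟨_, _, _, hB⟩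
  obtain ⟨i, wi, hi, hiu⟩ := conflation_pullback hB sq
  obtain ⟨q, hq₁, hq₂⟩ : ∃ q : A₁ ⊞ B₀ ⟶ Z, q ≫ u = biprod.fst ≫ f₁ + biprod.snd ≫ dB ∧
      q ≫ p = biprod.fst ≫ a := by
    refine ⟨sq.lift _ _ ?_, sq.lift_fst _ _ _, sq.lift_snd _ _ _⟩
    rw [← cancel_mono ib']
    simp [Preadditive.add_comp, ← hdB', hdB, hf, hdA, hg]
    rw [hdB', reassoc_of% w]
    simp
  have h₀ : S (ShortComplex.mk (biprod.inr : B₀ ⟶ A₁ ⊞ B₀) biprod.fst (by simp)) :=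
    conflation_of_iso (conflation_biprod S B₀ A₁) _ (Iso.refl _) (biprod.braiding _ _)
      (Iso.refl _) (by ext <;> simp) (by simp)
  refine ⟨Z, q, biprod.lift (-(p ≫ ia)) u, ?_, ?_, ?_, fun W f hf => ?_⟩
  · exact admissibleEpi_τ₂ h₀ hi
      { τ₁ := b
        τ₂ := q
        τ₃ := a
        comm₁₂ := sq.hom_ext (by simp [hq₁, hdB, hiu]) (by simp [hq₂, wi])
        comm₂₃ := hq₂ } hb ha
  · refine Preadditive.mono_of_cancel_zero _ fun l hl => sq.hom_ext ?_ ?_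
    · simpa using hl =≫ biprod.snd
    · rw [← cancel_mono ia]
      simpa using hl =≫ biprod.fst
  · ext <;> simp [hq₁, reassoc_of% hq₂, hdA]
  · have h₁ := hf =≫ biprod.fst
    have h₂ := hf =≫ biprod.snd
    simp at h₁ h₂
    obtain ⟨l, hl⟩ := hA (f ≫ biprod.fst) (by simpa using h₁)
    refine ⟨sq.lift (f ≫ biprod.snd) (-l) ?_, ?_⟩
    · rw [← cancel_mono ib', Category.assoc, Category.assoc, ← hdB', Category.assoc, hg,
        Preadditive.neg_comp, reassoc_of% hl]
      exact eq_neg_of_add_eq_zero_right (by simpa using h₂)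
    · ext <;> simp [hl]

/-- The components of the mapping cone. -/
def mappingConeIso {K L : ProjComplex S} (φ : K ⟶ L) (i j : ℤ) (h : i + 1 = j) :
    ((CochainComplex.mappingCone φ).X i).obj ≅ (K.X j).obj ⊞ (L.X i).obj where
  hom := biprod.lift ((CochainComplex.mappingCone.fst φ).1.v i j h).hom
    ((CochainComplex.mappingCone.snd φ).v i i (add_zero i)).hom
  inv := biprod.desc ((CochainComplex.mappingCone.inl φ).v j i (by omega)).hom
    ((CochainComplex.mappingCone.inr φ).f i).hom
  hom_inv_id := by
    rw [biprod.lift_desc]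
    exact congrArg (fun k => k.hom) (CochainComplex.mappingCone.id_X φ i j h)
  inv_hom_id := by
    ext
    · simp only [Category.assoc, biprod.lift_fst, biprod.inl_desc_assoc, Category.comp_id,
        biprod.inl_fst]
      exact congrArg (fun k => k.hom) (CochainComplex.mappingCone.inl_v_fst_v φ j i h)
    · simp only [Category.assoc, biprod.lift_snd, biprod.inl_desc_assoc, Category.comp_id,
        biprod.inl_snd]
      exact congrArg (fun k => k.hom) (CochainComplex.mappingCone.inl_v_snd_v φ j i (by omega))
    · simp only [Category.assoc, biprod.lift_fst, biprod.inr_desc_assoc, Category.comp_id,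
        biprod.inr_fst]
      exact congrArg (fun k => k.hom) (CochainComplex.mappingCone.inr_f_fst_v φ i j h)
    · simp only [Category.assoc, biprod.lift_snd, biprod.inr_desc_assoc, Category.comp_id,
        biprod.inr_snd]
      exact congrArg (fun k => k.hom) (CochainComplex.mappingCone.inr_f_snd_v φ i)

lemma d_comp_mappingConeIso_hom {K L : ProjComplex S} (φ : K ⟶ L) (i j k : ℤ) (hij : i + 1 = j)
    (hjk : j + 1 = k) :
    ((CochainComplex.mappingCone φ).d i j).hom ≫ (mappingConeIso φ j k hjk).hom =
      (mappingConeIso φ i j hij).hom ≫ biprod.lift (-(biprod.fst ≫ (K.d j k).hom))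
        (biprod.fst ≫ (φ.f j).hom + biprod.snd ≫ (L.d i j).hom) := by
  have h₁ := congrArg (fun k => k.hom) (CochainComplex.mappingCone.d_fst_v φ i j k hij hjk)
  have h₂ := congrArg (fun k => k.hom) (CochainComplex.mappingCone.d_snd_v φ i j hij)
  ext
  · simp only [mappingConeIso, Category.assoc, biprod.lift_fst, Preadditive.comp_neg,
      biprod.lift_fst_assoc]
    exact h₁
  · simp only [mappingConeIso, Category.assoc, biprod.lift_snd, Preadditive.comp_add,
      biprod.lift_fst_assoc, biprod.lift_snd_assoc]
    exact h₂

lemma boundaryAt_mappingCone {K L : ProjComplex S} (φ : K ⟶ L) (i j k l : ℤ) (hij : i + 1 = j)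
    (hjk : j + 1 = k) (hkl : k + 1 = l) (hK : BoundaryAt K k) (hL : BoundaryAt L j)
    (hL' : BoundaryAt L k) : BoundaryAt (CochainComplex.mappingCone φ) j := by
  intro i' k' hi hk
  obtain rfl : i' = i := by omega
  obtain rfl : k' = k := by omega
  obtain ⟨Za, a, ia, ha, hia, hdA, hA⟩ := hK _ _ hjk hkl
  obtain ⟨Zb, Zb', b, ib, b', ib', w, hb, hB, hib', hdB, hdB', hB'⟩ :=
    BoundaryAt.exists_conflation hij hjk hkl hL hL'
  have := ha.epi
  have hφ (i j : ℤ) : (φ.f i).hom ≫ (L.d i j).hom = (K.d i j).hom ≫ (φ.f j).hom :=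
    congrArg (fun k => k.hom) (φ.comm i j)
  obtain ⟨g, hg⟩ := hB' (ia ≫ (φ.f k').hom) (by
    rw [← cancel_epi a, Category.assoc, hφ, ← Category.assoc, ← hdA, ← Category.assoc, comp_zero]
    have := congrArg (fun k => k.hom) (K.d_comp_d j k' l)
    change (K.d j k').hom ≫ (K.d k' l).hom = 0 at this
    rw [this, zero_comp])
  obtain ⟨Z, q, ι, hq, hι, h₁, h₂⟩ := exists_boundary_cone ha hdA hA hb hdB hB hdB' (hφ j k') hg
  let e := mappingConeIso φ
  refine ⟨Z, (e i' j hij).hom ≫ q, ι ≫ (e j k' hjk).inv, hq.iso_comp _, inferInstance, ?_, ?_⟩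
  · rw [← cancel_mono (e j k' hjk).hom, d_comp_mappingConeIso_hom φ i' j k' hij hjk, h₁]
    simp [e]
  · intro W f hf
    obtain ⟨l, hl⟩ := h₂ (f ≫ (e j k' hjk).hom) (by
      rw [Category.assoc, ← d_comp_mappingConeIso_hom φ j k' l hjk hkl, reassoc_of% hf,
        zero_comp])
    exact ⟨l, by rw [reassoc_of% hl, Iso.hom_inv_id, Category.comp_id]⟩

/-- Acyclicity of the cone in degree `j` needs its boundaries in degrees `j`, `j + 1`, `j + 2`, and
each of these looks at `K` and `L` at most one degree further, whence the range up to `j + 3`. -/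
lemma acyclicAt_mappingCone {K L : ProjComplex S} (φ : K ⟶ L) (j : ℤ)
    (hK : ∀ i, j ≤ i → i ≤ j + 3 → AcyclicAt K i) (hL : ∀ i, j ≤ i → i ≤ j + 3 → AcyclicAt L i) :
    AcyclicAt (CochainComplex.mappingCone φ) j := by
  have h (i : ℤ) (hi : j ≤ i) (hi' : i ≤ j + 2) :
      BoundaryAt (CochainComplex.mappingCone φ) i :=
    boundaryAt_mappingCone φ (i - 1) i (i + 1) (i + 2) (by omega) (by omega) (by omega)
      (hK _ (by omega) (by omega)).boundaryAt (hL _ (by omega) (by omega)).boundaryAt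
      (hL _ (by omega) (by omega)).boundaryAt
  exact acyclicAt_of_boundaryAt (k := j + 1) (l := j + 2) rfl (by omega) (h _ (by omega) (by omega))
    (h _ (by omega) (by omega)) (h _ (by omega) (by omega))

end Cone

/-! ### `K^{∞,b}(P, F)` is triangulated -/

section KInfB

variable {C : Type u} [Category.{v} C] [Preadditive C] [HasZeroObject C] [HasBinaryBiproducts C]
  (S : ObjectProperty (ShortComplex C)) [IsFrobenius S]

/-- The full subcategory `K^{∞,b}(P, F)`, before closing under isomorphisms. -/
def KInfBStrict : ObjectProperty (KProj S) :=
  (IsEventuallyAcyclic S).strictMap (HomotopyCategory.quotient _ _)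

lemma KInfBStrict_quotient_obj_iff (K : ProjComplex S) :
    KInfBStrict S ((HomotopyCategory.quotient _ _).obj K) ↔ IsEventuallyAcyclic S K := by
  refine ⟨?_, fun h ↦ ⟨_, h⟩⟩
  simp only [KInfBStrict, ObjectProperty.strictMap_iff]
  rintro ⟨L, h, hL⟩
  obtain rfl : L = K := congr_arg Quotient.as hL
  exact h

variable {S} in
lemma acyclicAt_of_isZero {X : ProjComplex S} {j : ℤ}
    (h : ∀ i, j - 1 ≤ i → i ≤ j + 1 → IsZero (X.X i)) : AcyclicAt X j := by
  intro i k hi hk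
  have h' (i : ℤ) (hi : j - 1 ≤ i) (hi' : i ≤ j + 1) : IsZero (X.X i).obj :=
    (projectives S).ι.map_isZero (h i hi hi')
  have h₁ := h' i (by omega) (by omega)
  have h₂ := h' j (by omega) (by omega)
  have h₃ := h' k (by omega) (by omega)
  have : IsIso (0 : (X.X j).obj ⟶ (X.X k).obj) := by
    rw [h₂.eq_of_src 0 (h₂.iso h₃).hom]
    infer_instance
  exact ⟨(X.X i).obj, (X.X j).obj, 𝟙 _, 0, 𝟙 _, 0, by simp, conflation_zero_left S _ h₁,
    admissibleEpi_of_isIso S _, admissibleMono_of_isIso S _, h₁.eq_of_src _ _, h₂.eq_of_src _ _⟩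

variable {S} in
lemma IsBoundedComplex.isEventuallyAcyclic {X : ProjComplex S} (hX : IsBoundedComplex S X) :
    IsEventuallyAcyclic S X := by
  obtain ⟨a, b, _, _⟩ := hX
  rw [isEventuallyAcyclic_iff]
  exact ⟨a - 2, b + 2, fun j hj => acyclicAt_of_isZero fun i hi hi' =>
    X.isZero_of_isStrictlyGE a i (by omega), fun j hj => acyclicAt_of_isZero fun i hi hi' =>
    X.isZero_of_isStrictlyLE b i (by omega)⟩

instance : (KInfBStrict S).ContainsZero where
  exists_zero :=
    ⟨(HomotopyCategory.quotient _ _).obj 0, Functor.map_isZero _ (isZero_zero _), by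
      rw [KInfBStrict_quotient_obj_iff]
      refine IsBoundedComplex.isEventuallyAcyclic ?_
      exact ⟨0, 0, inferInstance, inferInstance⟩⟩

instance : (KInfBStrict S).IsStableUnderShift ℤ where
  isStableUnderShiftBy n :=
    { le_shift K hK := by
        obtain ⟨K : CochainComplex _ _, rfl⟩ := K.quotient_obj_surjective
        rw [KInfBStrict_quotient_obj_iff, isEventuallyAcyclic_iff] at hK
        obtain ⟨a, b, ha, hb⟩ := hK
        rw [ObjectProperty.prop_shift_iff, HomotopyCategory.shift_quotient_obj,
          KInfBStrict_quotient_obj_iff, isEventuallyAcyclic_iff]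
        exact ⟨a - n, b - n, fun j hj => (ha (j + n) (by omega)).shift n j rfl,
          fun j hj => (hb (j + n) (by omega)).shift n j rfl⟩ }

variable {S} in
lemma isEventuallyAcyclic_mappingCone {K L : ProjComplex S} (f : K ⟶ L)
    (hK : IsEventuallyAcyclic S K) (hL : IsEventuallyAcyclic S L) :
    IsEventuallyAcyclic S (CochainComplex.mappingCone f) := by
  rw [isEventuallyAcyclic_iff] at hK hL ⊢
  obtain ⟨a, b, ha, hb⟩ := hK
  obtain ⟨a', b', ha', hb'⟩ := hL
  exact ⟨min a a' - 3, max b b', fun j hj => acyclicAt_mappingCone f j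
    (fun i _ _ => ha i (by omega)) (fun i _ _ => ha' i (by omega)),
    fun j hj => acyclicAt_mappingCone f j
      (fun i _ _ => hb i (by omega)) (fun i _ _ => hb' i (by omega))⟩

instance : (KInfBStrict S).IsTriangulatedClosed₃ where
  ext₃' T hT h₁ h₂ := by
    have h₁' : IsEventuallyAcyclic S T.obj₁.as := by
      rwa [← KInfBStrict_quotient_obj_iff]
    have h₂' : IsEventuallyAcyclic S T.obj₂.as := by
      rwa [← KInfBStrict_quotient_obj_iff]
    obtain ⟨f : T.obj₁.as ⟶ T.obj₂.as, hf⟩ :=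
      (HomotopyCategory.quotient _ _).map_surjective T.mor₁
    refine ⟨_, ?_,
      ⟨Triangle.π₃.mapIso (isoTriangleOfIso₁₂ T _ hT
        (HomotopyCategory.mappingCone_triangleh_distinguished f)
        (Iso.refl _) (Iso.refl _) ?_)⟩⟩
    · exact (KInfBStrict_quotient_obj_iff S _).2 (isEventuallyAcyclic_mappingCone f h₁' h₂')
    · exact (Category.comp_id _).trans (hf.symm.trans (Category.id_comp _).symm)

instance : (KInfBStrict S).IsTriangulated where
  toIsTriangulatedClosed₂ := .of_isTriangulatedClosed₃

instance : (KInfB S).IsTriangulated :=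
  inferInstanceAs (KInfBStrict S).isoClosure.IsTriangulated

end KInfB

end ExactCat

namespace ExactCat

/-! ### Verdier quotients -/

section Verdier

variable {D : Type u} [Category.{v} D] [Preadditive D] [HasZeroObject D] [HasShift D ℤ]
  [∀ n : ℤ, (shiftFunctor D n).Additive] [Pretriangulated D] [IsTriangulated D]
  (P : ObjectProperty D) [P.IsTriangulated]

/-- The morphism `0 ⟶ X` has cone `X`, so the localization inverts it. -/
lemma isZero_Q_obj {X : D} (hX : P X) : IsZero (P.trW.Q.obj X) := by
  have h := Localization.inverts P.trW.Q P.trW _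
    (ObjectProperty.trW.mk P (contractible_distinguished₁ X) hX)
  have : IsIso (P.trW.Q.map (0 : 0 ⟶ X)) := h
  exact (P.trW.Q.map_isZero (isZero_zero D)).of_iso (asIso (P.trW.Q.map (0 : 0 ⟶ X))).symm

/-- By calculus of fractions, `f` is killed by some `s` completed to a triangle by an object `B` of
`P`, so it factors through the fibre `B` of `s`. -/
lemma exists_factorization_of_Q_map_eq_zero {X Y : D} (f : X ⟶ Y) (hf : P.trW.Q.map f = 0) :
    ∃ (B : D) (_ : P B) (a : X ⟶ B) (b : B ⟶ Y), f = a ≫ b := by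
  obtain ⟨Z, s, hs, h⟩ := (MorphismProperty.map_eq_iff_postcomp P.trW.Q P.trW f 0).1
    (by rw [hf, Functor.map_zero])
  rw [P.trW_iff'] at hs
  obtain ⟨B, g, k, hT, hB⟩ := hs
  obtain ⟨a, ha⟩ := Triangle.coyoneda_exact₂ _ hT f (h.trans zero_comp)
  exact ⟨B, hB, a, g, ha⟩

/-- Write a morphism of the quotient as a fraction `(φ.f, φ.s)` and let `B` be the cone of `φ.s`.
The composite of `φ.f` with the map to `B` comes from `T.obj₁`, as `X` has no maps to `T.obj₃`; and
`T.obj₁ ⟶ B` lifts to `φ.Y'`, as `T.obj₁` has no maps to `Y⟦1⟧`. Subtracting `u ≫ v`, which vanishes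
in the quotient, from `φ.f` leaves a map through `φ.s`. -/
lemma Q_map_surjective {X Y : D} (h : ∀ B, P B → ∃ (T : Triangle D) (_ : T ∈ distTriang D)
      (_ : T.obj₂ ≅ B), P T.obj₁ ∧ (∀ f : X ⟶ T.obj₃, f = 0) ∧ (∀ f : T.obj₁ ⟶ Y⟦(1 : ℤ)⟧, f = 0)) :
    Function.Surjective (P.trW.Q.map : (X ⟶ Y) → _) := by
  intro x
  obtain ⟨φ, hφ⟩ := Localization.exists_leftFraction P.trW.Q P.trW x
  have hs := φ.hs
  obtain ⟨B, g, k, hT, hB⟩ := hs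
  obtain ⟨T, hT', e, hP, h₁, h₂⟩ := h B hB
  obtain ⟨u, hu⟩ := Triangle.coyoneda_exact₂ T hT' (φ.f ≫ g ≫ e.inv) (h₁ _)
  obtain ⟨v, hv'⟩ : ∃ v : T.obj₁ ⟶ φ.Y', T.mor₁ ≫ e.hom = v ≫ g :=
    Triangle.coyoneda_exact₃ _ hT (T.mor₁ ≫ e.hom) (h₂ _)
  obtain ⟨t, ht'⟩ : ∃ t : X ⟶ Y, φ.f - u ≫ v = t ≫ φ.s :=
      Triangle.coyoneda_exact₂ _ hT (φ.f - u ≫ v) (by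
    change (φ.f - u ≫ v) ≫ g = 0
    rw [Preadditive.sub_comp, Category.assoc, ← hv', ← reassoc_of% hu]
    simp)
  refine ⟨t, ?_⟩
  have := Localization.inverts P.trW.Q P.trW φ.s φ.hs
  rw [hφ, MorphismProperty.LeftFraction.map, ← cancel_mono (P.trW.Q.map φ.s), ← Functor.map_comp,
    ← ht']
  have h₀ : P.trW.Q.map (u ≫ v) = 0 := by
    rw [Functor.map_comp, (isZero_Q_obj P hP).eq_of_tgt (P.trW.Q.map u) 0, zero_comp]
  simp [h₀]

end Verdier

/-! ### Brutal truncations -/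

section Glue

variable {V : Type u} [Category.{v} V] [Preadditive V] {X X' : CochainComplex V ℤ}

/-- The objects of the complex which coincides with `X` in degrees `< s` and with `X'` in
degrees `≥ s`. -/
def glueX (X X' : CochainComplex V ℤ) (s i : ℤ) : V := if i < s then X.X i else X'.X i

/-- `glueX` in degrees `< s`. -/
def glueIsoLeft (X X' : CochainComplex V ℤ) {s i : ℤ} (h : i < s) : glueX X X' s i ≅ X.X i :=
  eqToIso (if_pos h)

/-- `glueX` in degrees `≥ s`. -/
def glueIsoRight (X X' : CochainComplex V ℤ) {s i : ℤ} (h : ¬ i < s) :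
    glueX X X' s i ≅ X'.X i :=
  eqToIso (if_neg h)

/-- The map from `X`. -/
def glueIn (φ : X ⟶ X') (s i : ℤ) : X.X i ⟶ glueX X X' s i :=
  if h : i < s then (glueIsoLeft X X' h).inv else φ.f i ≫ (glueIsoRight X X' h).inv

/-- The map to `X'`. -/
def glueOut (φ : X ⟶ X') (s i : ℤ) : glueX X X' s i ⟶ X'.X i :=
  if h : i < s then (glueIsoLeft X X' h).hom ≫ φ.f i else (glueIsoRight X X' h).hom

/-- The differential. -/
def glueD (φ : X ⟶ X') (s i j : ℤ) : glueX X X' s i ⟶ glueX X X' s j :=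
  if h : i < s then (glueIsoLeft X X' h).hom ≫ X.d i j ≫ glueIn φ s j
  else if h' : j < s then 0 else
    (glueIsoRight X X' h).hom ≫ X'.d i j ≫ (glueIsoRight X X' h').inv

variable (φ : X ⟶ X') (s : ℤ)

lemma glueIn_of_lt {i : ℤ} (h : i < s) : glueIn φ s i = (glueIsoLeft X X' h).inv := dif_pos h

lemma glueOut_of_not_lt {i : ℤ} (h : ¬ i < s) : glueOut φ s i = (glueIsoRight X X' h).hom :=
  dif_neg h

lemma glueIn_glueOut (i : ℤ) : glueIn φ s i ≫ glueOut φ s i = φ.f i := by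
  by_cases h : i < s <;> simp [glueIn, glueOut, h]

lemma glueIn_glueD (i j : ℤ) : glueIn φ s i ≫ glueD φ s i j = X.d i j ≫ glueIn φ s j := by
  by_cases h : i < s
  · simp [glueD, glueIn, h]
  · by_cases h' : j < s
    · rw [X.shape i j (by simp only [ComplexShape.up_Rel]; omega)]
      simp [glueD, h, h']
    · simp [glueD, glueIn, h, h']

lemma glueD_glueOut (i j : ℤ) : glueD φ s i j ≫ glueOut φ s j = glueOut φ s i ≫ X'.d i j := by
  by_cases h : i < s
  · rw [glueD, dif_pos h, Category.assoc, Category.assoc, glueIn_glueOut, glueOut, dif_pos h,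
      Category.assoc, φ.comm]
  · by_cases h' : j < s
    · rw [X'.shape i j (by simp only [ComplexShape.up_Rel]; omega)]
      simp [glueD, h, h']
    · simp [glueD, glueOut, h, h']

/-- The complex which coincides with `X` in degrees `< s` and with `X'` in degrees `≥ s`. -/
def glue : CochainComplex V ℤ where
  X := glueX X X' s
  d := glueD φ s
  shape i j hij := by
    by_cases h : i < s
    · simp [glueD, h, X.shape i j hij]
    · by_cases h' : j < s
      · simp [glueD, h, h']
      · simp [glueD, h, h', X'.shape i j hij]
  d_comp_d' i j k _ _ := by
    by_cases h : i < s
    · rw [glueD, dif_pos h, Category.assoc, Category.assoc, glueIn_glueD]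
      simp
    · by_cases h' : j < s
      · simp [glueD, h, h']
      · by_cases h'' : k < s
        · simp [glueD, h, h', h'']
        · simp [glueD, h, h', h'']

/-- The map from the complex which provides the components of degrees `< s`. -/
@[simps]
def toGlue : X ⟶ glue φ s where
  f := glueIn φ s
  comm' i j _ := glueIn_glueD φ s i j

/-- The map to the complex which provides the components of degrees `≥ s`. -/
@[simps]
def fromGlue : glue φ s ⟶ X' where
  f := glueOut φ s
  comm' i j _ := (glueD_glueOut φ s i j).symm

lemma isIso_toGlue_f {i : ℤ} (h : i < s ∨ IsIso (φ.f i)) : IsIso ((toGlue φ s).f i) := by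
  rw [toGlue_f]
  by_cases h' : i < s
  · rw [glueIn_of_lt _ _ h']
    exact (glueIsoLeft X X' h').isIso_inv
  · have := h.resolve_left h'
    rw [glueIn, dif_neg h']
    exact inferInstanceAs (IsIso (φ.f i ≫ (glueIsoRight X X' h').inv))

lemma isIso_fromGlue_f {i : ℤ} (h : s ≤ i ∨ IsIso (φ.f i)) : IsIso ((fromGlue φ s).f i) := by
  rw [fromGlue_f]
  by_cases h' : i < s
  · have := h.resolve_left (by omega)
    rw [glueOut, dif_pos h']
    exact inferInstanceAs (IsIso ((glueIsoLeft X X' h').hom ≫ φ.f i))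
  · rw [glueOut_of_not_lt _ _ h']
    exact (glueIsoRight X X' h').isIso_hom

lemma agreeOn_glue_left : AgreeOn (· < s) X (glue φ s) :=
  ⟨(toGlue φ s).f, fun _ hi => isIso_toGlue_f φ s (.inl hi), fun i j _ _ => (toGlue φ s).comm i j⟩

lemma agreeOn_glue_right : AgreeOn (s ≤ ·) (glue φ s) X' :=
  ⟨(fromGlue φ s).f, fun _ hi => isIso_fromGlue_f φ s (.inl hi),
    fun i j _ _ => (fromGlue φ s).comm i j⟩

variable [HasZeroObject V] (B : CochainComplex V ℤ)

/-- The brutal truncation in degrees `≥ s`. -/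
abbrev brutalGE : CochainComplex V ℤ := glue (0 : (0 : CochainComplex V ℤ) ⟶ B) s

/-- The brutal truncation in degrees `< s`. -/
abbrev brutalLT : CochainComplex V ℤ := glue (0 : B ⟶ (0 : CochainComplex V ℤ)) s

lemma isZero_glue_left {i : ℤ} (hi : i < s) (h : IsZero (X.X i)) : IsZero ((glue φ s).X i) :=
  h.of_iso (glueIsoLeft X X' hi)

lemma isZero_glue_right {i : ℤ} (hi : s ≤ i) (h : IsZero (X'.X i)) : IsZero ((glue φ s).X i) :=
  h.of_iso (glueIsoRight X X' (by omega))

lemma isZero_zero_X (i : ℤ) : IsZero ((0 : CochainComplex V ℤ).X i) :=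
  (HomologicalComplex.eval V _ i).map_isZero (isZero_zero _)

/-- The short exact sequence given by the brutal truncations. -/
def brutalShortComplex : ShortComplex (CochainComplex V ℤ) :=
  ShortComplex.mk (fromGlue (0 : (0 : CochainComplex V ℤ) ⟶ B) s)
    (toGlue (0 : B ⟶ (0 : CochainComplex V ℤ)) s) (by
      ext i
      by_cases hi : i < s
      · exact (isZero_glue_left _ s hi (isZero_zero_X i)).eq_of_src _ _
      · exact (isZero_glue_right _ s (not_lt.1 hi) (isZero_zero_X i)).eq_of_tgt _ _)

/-- The brutal truncations give a degreewise split sequence. -/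
def brutalSplitting (i : ℤ) :
    ((brutalShortComplex s B).map (HomologicalComplex.eval V _ i)).Splitting :=
  if hi : i < s then
    { r := 0
      s := (glueIsoLeft B 0 hi).hom
      f_r := (isZero_glue_left (0 : (0 : CochainComplex V ℤ) ⟶ B) s hi (isZero_zero_X i)).eq_of_src _ _
      s_g := by
        change (glueIsoLeft B 0 hi).hom ≫ glueIn _ s i = 𝟙 _
        rw [glueIn_of_lt _ _ hi]
        exact Iso.hom_inv_id _
      id := by
        change (0 : B.X i ⟶ glueX 0 B s i) ≫ glueOut 0 s i +
          glueIn 0 s i ≫ (glueIsoLeft B 0 hi).hom = 𝟙 (B.X i)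
        rw [glueIn_of_lt _ _ hi, zero_comp, zero_add, Iso.inv_hom_id] }
  else
    { r := (glueIsoRight 0 B hi).inv
      s := 0
      f_r := by
        change glueOut _ s i ≫ (glueIsoRight 0 B hi).inv = 𝟙 _
        rw [glueOut_of_not_lt _ _ hi]
        exact Iso.hom_inv_id _
      s_g := (isZero_glue_right (0 : B ⟶ (0 : CochainComplex V ℤ)) s (not_lt.1 hi)
        (isZero_zero_X i)).eq_of_src _ _
      id := by
        change (glueIsoRight 0 B hi).inv ≫ glueOut 0 s i +
          glueIn 0 s i ≫ (0 : glueX B 0 s i ⟶ B.X i) = 𝟙 (B.X i)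
        rw [glueOut_of_not_lt _ _ hi, comp_zero, add_zero, Iso.inv_hom_id] }

end Glue

end ExactCat

namespace ExactCat

/-! ### The functor to the Verdier quotient -/

section Functor

variable {C : Type u} [Category.{v} C] [Preadditive C] [HasZeroObject C] [HasBinaryBiproducts C]
  {S : ObjectProperty (ShortComplex C)} [IsFrobenius S]

instance (α : MorEpi S) : Epi α.obj.hom := α.property.epi

/-- The map in the homotopy category between models which is given by any lift of a morphism
of arrows. -/
def mapModel {α β : Arrow C} [Epi α.hom] (M : Model S α) (N : Model S β) (f : α ⟶ β) :
    (HomotopyCategory.quotient _ (ComplexShape.up ℤ)).obj M.W ⟶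
      (HomotopyCategory.quotient _ _).obj N.W :=
  (HomotopyCategory.quotient _ _).map (M.exists_isLift N f).choose

/-- The difference of two lifts of `f` lifts the zero morphism, hence is null homotopic; so any lift
computes `mapModel`. -/
lemma Model.IsLift.mapModel_eq {α β : Arrow C} [Epi α.hom] {M : Model S α} {N : Model S β}
    {f : α ⟶ β} {φ : M.W ⟶ N.W} (h : M.IsLift N f φ) :
    mapModel M N f = (HomotopyCategory.quotient _ _).map φ := by
  obtain ⟨H⟩ := ((M.exists_isLift N f).choose_spec.add (h.neg (k := Arrow.homMk (-f.left) (-f.right)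
    (by simp)) rfl rfl) (k := Arrow.homMk 0 0 (by simp)) (by simp) (by simp)).homotopy_zero rfl
  have := HomotopyCategory.eq_of_homotopy _ _ H
  rw [Functor.map_add, Functor.map_neg, Functor.map_zero, add_neg_eq_zero] at this
  exact this

lemma mapModel_id {α : Arrow C} [Epi α.hom] (M : Model S α) : mapModel M M (𝟙 α) = 𝟙 _ := by
  rw [(Model.IsLift.id M).mapModel_eq, CategoryTheory.Functor.map_id]

lemma mapModel_comp {α β γ : Arrow C} [Epi α.hom] [Epi β.hom] (M : Model S α) (N : Model S β)
    (O : Model S γ) (f : α ⟶ β) (g : β ⟶ γ) :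
    mapModel M O (f ≫ g) = mapModel M N f ≫ mapModel N O g := by
  rw [((M.exists_isLift N f).choose_spec.comp (N.exists_isLift O g).choose_spec).mapModel_eq,
    Functor.map_comp]
  rfl

lemma mapModel_add {α β : Arrow C} [Epi α.hom] (M : Model S α) (N : Model S β) (f g k : α ⟶ β)
    (hl : k.left = f.left + g.left) (hr : k.right = f.right + g.right) :
    mapModel M N k = mapModel M N f + mapModel M N g := by
  rw [((M.exists_isLift N f).choose_spec.add (M.exists_isLift N g).choose_spec hl hr).mapModel_eq,
    Functor.map_add]
  rfl

variable (S) in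
/-- The functor which sends a deflation to the class of its model in `K(P)`. -/
def modelFunctor : MorEpi S ⥤ KProj S where
  obj α := (HomotopyCategory.quotient _ _).obj (model S α.obj).W
  map f := mapModel _ _ f.hom
  map_id _ := mapModel_id _
  map_comp _ _ := mapModel_comp _ _ _ _ _

instance : (modelFunctor S).Additive where
  map_add := mapModel_add _ _ _ _ _ rfl rfl

lemma modelFunctor_map_surjective {α β : MorEpi S} :
    Function.Surjective ((modelFunctor S).map : (α ⟶ β) → _) := by
  intro φ
  obtain ⟨φ, rfl⟩ := (HomotopyCategory.quotient _ _).map_surjective φ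
  obtain ⟨f, hf⟩ := Model.exists_isLift_hom _ _ φ
  exact ⟨ObjectProperty.homMk f, hf.mapModel_eq⟩

variable (S) in
lemma isEventuallyAcyclic_model (α : Arrow C) (M : Model S α) : IsEventuallyAcyclic S M.W := by
  rw [isEventuallyAcyclic_iff]
  exact ⟨-2, 1, fun j hj => M.acyclicAt (by omega) (by omega),
    fun j hj => M.acyclicAt (by omega) (by omega)⟩

variable (S) in
/-- The functor which sends a deflation to the class of its model in `K^{∞,b}(P, F)`. -/
def toKInfB : MorEpi S ⥤ (KInfB S).FullSubcategory :=
  (KInfB S).lift (modelFunctor S)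
    (fun α => (KInfBStrict S).le_isoClosure _ ((KInfBStrict_quotient_obj_iff S _).2
      (isEventuallyAcyclic_model S α.obj _)))

instance : (toKInfB S).Additive where
  map_add {_ _ f g} := by
    ext
    exact (modelFunctor S).map_add

lemma toKInfB_map_surjective {α β : MorEpi S} :
    Function.Surjective ((toKInfB S).map : (α ⟶ β) → _) := by
  intro φ
  obtain ⟨f, hf⟩ := modelFunctor_map_surjective φ.hom
  exact ⟨f, by ext; exact hf⟩

variable (S) in
/-- The objects of `K^{∞,b}(P, F)` which are isomorphic to bounded complexes. -/
abbrev boundedInKInfB : ObjectProperty (KInfB S).FullSubcategory :=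
  (KBounded S).inverseImage (KInfB S).ι

variable (S) in
/-- The functor from the category of deflations to the Verdier quotient. -/
def toVerdier : MorEpi S ⥤ KInfBModKBounded S :=
  toKInfB S ⋙ (boundedInKInfB S).trW.Q

instance : (toVerdier S).Additive := by
  dsimp only [toVerdier]
  infer_instance

/-! ### Orthogonality of models and bounded complexes -/

/-- The homotopy starts with zeros to the left of `B` and is continued to the right; the only degree
where the model does not extend maps is `-1`, and there `B` vanishes. -/
lemma Model.quotient_hom_eq_zero_right {α : Arrow C} [Epi α.hom] (M : Model S α) {B : ProjComplex S}
    (hB : IsBoundedComplex S B) (hB' : IsZero (B.X (-1)))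
    (φ : (HomotopyCategory.quotient _ (ComplexShape.up ℤ)).obj M.W ⟶
      (HomotopyCategory.quotient _ _).obj B) : φ = 0 := by
  obtain ⟨φ, rfl⟩ := (HomotopyCategory.quotient _ _).map_surjective φ
  obtain ⟨a, b, _, _⟩ := hB
  obtain ⟨H⟩ := exists_homotopy_zero φ (a - 1) 0 0
    ((B.isZero_of_isStrictlyGE a _ (by omega)).eq_of_tgt _ _)
    (fun i hi => by
      by_cases hi : i = -1
      · subst hi
        exact .inr hB'
      · exact .inl (M.extendsFrom hi))
    (fun i hi => .inl (liftsTo_of_isZero _ _ (B.isZero_of_isStrictlyGE a _ (by omega))))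
  rw [HomotopyCategory.eq_of_homotopy _ _ H, Functor.map_zero]

/-- Here the homotopy starts to the right of `B` and is continued to the left. That `α` is a
deflation, and not just an epimorphism, is what allows the lift in degree `0`. -/
lemma Model.quotient_hom_eq_zero_left {α : Arrow C} (hα : AdmissibleEpi S α.hom) (M : Model S α)
    {B : ProjComplex S} (hB : IsBoundedComplex S B) (hB' : IsZero (B.X (-1)))
    (φ : (HomotopyCategory.quotient _ (ComplexShape.up ℤ)).obj B ⟶
      (HomotopyCategory.quotient _ _).obj M.W) : φ = 0 := by
  obtain ⟨φ, rfl⟩ := (HomotopyCategory.quotient _ _).map_surjective φ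
  obtain ⟨a, b, _, _⟩ := hB
  obtain ⟨H⟩ := exists_homotopy_zero φ (b + 1) 0 0
    ((B.isZero_of_isStrictlyLE b _ (by omega)).eq_of_src _ _)
    (fun i hi => .inl (extendsFrom_of_isZero _ _ (B.isZero_of_isStrictlyLE b _ (by omega))))
    (fun i hi => by
      by_cases hi : i = -1
      · subst hi
        exact .inr hB'
      · exact .inl (M.liftsTo_of_admissibleEpi hi (M.admissibleEpi_γ hα i)))
  rw [HomotopyCategory.eq_of_homotopy _ _ H, Functor.map_zero]

lemma IsBoundedComplex.glue {X X' : ProjComplex S} (φ : X ⟶ X') (s : ℤ)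
    (hX : IsBoundedComplex S X) (hX' : IsBoundedComplex S X') : IsBoundedComplex S (glue φ s) := by
  obtain ⟨a, b, _, _⟩ := hX
  obtain ⟨a', b', _, _⟩ := hX'
  refine ⟨min a a', max b b', ?_, ?_⟩
  · rw [CochainComplex.isStrictlyGE_iff]
    intro i hi
    by_cases h : i < s
    · exact isZero_glue_left φ s h (X.isZero_of_isStrictlyGE a _ (by omega))
    · exact isZero_glue_right φ s (by omega) (X'.isZero_of_isStrictlyGE a' _ (by omega))
  · rw [CochainComplex.isStrictlyLE_iff]
    intro i hi
    by_cases h : i < s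
    · exact isZero_glue_left φ s h (X.isZero_of_isStrictlyLE b _ (by omega))
    · exact isZero_glue_right φ s (by omega) (X'.isZero_of_isStrictlyLE b' _ (by omega))

lemma isBoundedComplex_zero : IsBoundedComplex S (0 : ProjComplex S) :=
  ⟨0, 0, inferInstance, inferInstance⟩

lemma brutal_distinguished (s : ℤ) (B : ProjComplex S) :
    CochainComplex.trianglehOfDegreewiseSplit (brutalShortComplex s B) (brutalSplitting s B) ∈
      distTriang (KProj S) := by
  rw [HomotopyCategory.distinguished_iff_iso_trianglehOfDegreewiseSplit]
  exact ⟨_, _, ⟨Iso.refl _⟩⟩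

/-- The intermediate projective deflation is `P ⟶ 0`, corresponding to the complex with `P` alone in
degree `-1`. -/
lemma stableRel_zero_of_left {α β : MorEpi S} (f : α ⟶ β) {P : C} (hP : projectives S P)
    (a : α.obj.left ⟶ P) (b : P ⟶ β.obj.left) (hb : b ≫ β.obj.hom = 0)
    (hl : f.hom.left = a ≫ b) (hr : f.hom.right = 0) :
    stableRel (morEpiConflations S) f 0 := by
  refine ⟨MorEpi.of (p := (0 : P ⟶ 0)) ⟨_, _, _, conflation_zero_right S P (isZero_zero C)⟩,
    (morEpi_projectives_iff _).2 ⟨hP, (projectives S).prop_of_isZero (isZero_zero C)⟩,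
    MorEpi.ofHom a 0 ?_, MorEpi.ofHom b 0 ?_, ?_⟩
  · exact comp_zero.trans comp_zero.symm
  · exact hb.trans zero_comp.symm
  · rw [sub_zero]
    refine MorEpi.hom_ext ?_ ?_
    · exact hl
    · exact hr.trans zero_comp.symm

lemma stableRel_zero_of_id {α β : MorEpi S} (f : α ⟶ β) {Q : C} (hQ : projectives S Q)
    (a : α.obj.right ⟶ Q) (b : Q ⟶ β.obj.left) (hl : f.hom.left = α.obj.hom ≫ a ≫ b)
    (hr : f.hom.right = a ≫ b ≫ β.obj.hom) :
    stableRel (morEpiConflations S) f 0 := by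
  refine ⟨MorEpi.of (IsExactStructure.id_epi (S := S) Q),
    (morEpi_projectives_iff _).2 ⟨hQ, hQ⟩,
    MorEpi.ofHom (α.obj.hom ≫ a) a ?_, MorEpi.ofHom b (b ≫ β.obj.hom) ?_, ?_⟩
  · exact (Category.comp_id _)
  · exact (Category.id_comp _).symm
  · rw [sub_zero]
    refine MorEpi.hom_ext ?_ ?_
    · exact hl.trans (Category.assoc _ _ _).symm
    · exact hr

lemma stableRel_of_sub {α β : MorEpi S} {f g : α ⟶ β}
    (h : stableRel (morEpiConflations S) (f - g) 0) : stableRel (morEpiConflations S) f g := by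
  obtain ⟨P, hP, a, b, h⟩ := h
  exact ⟨P, hP, a, b, by rw [← h, sub_zero]⟩

/-- Orthogonality cuts `B` down to its component of degree `-1`. A chain map through that component
lifts a morphism `g` factoring through a deflation `P ⟶ 0`, while `f - g` has a null homotopic lift
and so factors through the identity of a projective object. -/
lemma Model.IsLift.stableRel_of_bounded {α β : MorEpi S} {M : Model S α.obj} {N : Model S β.obj}
    {f : α ⟶ β} {φ : M.W ⟶ N.W} (h : M.IsLift N f.hom φ) {B : ProjComplex S}
    (hB : IsBoundedComplex S B)
    (a : (HomotopyCategory.quotient _ (ComplexShape.up ℤ)).obj M.W ⟶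
      (HomotopyCategory.quotient _ _).obj B)
    (b : (HomotopyCategory.quotient _ (ComplexShape.up ℤ)).obj B ⟶
      (HomotopyCategory.quotient _ _).obj N.W)
    (hab : (HomotopyCategory.quotient _ _).map φ = a ≫ b) :
    stableRel (morEpiConflations S) f 0 := by
  let B' := brutalGE (-1) B
  have hB' : IsBoundedComplex S B' := isBoundedComplex_zero.glue _ _ hB
  -- The quotient of `B` in degrees `< -1` receives no nonzero map from `M`, so `a` factors through
  -- the part in degrees `≥ -1`.
  obtain ⟨a', ha'⟩ := Triangle.coyoneda_exact₂ _ (brutal_distinguished (-1) B) a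
    (M.quotient_hom_eq_zero_right (hB.glue _ _ isBoundedComplex_zero)
      (isZero_glue_right _ _ le_rfl (isZero_zero_X _)) _)
  let B'' := brutalLT 0 B'
  have hB'' : IsBoundedComplex S B'' := hB'.glue _ _ isBoundedComplex_zero
  -- The subcomplex of `B'` in degrees `≥ 0` has no nonzero map to `N`, so only the component of
  -- degree `-1` is left.
  obtain ⟨b', hb'⟩ := Triangle.yoneda_exact₂ _ (brutal_distinguished 0 B')
    ((HomotopyCategory.quotient _ _).map (fromGlue _ (-1)) ≫ b)
    (N.quotient_hom_eq_zero_left β.property (isBoundedComplex_zero.glue _ _ hB')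
      (isZero_glue_left _ _ (by simp) (isZero_zero_X _)) _)
  obtain ⟨a'', ha''⟩ := (HomotopyCategory.quotient _ _).map_surjective
    (X := M.W) (Y := B'') (a' ≫ (HomotopyCategory.quotient _ _).map (toGlue _ 0))
  obtain ⟨b'', hb''⟩ := (HomotopyCategory.quotient _ _).map_surjective (X := B'') (Y := N.W) b'
  have e : (HomotopyCategory.quotient _ _).map φ =
      (HomotopyCategory.quotient _ _).map (a'' ≫ b'') := by
    rw [hab, Functor.map_comp, ha'', hb'', ha']
    exact (Category.assoc _ _ _).trans ((congrArg (a' ≫ ·) hb').trans (Category.assoc _ _ _).symm)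
  have h₀ : IsZero (B''.X 0) := isZero_glue_right _ _ le_rfl (isZero_zero_X _)
  have h₂ : IsZero (B''.X (-2)) := isZero_glue_left _ _ (by simp)
    (isZero_glue_left _ _ (by simp) (isZero_zero_X _))
  obtain ⟨g, hg⟩ := M.exists_isLift_hom N (a'' ≫ b'')
  have hg₀ : g.right = 0 := by
    rw [← cancel_mono N.j, ← hg.j, zero_comp]
    have : a''.f 0 ≫ b''.f 0 = 0 := by rw [h₀.eq_of_src (b''.f 0) 0, comp_zero]
    exact (congrArg (fun k => M.j ≫ k.hom) this).trans comp_zero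
  obtain ⟨u, hu⟩ := M.exists_p_comp_eq (a''.f (-1)).hom (by
    have h := a''.comm (-2) (-1)
    rw [h₂.eq_of_src (B''.d (-2) (-1)) 0, comp_zero] at h
    exact (congrArg (fun k => k.hom) h).symm)
  have hw : (b''.f (-1)).hom ≫ (N.W.d (-1) 0).hom = 0 := by
    have h := b''.comm (-1) 0
    rw [h₀.eq_of_tgt (B''.d (-1) 0) 0, zero_comp] at h
    exact (congrArg (fun k => k.hom) h)
  have hst : stableRel (morEpiConflations S) (ObjectProperty.homMk g : α ⟶ β) 0 := by
    refine stableRel_zero_of_left _ (B''.X (-1)).property u ((b''.f (-1)).hom ≫ N.p) ?_ ?_ hg₀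
    · rw [N.d_neg_one_zero] at hw
      rw [← cancel_mono N.j]
      simpa using hw
    · rw [← cancel_epi M.p, reassoc_of% hu]
      exact hg.p.symm.trans (Category.assoc _ _ _)
  refine Congruence.equivalence.trans (stableRel_of_sub ?_) hst
  obtain ⟨H⟩ := (HomotopyCategory.quotient_map_eq_zero_iff _).1
    (show (HomotopyCategory.quotient _ _).map (φ + -(a'' ≫ b'')) = 0 by
      rw [Functor.map_add, Functor.map_neg, e, add_neg_cancel])
  obtain ⟨Q, hQ, c, d, h₁, h₂⟩ := ((h.add (hg.neg (k := Arrow.homMk (-g.left) (-g.right) (by simp))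
    rfl rfl) (k := (f - (ObjectProperty.homMk g : α ⟶ β)).hom) (sub_eq_add_neg _ _)
    (sub_eq_add_neg _ _))).exists_factorization H
  exact stableRel_zero_of_id _ hQ c d h₁ h₂

/-- The morphisms which factor through projective objects lift to morphisms which factor through
bounded complexes. -/
lemma exists_bounded_factorization {α β : MorEpi S} (f : α ⟶ β) {P : C} (hP : projectives S P)
    (a : α.obj.left ⟶ P) (b : P ⟶ β.obj.left) (hb : b ≫ β.obj.hom = 0)
    (hl : f.hom.left = a ≫ b) (hr : f.hom.right = 0) :
    ∃ (B : ProjComplex S) (_ : IsBoundedComplex S B) (u : (modelFunctor S).obj α ⟶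
      (HomotopyCategory.quotient _ _).obj B) (w : (HomotopyCategory.quotient _ _).obj B ⟶ _),
      (modelFunctor S).map f = u ≫ w := by
  let M := model S α.obj
  let N := model S β.obj
  obtain ⟨b', hb'⟩ := projectives_lift hP N.admissibleEpi_p b
  let u : M.W ⟶ (HomologicalComplex.single _ _ (-1)).obj ⟨P, hP⟩ :=
    HomologicalComplex.mkHomToSingle (ObjectProperty.homMk (M.p ≫ a)) (fun i hi => by
      ext
      change (M.W.d i (-1)).hom ≫ M.p ≫ a = 0
      rw [reassoc_of% (M.d_p i), zero_comp])
  let w : (HomologicalComplex.single _ _ (-1)).obj ⟨P, hP⟩ ⟶ N.W :=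
    HomologicalComplex.mkHomFromSingle (ObjectProperty.homMk b' :
      (⟨P, hP⟩ : (projectives S).FullSubcategory) ⟶ N.W.X (-1)) (fun i hi => by
      obtain rfl : i = 0 := by
        simp only [ComplexShape.up_Rel] at hi
        omega
      ext
      change b' ≫ (N.W.d (-1) 0).hom = 0
      rw [N.d_neg_one_zero, reassoc_of% hb', reassoc_of% hb, zero_comp])
  refine ⟨(HomologicalComplex.single _ _ (-1)).obj ⟨P, hP⟩, ⟨-1, -1, ?_, ?_⟩,
    (HomotopyCategory.quotient _ _).map u, (HomotopyCategory.quotient _ _).map w, ?_⟩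
  · rw [CochainComplex.isStrictlyGE_iff]
    exact fun i hi => HomologicalComplex.isZero_single_obj_X _ _ _ _ (by omega)
  · rw [CochainComplex.isStrictlyLE_iff]
    exact fun i hi => HomologicalComplex.isZero_single_obj_X _ _ _ _ (by omega)
  · have huw : (u ≫ w).f (-1) = (ObjectProperty.homMk (M.p ≫ a) :
        M.W.X (-1) ⟶ (⟨P, hP⟩ : (projectives S).FullSubcategory)) ≫ ObjectProperty.homMk b' := by
      simp [u, w]
    have h : M.IsLift N f.hom (u ≫ w) := by
      refine ⟨?_, ?_⟩
      · rw [huw]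
        change ((M.p ≫ a) ≫ b') ≫ N.p = _
        rw [Category.assoc, Category.assoc, hb', hl]
      · have : (u ≫ w).f 0 = 0 := by
          rw [HomologicalComplex.comp_f, (HomologicalComplex.isZero_single_obj_X _ _ _ _
            (by simp)).eq_of_src (w.f 0) 0, comp_zero]
        rw [hr, this, zero_comp]
        exact comp_zero
    exact h.mapModel_eq.trans (Functor.map_comp _ _ _)

/-- Extending `a` along `M.j` and lifting `b` along `N.p` gives a map from degree `0` to degree `-1`
through `Q`. The null homotopic map with this single component is a lift of `f`. -/
lemma modelFunctor_map_eq_zero {α β : MorEpi S} (f : α ⟶ β) {Q : C} (hQ : projectives S Q)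
    (a : α.obj.right ⟶ Q) (b : Q ⟶ β.obj.left) (hl : f.hom.left = α.obj.hom ≫ a ≫ b)
    (hr : f.hom.right = a ≫ b ≫ β.obj.hom) : (modelFunctor S).map f = 0 := by
  let M := model S α.obj
  let N := model S β.obj
  obtain ⟨b', hb'⟩ := projectives_lift hQ N.admissibleEpi_p b
  obtain ⟨a', ha'⟩ := projectives_extend hQ M.admissibleMono_j a
  let κ : M.W.X 0 ⟶ N.W.X (-1) := ObjectProperty.homMk (a' ≫ b')
  let h (i j : ℤ) (_ : (ComplexShape.up ℤ).Rel j i) : M.W.X i ⟶ N.W.X j :=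
    if hij : i = 0 ∧ j = -1 then
      (M.W.XIsoOfEq hij.1).hom ≫ κ ≫ (N.W.XIsoOfEq hij.2.symm).hom else 0
  have h₀ : h 0 (-1) (by simp) = κ := by simp [h]
  have h₁ : h 1 0 (by simp) = 0 := dif_neg (by simp)
  have h₂ : h (-1) (-2) (by simp) = 0 := dif_neg (by simp)
  have hf : M.IsLift N f.hom (Homotopy.nullHomotopicMap' h) := by
    refine ⟨?_, ?_⟩
    · rw [Homotopy.nullHomotopicMap'_f (k₂ := -2) (k₁ := -1) (k₀ := 0) (by simp) (by simp), h₀, h₂,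
        zero_comp, add_zero]
      change ((M.W.d (-1) 0).hom ≫ a' ≫ b') ≫ N.p = _
      rw [M.d_neg_one_zero, hl, Category.assoc, Category.assoc, Category.assoc, Category.assoc,
        hb', reassoc_of% ha']
    · rw [Homotopy.nullHomotopicMap'_f (k₂ := -1) (k₁ := 0) (k₀ := 1) (by simp) (by simp), h₀, h₁,
        comp_zero, zero_add]
      change M.j ≫ (a' ≫ b') ≫ (N.W.d (-1) 0).hom = _
      rw [N.d_neg_one_zero, hr, Category.assoc, Category.assoc, reassoc_of% ha',
        reassoc_of% hb', Category.assoc]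
  exact hf.mapModel_eq.trans ((HomotopyCategory.eq_of_homotopy _ _
    (Homotopy.nullHomotopy' h)).trans (Functor.map_zero _ _ _))

lemma boundedInKInfB_of_isBoundedComplex {X : (KInfB S).FullSubcategory} {B : ProjComplex S}
    (hB : IsBoundedComplex S B) (e : X.obj ≅ (HomotopyCategory.quotient _ _).obj B) :
    boundedInKInfB S X :=
  ⟨_, (KBoundedStrict_quotient_obj_iff S B).2 hB, ⟨e⟩⟩

/-- A bounded complex, as an object of `K^{∞,b}(P, F)`. -/
def boundedObj (B : ProjComplex S) (hB : IsBoundedComplex S B) : (KInfB S).FullSubcategory :=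
  ⟨(HomotopyCategory.quotient _ _).obj B, (KInfBStrict S).le_isoClosure _
    ((KInfBStrict_quotient_obj_iff S _).2 hB.isEventuallyAcyclic)⟩

lemma boundedInKInfB_boundedObj (B : ProjComplex S) (hB : IsBoundedComplex S B) :
    boundedInKInfB S (boundedObj B hB) :=
  boundedInKInfB_of_isBoundedComplex hB (Iso.refl _)

/-- A projective deflation `π` has a section `s`. The part `f₁` of `f` that passes through `s`
factors through the identity of the target of `π` and already vanishes in `K(P)`; the rest factors
through the source of `π` followed by a map killed by `β`, hence through a bounded complex. -/
lemma toVerdier_map_eq_zero {α β : MorEpi S} (f : α ⟶ β)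
    (hf : stableRel (morEpiConflations S) f 0) : (toVerdier S).map f = 0 := by
  obtain ⟨π, hπ, u, w, h⟩ := hf
  rw [sub_zero] at h
  obtain ⟨hπ₁, hπ₂⟩ := (morEpi_projectives_iff _).1 hπ
  obtain ⟨s, hs⟩ := projectives_lift hπ₂ π.property (𝟙 _)
  have h₁ : f.hom.left = u.hom.left ≫ w.hom.left := by rw [h]; rfl
  have h₂ : f.hom.right = u.hom.right ≫ w.hom.right := by rw [h]; rfl
  have hw := MorEpi.w w
  have hu := MorEpi.w u
  let f₁ : α ⟶ β := MorEpi.ofHom (α.obj.hom ≫ u.hom.right ≫ s ≫ w.hom.left)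
    (u.hom.right ≫ (s ≫ w.hom.left) ≫ β.obj.hom) (by simp)
  have hf₁ : (modelFunctor S).map f₁ = 0 := modelFunctor_map_eq_zero f₁ hπ₂ u.hom.right
    (s ≫ w.hom.left) rfl rfl
  obtain ⟨B, hB, a, b, hab⟩ := exists_bounded_factorization (f - f₁) hπ₁ u.hom.left
    (w.hom.left - π.obj.hom ≫ s ≫ w.hom.left) (by
      rw [Preadditive.sub_comp, Category.assoc, Category.assoc, hw, reassoc_of% hs, sub_self]) (by
      change f.hom.left - f₁.hom.left = _
      rw [h₁, Preadditive.comp_sub, ← Category.assoc u.hom.left π.obj.hom, hu, Category.assoc]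
      rfl) (by
      change f.hom.right - u.hom.right ≫ (s ≫ w.hom.left) ≫ β.obj.hom = 0
      rw [h₂, Category.assoc, hw, reassoc_of% hs, sub_self])
  have e : (toKInfB S).map f = (ObjectProperty.homMk a : (toKInfB S).obj α ⟶ boundedObj B hB) ≫
      (ObjectProperty.homMk b : boundedObj B hB ⟶ (toKInfB S).obj β) := by
    ext
    rw [Functor.map_sub, hf₁, sub_zero] at hab
    exact hab
  change (boundedInKInfB S).trW.Q.map ((toKInfB S).map f) = 0
  rw [e, Functor.map_comp, (isZero_Q_obj (boundedInKInfB S)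
    (boundedInKInfB_boundedObj B hB)).eq_of_tgt ((boundedInKInfB S).trW.Q.map _) 0, zero_comp]

lemma stableRel_of_toVerdier_map_eq_zero {α β : MorEpi S} (f : α ⟶ β)
    (hf : (toVerdier S).map f = 0) : stableRel (morEpiConflations S) f 0 := by
  obtain ⟨X, ⟨Y, hY, ⟨e⟩⟩, a, b, hab⟩ := exists_factorization_of_Q_map_eq_zero
    (boundedInKInfB S) ((toKInfB S).map f) hf
  obtain ⟨B : ProjComplex S, rfl⟩ := Y.quotient_obj_surjective
  have hB := (KBoundedStrict_quotient_obj_iff S B).1 hY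
  have hab' : (modelFunctor S).map f = a.hom ≫ b.hom := congrArg (fun k => k.hom) hab
  exact ((model S α.obj).exists_isLift (model S β.obj) f.hom).choose_spec.stableRel_of_bounded hB
    (a.hom ≫ e.hom) (e.inv ≫ b.hom) (hab'.trans (by
      exact (congrArg (a.hom ≫ ·) (e.hom_inv_id_assoc _).symm).trans
        (Category.assoc _ _ _).symm))

lemma distinguished_fullSubcategory {D : Type*} [Category* D] [Preadditive D] [HasZeroObject D]
    [HasShift D ℤ] [∀ n : ℤ, (shiftFunctor D n).Additive] [Pretriangulated D]
    (P : ObjectProperty D) [P.IsTriangulated] {X Y Z : P.FullSubcategory} (f : X ⟶ Y) (g : Y ⟶ Z)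
    (h : Z.obj ⟶ X.obj⟦(1 : ℤ)⟧) (hT : Triangle.mk f.hom g.hom h ∈ distTriang D) :
    Triangle.mk f g (P.fullyFaithfulι.preimage
      (h ≫ (P.ι.commShiftIso (1 : ℤ)).inv.app X)) ∈ distTriang P.FullSubcategory := by
  refine isomorphic_distinguished _ hT _ (Triangle.isoMk _ _ (Iso.refl _) (Iso.refl _)
    (Iso.refl _) ?_ ?_ ?_)
  · exact (Category.comp_id _).trans (Category.id_comp _).symm
  · exact (Category.comp_id _).trans (Category.id_comp _).symm
  · change (_ ≫ _) ≫ (𝟙 _)⟦(1 : ℤ)⟧' = 𝟙 _ ≫ h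
    rw [CategoryTheory.Functor.map_id, Category.comp_id, Category.id_comp]
    erw [P.fullyFaithfulι.map_preimage]
    exact (Category.assoc _ _ _).trans ((congrArg (h ≫ ·)
      ((P.ι.commShiftIso (1 : ℤ)).inv_hom_id_app X)).trans (Category.comp_id _))

/-- The triangle of brutal truncations at `-1` satisfies the hypotheses of `Q_map_surjective`: there
are no maps from a model to the part in degrees `< -1`, nor from the part in degrees `≥ -1` to the
shift of a model. Both are instances of orthogonality. -/
lemma toVerdier_map_surjective {α β : MorEpi S} :
    Function.Surjective ((toVerdier S).map : (α ⟶ β) → _) := by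
  have : Function.Surjective ((boundedInKInfB S).trW.Q.map :
      ((toKInfB S).obj α ⟶ (toKInfB S).obj β) → _) := by
    refine Q_map_surjective _ fun X hX => ?_
    obtain ⟨Y, hY, ⟨e⟩⟩ := hX
    obtain ⟨B : ProjComplex S, rfl⟩ := Y.quotient_obj_surjective
    have hB := (KBoundedStrict_quotient_obj_iff S B).1 hY
    have hB₁ : IsBoundedComplex S (brutalGE (-1) B) := isBoundedComplex_zero.glue _ _ hB
    have hB₂ : IsBoundedComplex S (brutalLT (-1) B) := hB.glue _ _ isBoundedComplex_zero
    refine ⟨_, distinguished_fullSubcategory (KInfB S) (X := boundedObj _ hB₁)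
      (Y := boundedObj B hB) (Z := boundedObj _ hB₂) (ObjectProperty.homMk _)
      (ObjectProperty.homMk _) _ (brutal_distinguished (-1) B),
      (KInfB S).ι.preimageIso e.symm, boundedInKInfB_boundedObj _ hB₁, ?_, ?_⟩
    · intro f
      ext
      exact (model S α.obj).quotient_hom_eq_zero_right hB₂
        (isZero_glue_right _ _ le_rfl (isZero_zero_X _)) f.hom
    · intro f
      have hs : IsBoundedComplex S ((shiftFunctor (ProjComplex S) (-1 : ℤ)).obj
          (brutalGE (-1) B)) := by
        obtain ⟨a, b, _, _⟩ := hB₁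
        exact ⟨a + 1, b + 1, CochainComplex.isStrictlyGE_shift _ a (-1) _ (by omega),
          CochainComplex.isStrictlyLE_shift _ b (-1) _ (by omega)⟩
      -- Moving the shift to the other side turns degree `-1` into degree `-2`, where the part in
      -- degrees `≥ -1` vanishes.
      have hz : IsZero (((shiftFunctor (ProjComplex S) (-1 : ℤ)).obj (brutalGE (-1) B)).X (-1)) := by
        change IsZero ((brutalGE (-1) B).X (-1 + -1))
        exact isZero_glue_left _ _ (by omega) (isZero_zero_X _)
      let f' := f.hom ≫ ((KInfB S).ι.commShiftIso (1 : ℤ)).hom.app ((toKInfB S).obj β)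
      have hf' : f' = 0 := by
        apply (shiftFunctor (KProj S) (-1 : ℤ)).map_injective
        rw [Functor.map_zero, ← cancel_mono ((shiftFunctorCompIsoId (KProj S) (1 : ℤ) (-1)
          (by omega)).hom.app ((toKInfB S).obj β).obj), zero_comp]
        exact (cancel_epi (((HomotopyCategory.quotient _ _).commShiftIso (-1 : ℤ)).hom.app
          (brutalGE (-1) B))).1 (((model S β.obj).quotient_hom_eq_zero_left β.property hs hz
            _).trans comp_zero.symm)
      ext
      exact (cancel_mono (((KInfB S).ι.commShiftIso (1 : ℤ)).hom.app
        ((toKInfB S).obj β))).1 (hf'.trans zero_comp.symm)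
  exact this.comp toKInfB_map_surjective

end Functor

end ExactCat

namespace ExactCat

/-! ### Naturality of the connecting map of a degreewise split sequence. -/

section DegreewiseSplit

variable {A : Type*} [Category* A] [Preadditive A] {T T' : ShortComplex (CochainComplex A ℤ)}
  (σ : ∀ n, (T.map (HomologicalComplex.eval A _ n)).Splitting)
  (σ' : ∀ n, (T'.map (HomologicalComplex.eval A _ n)).Splitting) (φ : T ⟶ T')

/-- The section in degree `n` of a degreewise split sequence. -/
def degreeSection (n : ℤ) : T.X₃.X n ⟶ T.X₂.X n := (σ n).s

/-- The retraction in degree `n` of a degreewise split sequence. -/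
def degreeRetraction (n : ℤ) : T.X₂.X n ⟶ T.X₁.X n := (σ n).r

lemma degreeSection_g (n : ℤ) : degreeSection σ n ≫ T.g.f n = 𝟙 _ := (σ n).s_g

lemma f_degreeRetraction (n : ℤ) : T.f.f n ≫ degreeRetraction σ n = 𝟙 _ := (σ n).f_r

lemma degreeRetraction_add (n : ℤ) :
    degreeRetraction σ n ≫ T.f.f n + T.g.f n ≫ degreeSection σ n = 𝟙 _ := (σ n).id

lemma homOfDegreewiseSplit_f_eq (n : ℤ) :
    (CochainComplex.homOfDegreewiseSplit T σ).f n =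
      degreeSection σ n ≫ T.X₂.d n (n + 1) ≫ degreeRetraction σ (n + 1) := by
  rw [CochainComplex.homOfDegreewiseSplit_f]
  simp [CochainComplex.cocycleOfDegreewiseSplit]
  rfl

lemma degreeSection_d (n : ℤ) : degreeSection σ n ≫ T.X₂.d n (n + 1) =
    T.X₃.d n (n + 1) ≫ degreeSection σ (n + 1) +
      (degreeSection σ n ≫ T.X₂.d n (n + 1) ≫ degreeRetraction σ (n + 1)) ≫ T.f.f (n + 1) := by
  have h := degreeSection σ n ≫= T.X₂.d n (n + 1) ≫= degreeRetraction_add σ (n + 1)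
  rw [Category.comp_id, Preadditive.comp_add, Preadditive.comp_add, ← T.g.comm_assoc,
    reassoc_of% degreeSection_g σ n] at h
  rw [← h, Category.assoc, Category.assoc]
  exact add_comm _ _

lemma degreeSection_τ₂ (n : ℤ) : degreeSection σ n ≫ φ.τ₂.f n =
    φ.τ₃.f n ≫ degreeSection σ' n +
      (degreeSection σ n ≫ φ.τ₂.f n ≫ degreeRetraction σ' n) ≫ T'.f.f n := by
  have h := degreeSection σ n ≫= φ.τ₂.f n ≫= degreeRetraction_add σ' n
  have hφ : φ.τ₂.f n ≫ T'.g.f n = T.g.f n ≫ φ.τ₃.f n := by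
    rw [← HomologicalComplex.comp_f, ← HomologicalComplex.comp_f, φ.comm₂₃]
  rw [Category.comp_id, Preadditive.comp_add, Preadditive.comp_add, reassoc_of% hφ,
    reassoc_of% degreeSection_g σ n] at h
  rw [← h, Category.assoc, Category.assoc]
  exact add_comm _ _

/-- Morphisms need not respect the splittings; the defect `s ≫ φ.τ₂ ≫ r` is the homotopy showing
that the connecting maps commute with `φ`. The identity results from computing `s ≫ d ≫ φ.τ₂ ≫ r` in
two ways. -/
lemma degreewiseSplit_comm (n : ℤ) :
    (degreeSection σ n ≫ T.X₂.d n (n + 1) ≫ degreeRetraction σ (n + 1)) ≫ φ.τ₁.f (n + 1) =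
      φ.τ₃.f n ≫ degreeSection σ' n ≫ T'.X₂.d n (n + 1) ≫ degreeRetraction σ' (n + 1) +
      (degreeSection σ n ≫ φ.τ₂.f n ≫ degreeRetraction σ' n) ≫ T'.X₁.d n (n + 1) -
        T.X₃.d n (n + 1) ≫ degreeSection σ (n + 1) ≫ φ.τ₂.f (n + 1) ≫
          degreeRetraction σ' (n + 1) := by
  have h₁ := degreeSection_d σ n =≫ (φ.τ₂.f (n + 1) ≫ degreeRetraction σ' (n + 1))
  have h₂ := degreeSection_τ₂ σ σ' φ n =≫ (T'.X₂.d n (n + 1) ≫ degreeRetraction σ' (n + 1))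
  have hφ : T.f.f (n + 1) ≫ φ.τ₂.f (n + 1) = φ.τ₁.f (n + 1) ≫ T'.f.f (n + 1) := by
    rw [← HomologicalComplex.comp_f, ← HomologicalComplex.comp_f, φ.comm₁₂]
  simp only [Category.assoc, Preadditive.add_comp, reassoc_of% hφ, T'.f.comm_assoc,
    f_degreeRetraction, Category.comp_id, φ.τ₂.comm_assoc] at h₁ h₂ ⊢
  rw [h₂] at h₁
  rw [h₁]
  abel

lemma homotopy_homOfDegreewiseSplit : Nonempty (Homotopy
    (CochainComplex.homOfDegreewiseSplit T σ ≫ φ.τ₁⟦(1 : ℤ)⟧')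
    (φ.τ₃ ≫ CochainComplex.homOfDegreewiseSplit T' σ')) := by
  -- The sign is forced by the differential of `T'.X₁⟦1⟧`, which is the negative of that of `T'.X₁`.
  refine ⟨⟨fun i j => if h : j + 1 = i then
    (degreeSection σ i ≫ (-φ.τ₂.f i) ≫ degreeRetraction σ' i) ≫
    (T'.X₁.XIsoOfEq h.symm).hom else 0, fun i j hij => dif_neg hij, fun i => ?_⟩⟩
  rw [dNext_eq _ (i' := i + 1) (by simp), prevD_eq _ (j' := i - 1) (by simp), dif_pos (by simp),
    dif_pos (by simp), HomologicalComplex.comp_f, HomologicalComplex.comp_f,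
    homOfDegreewiseSplit_f_eq, homOfDegreewiseSplit_f_eq]
  have h := degreewiseSplit_comm σ σ' φ i
  simp only [Category.assoc] at h
  simp [h]
  abel

/-- The connecting map in the homotopy category of a degreewise split sequence. -/
def homotopyDelta : (HomotopyCategory.quotient A (ComplexShape.up ℤ)).obj T.X₃ ⟶
    ((HomotopyCategory.quotient A (ComplexShape.up ℤ)).obj T.X₁)⟦(1 : ℤ)⟧ :=
  (HomotopyCategory.quotient _ _).map (CochainComplex.homOfDegreewiseSplit T σ) ≫
    ((HomotopyCategory.quotient _ _).commShiftIso (1 : ℤ)).hom.app T.X₁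

lemma homotopyDelta_naturality :
    (HomotopyCategory.quotient A (ComplexShape.up ℤ)).map φ.τ₃ ≫ homotopyDelta σ' =
      homotopyDelta σ ≫ ((HomotopyCategory.quotient A (ComplexShape.up ℤ)).map φ.τ₁)⟦(1 : ℤ)⟧' := by
  obtain ⟨H⟩ := homotopy_homOfDegreewiseSplit σ σ' φ
  have h := HomotopyCategory.eq_of_homotopy _ _ H
  rw [Functor.map_comp, Functor.map_comp] at h
  rw [homotopyDelta, homotopyDelta, Category.assoc, ← Functor.commShiftIso_hom_naturality,
    reassoc_of% h]

lemma homotopyDelta_distinguished [HasZeroObject A] [HasBinaryBiproducts A] :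
    Triangle.mk ((HomotopyCategory.quotient A (ComplexShape.up ℤ)).map T.f)
      ((HomotopyCategory.quotient A (ComplexShape.up ℤ)).map T.g) (homotopyDelta σ) ∈
      distTriang (HomotopyCategory A (ComplexShape.up ℤ)) := by
  rw [HomotopyCategory.distinguished_iff_iso_trianglehOfDegreewiseSplit]
  exact ⟨T, σ, ⟨Iso.refl _⟩⟩

end DegreewiseSplit

/-! ### Functoriality of glueing and of brutal truncations. -/

section GlueMap

variable {V : Type u} [Category.{v} V] [Preadditive V] {X X' Y Y' : CochainComplex V ℤ}
  (φ : X ⟶ X') (ψ : Y ⟶ Y') (s : ℤ) (a : X ⟶ Y) (b : X' ⟶ Y')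

/-- The component of the map between complexes obtained by glueing. -/
def glueMapF (i : ℤ) : glueX X X' s i ⟶ glueX Y Y' s i :=
  if h : i < s then (glueIsoLeft X X' h).hom ≫ a.f i ≫ (glueIsoLeft Y Y' h).inv else
    (glueIsoRight X X' h).hom ≫ b.f i ≫ (glueIsoRight Y Y' h).inv

lemma glueIn_glueMapF (w : φ ≫ b = a ≫ ψ) (i : ℤ) : glueIn φ s i ≫ glueMapF s a b i = a.f i ≫ glueIn ψ s i := by
  have := congrArg (fun k => k.f i) w
  dsimp at this
  by_cases h : i < s
  · simp [glueIn, glueMapF, h]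
  · simp [glueIn, glueMapF, h, reassoc_of% this]

lemma glueMapF_glueOut (w : φ ≫ b = a ≫ ψ) (i : ℤ) : glueMapF s a b i ≫ glueOut ψ s i = glueOut φ s i ≫ b.f i := by
  have := congrArg (fun k => k.f i) w
  dsimp at this
  by_cases h : i < s
  · simp [glueOut, glueMapF, h, this]
  · simp [glueOut, glueMapF, h]

/-- The functoriality of the glueing of complexes. -/
def glueMap (w : φ ≫ b = a ≫ ψ) : glue φ s ⟶ glue ψ s where
  f := glueMapF s a b
  comm' i j _ := by
    change glueMapF s a b i ≫ glueD ψ s i j = glueD φ s i j ≫ glueMapF s a b j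
    by_cases h : i < s
    · simp only [glueD, dif_pos h, glueMapF, Category.assoc, Iso.inv_hom_id_assoc]
      rw [← glueMapF, glueIn_glueMapF φ ψ s a b w j, a.comm_assoc]
    · by_cases h' : j < s
      · simp [glueD, h, h']
      · simp [glueD, glueMapF, h, h']

lemma isIso_glueMap_f (w : φ ≫ b = a ≫ ψ) (i : ℤ) (ha : i < s → IsIso (a.f i)) (hb : s ≤ i → IsIso (b.f i)) :
    IsIso ((glueMap φ ψ s a b w).f i) := by
  change IsIso (glueMapF s a b i)
  by_cases h : i < s
  · have := ha h
    rw [glueMapF, dif_pos h]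
    infer_instance
  · have := hb (by omega)
    rw [glueMapF, dif_neg h]
    infer_instance

variable [HasZeroObject V]

/-- The functoriality of the brutal truncations. -/
def brutalMap {K L : CochainComplex V ℤ} (f : K ⟶ L) :
    brutalShortComplex s K ⟶ brutalShortComplex s L where
  τ₁ := glueMap _ _ s (𝟙 _) f ((isZero_zero _).eq_of_src _ _)
  τ₂ := f
  τ₃ := glueMap _ _ s f (𝟙 _) ((isZero_zero _).eq_of_tgt _ _)
  comm₁₂ := by
    ext i
    exact glueMapF_glueOut _ _ s _ _ ((isZero_zero _).eq_of_src _ _) i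
  comm₂₃ := by
    ext i
    exact (glueIn_glueMapF _ _ s _ _ ((isZero_zero _).eq_of_tgt _ _) i).symm

lemma isIso_brutalMap_τ₁_f {K L : CochainComplex V ℤ} (f : K ⟶ L) (i : ℤ)
    (h : s ≤ i → IsIso (f.f i)) : IsIso ((brutalMap s f).τ₁.f i) :=
  isIso_glueMap_f _ _ s _ _ ((isZero_zero _).eq_of_src _ _) i (fun _ => inferInstance) h

lemma isIso_brutalMap_τ₃_f {K L : CochainComplex V ℤ} (f : K ⟶ L) (i : ℤ)
    (h : i < s → IsIso (f.f i)) : IsIso ((brutalMap s f).τ₃.f i) :=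
  isIso_glueMap_f _ _ s _ _ ((isZero_zero _).eq_of_tgt _ _) i h (fun _ => inferInstance)

end GlueMap

/-! ### Triangles in the Verdier quotient -/

section CommShift

variable {D D' : Type*} [Category* D] [Category* D'] [HasShift D ℤ] [HasShift D' ℤ] (F : D ⥤ D')
  [F.CommShift ℤ] {X Y X' Y' : D} (a : X ⟶ X') (b : Y ⟶ Y')

lemma map_comp_commShiftIso_naturality (f : Y ⟶ X⟦(1 : ℤ)⟧) (f' : Y' ⟶ X'⟦(1 : ℤ)⟧)
    (h : b ≫ f' = f ≫ a⟦(1 : ℤ)⟧') :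
    F.map b ≫ F.map f' ≫ (F.commShiftIso (1 : ℤ)).hom.app X' =
      (F.map f ≫ (F.commShiftIso (1 : ℤ)).hom.app X) ≫ (F.map a)⟦(1 : ℤ)⟧' := by
  rw [Category.assoc, ← Functor.commShiftIso_hom_naturality, ← F.map_comp_assoc,
    ← F.map_comp_assoc, h]

lemma preimage_comp_commShiftIso_naturality (hF : F.FullyFaithful)
    (f : F.obj Y ⟶ (F.obj X)⟦(1 : ℤ)⟧) (f' : F.obj Y' ⟶ (F.obj X')⟦(1 : ℤ)⟧)
    (h : F.map b ≫ f' = f ≫ (F.map a)⟦(1 : ℤ)⟧') :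
    b ≫ hF.preimage (f' ≫ (F.commShiftIso (1 : ℤ)).inv.app X') =
      hF.preimage (f ≫ (F.commShiftIso (1 : ℤ)).inv.app X) ≫ a⟦(1 : ℤ)⟧' := by
  apply hF.map_injective
  rw [Functor.map_comp, Functor.map_comp, hF.map_preimage, hF.map_preimage, reassoc_of% h,
    Category.assoc, F.commShiftIso_inv_naturality]

end CommShift

section Verdier

variable {C : Type u} [Category.{v} C] [Preadditive C] [HasZeroObject C] [HasBinaryBiproducts C]
  {S : ObjectProperty (ShortComplex C)} [IsFrobenius S]

/-- The class of an eventually acyclic complex in `K^{∞,b}(P, F)`. -/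
def infObj (K : ProjComplex S) (hK : IsEventuallyAcyclic S K) : (KInfB S).FullSubcategory :=
  ⟨(HomotopyCategory.quotient _ _).obj K, (KInfBStrict S).le_isoClosure _
    ((KInfBStrict_quotient_obj_iff S _).2 hK)⟩

/-- The class of an eventually acyclic complex in the Verdier quotient. -/
abbrev verdierObj (K : ProjComplex S) (hK : IsEventuallyAcyclic S K) : KInfBModKBounded S :=
  (boundedInKInfB S).trW.Q.obj (infObj K hK)

variable {K L M : ProjComplex S} {hK : IsEventuallyAcyclic S K} {hL : IsEventuallyAcyclic S L}
  {hM : IsEventuallyAcyclic S M}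

/-- The morphism in the Verdier quotient induced by a morphism in the homotopy category. -/
def verdierMap (f : (HomotopyCategory.quotient _ (ComplexShape.up ℤ)).obj K ⟶
    (HomotopyCategory.quotient _ (ComplexShape.up ℤ)).obj L) :
    verdierObj K hK ⟶ verdierObj L hL :=
  (boundedInKInfB S).trW.Q.map (ObjectProperty.homMk f : infObj K hK ⟶ infObj L hL)

variable (hK) in
lemma verdierMap_id : verdierMap (hK := hK) (hL := hK) (𝟙 _) = 𝟙 _ :=
  CategoryTheory.Functor.map_id _ _

lemma verdierMap_comp (f : (HomotopyCategory.quotient _ (ComplexShape.up ℤ)).obj K ⟶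
    (HomotopyCategory.quotient _ (ComplexShape.up ℤ)).obj L)
    (g : (HomotopyCategory.quotient _ (ComplexShape.up ℤ)).obj L ⟶
      (HomotopyCategory.quotient _ (ComplexShape.up ℤ)).obj M) :
    verdierMap (hK := hK) (hL := hM) (f ≫ g) =
      verdierMap (hL := hL) f ≫ verdierMap g :=
  Functor.map_comp (boundedInKInfB S).trW.Q (ObjectProperty.homMk f : infObj K hK ⟶ infObj L hL)
    (ObjectProperty.homMk g : infObj L hL ⟶ infObj M hM)

instance isIso_verdierMap (f : (HomotopyCategory.quotient _ (ComplexShape.up ℤ)).obj K ⟶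
    (HomotopyCategory.quotient _ (ComplexShape.up ℤ)).obj L) [IsIso f] :
    IsIso (verdierMap (hK := hK) (hL := hL) f) :=
  ⟨verdierMap (inv f), by rw [← verdierMap_comp, IsIso.hom_inv_id, verdierMap_id],
    by rw [← verdierMap_comp, IsIso.inv_hom_id, verdierMap_id]⟩

variable {T T' : ShortComplex (ProjComplex S)}
  (σ : ∀ n, (T.map (HomologicalComplex.eval _ _ n)).Splitting)
  (σ' : ∀ n, (T'.map (HomologicalComplex.eval _ _ n)).Splitting) (φ : T ⟶ T')
  (h₁ : IsEventuallyAcyclic S T.X₁) (h₂ : IsEventuallyAcyclic S T.X₂)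
  (h₃ : IsEventuallyAcyclic S T.X₃)
  (h₁' : IsEventuallyAcyclic S T'.X₁) (h₂' : IsEventuallyAcyclic S T'.X₂)
  (h₃' : IsEventuallyAcyclic S T'.X₃)

/-- The connecting map in `K^{∞,b}(P, F)` of a degreewise split sequence of complexes. -/
def infDelta : infObj T.X₃ h₃ ⟶ (infObj T.X₁ h₁)⟦(1 : ℤ)⟧ :=
  (KInfB S).fullyFaithfulι.preimage
    (homotopyDelta σ ≫ ((KInfB S).ι.commShiftIso (1 : ℤ)).inv.app (infObj T.X₁ h₁))

/-- The connecting map in the Verdier quotient of a degreewise split sequence of complexes. -/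
def verdierDelta : verdierObj T.X₃ h₃ ⟶ (verdierObj T.X₁ h₁)⟦(1 : ℤ)⟧ :=
  (boundedInKInfB S).trW.Q.map (infDelta σ h₁ h₃) ≫
    ((boundedInKInfB S).trW.Q.commShiftIso (1 : ℤ)).hom.app (infObj T.X₁ h₁)

lemma verdierDelta_distinguished :
    Triangle.mk (verdierMap (hK := h₁) (hL := h₂) ((HomotopyCategory.quotient _ _).map T.f))
      (verdierMap (hL := h₃) ((HomotopyCategory.quotient _ _).map T.g)) (verdierDelta σ h₁ h₃) ∈
      distTriang (KInfBModKBounded S) :=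
  (boundedInKInfB S).trW.Q.map_distinguished _
    (distinguished_fullSubcategory (KInfB S) (X := infObj T.X₁ h₁) (Y := infObj T.X₂ h₂)
      (Z := infObj T.X₃ h₃) (ObjectProperty.homMk _) (ObjectProperty.homMk _) _
      (homotopyDelta_distinguished σ))

lemma infDelta_naturality :
    (ObjectProperty.homMk ((HomotopyCategory.quotient _ _).map φ.τ₃) :
      infObj T.X₃ h₃ ⟶ infObj T'.X₃ h₃') ≫ infDelta σ' h₁' h₃' = infDelta σ h₁ h₃ ≫
        (ObjectProperty.homMk ((HomotopyCategory.quotient _ _).map φ.τ₁) :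
          infObj T.X₁ h₁ ⟶ infObj T'.X₁ h₁')⟦(1 : ℤ)⟧' := by
  exact preimage_comp_commShiftIso_naturality (KInfB S).ι _ _ _ _ _
    (homotopyDelta_naturality σ σ' φ)

lemma verdierDelta_naturality :
    verdierMap (hK := h₃) ((HomotopyCategory.quotient _ _).map φ.τ₃) ≫ verdierDelta σ' h₁' h₃' =
      verdierDelta σ h₁ h₃ ≫
        (verdierMap (hK := h₁) (hL := h₁') ((HomotopyCategory.quotient _ _).map φ.τ₁))⟦(1 : ℤ)⟧' := by
  exact map_comp_commShiftIso_naturality (boundedInKInfB S).trW.Q _ _ _ _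
    (infDelta_naturality σ σ' φ h₁ h₃ h₁' h₃')

include σ σ' in
lemma isIso_verdierMap_τ₂
    (i₁ : IsIso (verdierMap (hK := h₁) (hL := h₁') ((HomotopyCategory.quotient _ _).map φ.τ₁)))
    (i₃ : IsIso (verdierMap (hK := h₃) (hL := h₃') ((HomotopyCategory.quotient _ _).map φ.τ₃))) :
    IsIso (verdierMap (hK := h₂) (hL := h₂') ((HomotopyCategory.quotient _ _).map φ.τ₂)) :=
  isIso₂_of_isIso₁₃
    { hom₁ := verdierMap (hK := h₁) (hL := h₁') ((HomotopyCategory.quotient _ _).map φ.τ₁)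
      hom₂ := verdierMap (hK := h₂) (hL := h₂') ((HomotopyCategory.quotient _ _).map φ.τ₂)
      hom₃ := verdierMap (hK := h₃) (hL := h₃') ((HomotopyCategory.quotient _ _).map φ.τ₃)
      comm₁ := by
        refine (verdierMap_comp _ _).symm.trans (Eq.trans ?_ (verdierMap_comp _ _))
        rw [← Functor.map_comp, ← Functor.map_comp, φ.comm₁₂]
      comm₂ := by
        refine (verdierMap_comp _ _).symm.trans (Eq.trans ?_ (verdierMap_comp _ _))
        rw [← Functor.map_comp, ← Functor.map_comp, φ.comm₂₃]
      comm₃ := (verdierDelta_naturality σ σ' φ h₁ h₃ h₁' h₃').symm }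
    (verdierDelta_distinguished σ h₁ h₂ h₃) (verdierDelta_distinguished σ' h₁' h₂' h₃') i₁ i₃

lemma isZero_verdierObj (hK' : IsBoundedComplex S K) : IsZero (verdierObj K hK) :=
  isZero_Q_obj _ (boundedInKInfB_of_isBoundedComplex hK' (Iso.refl _))

lemma IsEventuallyAcyclic.glue {X X' : ProjComplex S} (φ : X ⟶ X') (s : ℤ)
    (hX : IsEventuallyAcyclic S X) (hX' : IsEventuallyAcyclic S X') :
    IsEventuallyAcyclic S (glue φ s) := by
  rw [isEventuallyAcyclic_iff] at hX hX' ⊢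
  obtain ⟨m, n, hm, hn⟩ := hX
  obtain ⟨m', n', hm', hn'⟩ := hX'
  -- The neighbours of `j` must lie on the same side of the cut at `s`.
  refine ⟨min m (s - 2), max n' (s + 1), fun j hj => ?_, fun j hj => ?_⟩
  · exact (agreeOn_glue_left φ s).acyclicAt (by omega) (by omega) (by omega) (hm j (by omega))
  · exact (agreeOn_glue_right φ s).symm.acyclicAt (by omega) (by omega) (by omega)
      (hn' j (by omega))

/-- Brutal truncation at `a` and at `b + 1` isolates the degrees in `[a, b]`. The middle pieces are
bounded, hence zero in the quotient, the outer ones are mapped isomorphically, and the triangles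
assemble these isomorphisms. -/
lemma isIso_verdierMap_quotient (f : K ⟶ L) (a b : ℤ)
    (hf : ∀ i, i < a ∨ b < i → IsIso (f.f i)) :
    IsIso (verdierMap (hK := hK) (hL := hL) ((HomotopyCategory.quotient _ _).map f)) := by
  have h₀ := (isBoundedComplex_zero (S := S)).isEventuallyAcyclic
  have key (s : ℤ) {K L : ProjComplex S} {hK : IsEventuallyAcyclic S K}
      {hL : IsEventuallyAcyclic S L} (f : K ⟶ L)
      (i₁ : IsIso (verdierMap (hK := h₀.glue _ s hK) (hL := h₀.glue _ s hL)
        ((HomotopyCategory.quotient _ _).map (brutalMap s f).τ₁)))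
      (i₃ : IsIso (verdierMap (hK := hK.glue _ s h₀) (hL := hL.glue _ s h₀)
        ((HomotopyCategory.quotient _ _).map (brutalMap s f).τ₃))) :
      IsIso (verdierMap (hK := hK) (hL := hL) ((HomotopyCategory.quotient _ _).map f)) :=
    isIso_verdierMap_τ₂ (brutalSplitting s K) (brutalSplitting s L) (brutalMap s f) _ _ _ _ _ _
      i₁ i₃
  have hi {K L : ProjComplex S} {hK : IsEventuallyAcyclic S K} {hL : IsEventuallyAcyclic S L}
      (f : K ⟶ L) (hf : ∀ i, IsIso (f.f i)) :
      IsIso (verdierMap (hK := hK) (hL := hL) ((HomotopyCategory.quotient _ _).map f)) := by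
    have : IsIso f := HomologicalComplex.Hom.isIso_of_components f
    infer_instance
  refine key a f (key (b + 1) _ ?_ ?_) ?_
  · exact hi _ fun i => isIso_brutalMap_τ₁_f _ _ _ fun _ => isIso_brutalMap_τ₁_f _ _ _
      fun _ => hf i (.inr (by omega))
  · have hB (K : ProjComplex S) :
        IsBoundedComplex S (brutalLT (b + 1) (brutalGE a K)) := by
      refine ⟨a, b, ?_, ?_⟩
      · rw [CochainComplex.isStrictlyGE_iff]
        intro i hi
        by_cases h : i < b + 1
        · exact isZero_glue_left _ _ h (isZero_glue_left _ _ hi (isZero_zero_X _))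
        · exact isZero_glue_right _ _ (by omega) (isZero_zero_X _)
      · rw [CochainComplex.isStrictlyLE_iff]
        exact fun i hi => isZero_glue_right _ _ (by omega) (isZero_zero_X _)
    exact (isZero_verdierObj (hB K)).isIso (isZero_verdierObj (hB L)) _
  · exact hi _ fun i => isIso_brutalMap_τ₃_f _ _ _ fun h => hf i (.inl h)

end Verdier

end ExactCat

namespace ExactCat

/-! ### Essential surjectivity -/

section EssSurj

variable {C : Type u} [Category.{v} C] [Preadditive C] [HasZeroObject C] [HasBinaryBiproducts C]
  {S : ObjectProperty (ShortComplex C)} [IsFrobenius S]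

lemma IsAcyclicComplex.liftsTo {X : ProjComplex S} (hX : IsAcyclicComplex S X) (i : ℤ) :
    LiftsTo X i := by
  obtain ⟨Z, ι, π, w, h⟩ := hX
  rintro a b rfl rfl P k hk
  have hk' : k.hom ≫ (X.d (a + 1) (a + 1 + 1)).hom = 0 := congrArg (fun k => k.hom) hk
  have := conflation_mono (h (a + 1 + 1)).1
  rw [(h (a + 1)).2, ← Category.assoc] at hk'
  obtain ⟨l, hl⟩ := conflation_lift (h (a + 1)).1 k.hom (Mono.right_cancellation _ _
    (hk'.trans zero_comp.symm))
  obtain ⟨g, hg⟩ := projectives_lift P.property (⟨_, _, _, (h a).1⟩ : AdmissibleEpi S (π a)) l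
  refine ⟨ObjectProperty.homMk g, ?_⟩
  ext
  change g ≫ (X.d a (a + 1)).hom = k.hom
  rw [(h a).2, reassoc_of% hg, hl]

lemma IsAcyclicComplex.extendsFrom {X : ProjComplex S} (hX : IsAcyclicComplex S X) (i : ℤ) :
    ExtendsFrom X i := by
  obtain ⟨Z, ι, π, w, h⟩ := hX
  rintro a b rfl rfl Q k hk
  have hk' : (X.d a (a + 1)).hom ≫ k.hom = 0 := congrArg (fun k => k.hom) hk
  have := conflation_epi (h a).1
  rw [(h a).2, Category.assoc] at hk'
  obtain ⟨l, hl⟩ := conflation_desc (h (a + 1)).1 k.hom (Epi.left_cancellation _ _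
    (hk'.trans comp_zero.symm))
  obtain ⟨g, hg⟩ := projectives_extend Q.property
    (⟨_, _, _, (h (a + 1 + 1)).1⟩ : AdmissibleMono S (ι (a + 1 + 1))) l
  refine ⟨ObjectProperty.homMk g, ?_⟩
  ext
  change (X.d (a + 1) (a + 1 + 1)).hom ≫ g = k.hom
  rw [(h (a + 1)).2, Category.assoc, hg, hl]

lemma conflation_inl_map {X Y Z : C} {i : X ⟶ Y} {p : Y ⟶ Z} {w : i ≫ p = 0}
    (h : S (ShortComplex.mk i p w)) (E : C) :
    S (ShortComplex.mk (i ≫ biprod.inl) (biprod.map p (𝟙 E)) (by simp [reassoc_of% w])) := by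
  have := conflation_mono h
  refine conflation_of_admissibleEpi _
    (AdmissibleEpi.biprod_map ⟨_, _, _, h⟩ (IsExactStructure.id_epi E)) inferInstance
    fun f hf => ?_
  have h₁ : (f ≫ biprod.fst) ≫ p = 0 := by simpa using hf =≫ biprod.fst
  have h₂ : f ≫ biprod.snd = 0 := by simpa using hf =≫ biprod.snd
  obtain ⟨l, hl⟩ := conflation_lift h _ h₁
  refine ⟨l, ?_⟩
  ext
  · simp [hl]
  · simp [h₂]

namespace Model

variable {α : Arrow C} (M : Model S α) (E : ℤ → C) (hE : ∀ i, projectives S (E i))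
  (hE' : ∀ i, i ≠ 0 → IsZero (E i)) (t : ∀ i, E i ⟶ M.B i)

/-- The model obtained by adding a projective object to the source of the arrow. -/
def addProj : Model S (Arrow.mk (biprod.desc (M.γ 0) (t 0))) :=
  Model.mk' _ (fun i => ⟨(M.W.X i).obj ⊞ E (i + 1), projectives_biprod S (M.W.X i).property (hE _)⟩)
    (fun i => M.A i ⊞ E i) M.B (fun i => biprod.desc (M.γ i) (t i))
    (fun i => M.ι i ≫ biprod.inl) (fun i => biprod.map (M.π i) (𝟙 _))
    (fun i => by simp [reassoc_of% (M.w i)]) (fun i => conflation_inl_map (M.conflation i) _)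
    (fun i hi => by
      have := M.isIso i hi
      refine ⟨inv (M.γ i) ≫ biprod.inl, ?_, by simp⟩
      ext
      · simp
      · simp
      · exact (hE' i hi).eq_of_src _ _
      · exact (hE' i hi).eq_of_src _ _) (Iso.refl _)

/-- The map to the model obtained by adding a projective object. -/
def toAddProj : M.W ⟶ (M.addProj E hE hE' t).W where
  f i := ObjectProperty.homMk biprod.inl
  comm' i j hij := by
    obtain rfl : i + 1 = j := hij
    ext
    change biprod.inl ≫ ((M.addProj E hE hE' t).W.d i (i + 1)).hom =
      (M.W.d i (i + 1)).hom ≫ biprod.inl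
    rw [M.d_eq, Model.d_eq]
    change biprod.inl ≫ biprod.map (M.π i) (𝟙 _) ≫ biprod.desc _ _ ≫ M.ι _ ≫ biprod.inl = _
    simp

lemma isIso_toAddProj_f (i : ℤ) (hi : i ≠ -1) : IsIso ((M.toAddProj E hE hE' t).f i) := by
  refine ⟨ObjectProperty.homMk biprod.fst, ?_, ?_⟩
  · ext
    exact biprod.inl_fst
  · ext
    change (biprod.fst : (M.W.X i).obj ⊞ E (i + 1) ⟶ _) ≫ biprod.inl = 𝟙 _
    ext
    · simp
    · simp
    · exact (hE' (i + 1) (by omega)).eq_of_src _ _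
    · exact (hE' (i + 1) (by omega)).eq_of_src _ _

end Model

lemma Model.isIso_mapModel {α : Arrow C} [Epi α.hom] (M N : Model S α) :
    IsIso (mapModel M N (𝟙 α)) :=
  ⟨mapModel N M (𝟙 α), by rw [← mapModel_comp, Category.comp_id, mapModel_id],
    by rw [← mapModel_comp, Category.comp_id, mapModel_id]⟩

section Splice

variable {Y : ProjComplex S} {Z : ℤ → C} {ι : ∀ i, Z i ⟶ (Y.X i).obj}
  {π : ∀ i, (Y.X i).obj ⟶ Z (i + 1)} {w : ∀ i, ι i ≫ π i = 0}
  (h : ∀ i, S (ShortComplex.mk (ι i) (π i) (w i)))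

/-- The left part of an acyclic complex is a resolution. -/
def leftResOfAcyclic : LeftRes S (Z 0) where
  Z
    | 0 => Z 0
    | n + 1 => Z (Int.negSucc n)
  P n := Y.X (Int.negSucc n)
  ι n := ι (Int.negSucc n)
  π
    | 0 => π (Int.negSucc 0)
    | n + 1 => π (Int.negSucc (n + 1))
  w
    | 0 => w (Int.negSucc 0)
    | n + 1 => w (Int.negSucc (n + 1))
  conflation
    | 0 => h (Int.negSucc 0)
    | n + 1 => h (Int.negSucc (n + 1))
  e := Iso.refl _

/-- The right part of an acyclic complex is a coresolution. -/
def rightResOfAcyclic : RightRes S (Z 0) where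
  Z n := Z (Int.ofNat n)
  I n := Y.X (Int.ofNat n)
  ι n := ι (Int.ofNat n)
  π n := π (Int.ofNat n)
  w n := w (Int.ofNat n)
  conflation n := h (Int.ofNat n)
  e := Iso.refl _

end Splice

lemma glue_d_of_lt {V : Type*} [Category* V] [Preadditive V] {X X' : CochainComplex V ℤ}
    (φ : X ⟶ X') (s : ℤ) {i : ℤ} (hi : i < s) (j : ℤ) :
    (glue φ s).d i j = (glueIsoLeft X X' hi).hom ≫ X.d i j ≫ glueIn φ s j := dif_pos hi

lemma glue_d_of_not_lt {V : Type*} [Category* V] [Preadditive V] {X X' : CochainComplex V ℤ}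
    (φ : X ⟶ X') (s : ℤ) {i j : ℤ} (hi : ¬ i < s) (hj : ¬ j < s) :
    (glue φ s).d i j = (glueIsoRight X X' hi).hom ≫ X'.d i j ≫ (glueIsoRight X X' hj).inv :=
  (dif_neg hi).trans (dif_neg hj)

lemma glueIn_of_not_lt {V : Type*} [Category* V] [Preadditive V] {X X' : CochainComplex V ℤ}
    (φ : X ⟶ X') (s : ℤ) {i : ℤ} (hi : ¬ i < s) :
    glueIn φ s i = φ.f i ≫ (glueIsoRight X X' hi).inv := dif_neg hi

lemma iso_conj_comp {V : Type*} [Category* V] {a b c d y : V} (e : a ≅ b) (e' : c ≅ d)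
    {g : b ⟶ y} {k : b ⟶ d} {l : d ⟶ y} (h : g = k ≫ l) :
    e.hom ≫ g = (e.hom ≫ k ≫ e'.inv) ≫ e'.hom ≫ l := by
  simp [h]

/-- In degree `0` the composite `χ ≫ ψ` maps cycles to cycles, which gives an arrow `a : Z 0 ⟶ Z'
0`. Splicing the left half of `Y` to the right half of `Y'` along `a` gives the model; the map to it
is the identification with `Y` in degrees `< 0` and `ψ` in degrees `≥ 0`. -/
lemma exists_model_of_isAcyclicComplex {Y V Y' : ProjComplex S} (hY : IsAcyclicComplex S Y)
    (hY' : IsAcyclicComplex S Y') (χ : Y ⟶ V) (ψ : V ⟶ Y') :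
    ∃ (α : Arrow C) (M : Model S α) (φ : glue χ 0 ⟶ M.W),
      ∀ i, (0 ≤ i → IsIso (ψ.f i)) → IsIso (φ.f i) := by
  obtain ⟨Z, ι, π, w, h⟩ := hY
  obtain ⟨Z', ι', π', w', h'⟩ := hY'
  have hι : (Y.d (-1) 0).hom = π (-1) ≫ ι 0 := (h (-1)).2
  have hι' : (Y'.d 0 1).hom = π' 0 ≫ ι' 1 := (h' 0).2
  have := conflation_epi (h (-1)).1
  have := conflation_mono (h' (0 + 1)).1
  obtain ⟨a, ha⟩ := conflation_lift (h' 0).1 (ι 0 ≫ (χ.f 0).hom ≫ (ψ.f 0).hom) (by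
    rw [← cancel_mono (ι' (0 + 1)), ← cancel_epi (π (-1))]
    have e : (Y.d (-1) 0).hom ≫ ((χ ≫ ψ).f 0).hom ≫ (Y'.d 0 1).hom = 0 := by
      have := Y.d (-1) 0 ≫= (χ ≫ ψ).comm 0 1
      rw [Y.d_comp_d_assoc, zero_comp] at this
      exact congrArg (fun k => k.hom) this
    rw [hι, hι', HomologicalComplex.comp_f, Category.assoc] at e
    rw [zero_comp, comp_zero, ← e]
    simp)
  let L := leftResOfAcyclic (fun i => (h i).1)
  let R := rightResOfAcyclic (fun i => (h' i).1)
  let M := L.splice R a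
  have hr (n : ℕ) : ¬ Int.ofNat n < 0 := Int.not_lt.2 (Int.natCast_nonneg n)
  have hl (n : ℕ) : Int.negSucc n < 0 := Int.negSucc_lt_zero n
  let φ : ∀ i : ℤ, (glue χ 0).X i ⟶ M.W.X i
    | Int.ofNat n => (glueIsoRight Y V (hr n)).hom ≫ ψ.f (Int.ofNat n)
    | Int.negSucc n => (glueIsoLeft Y V (hl n)).hom
  have hφ : ∀ i : ℤ, φ i ≫ M.W.d i (i + 1) = (glue χ 0).d i (i + 1) ≫ φ (i + 1)
    | Int.ofNat n => by
      have hd : M.W.d (Int.ofNat n) (Int.ofNat (n + 1)) =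
          Y'.d (Int.ofNat n) (Int.ofNat (n + 1)) := by
        ext
        refine (M.d_eq (Int.ofNat n)).trans (Eq.trans ?_ (h' (Int.ofNat n)).2.symm)
        exact π' (Int.ofNat n) ≫= Category.id_comp _
      have hg : (glue χ 0).d (Int.ofNat n) (Int.ofNat (n + 1)) = (glueIsoRight Y V (hr n)).hom ≫
          V.d _ _ ≫ (glueIsoRight Y V (hr (n + 1))).inv :=
        glue_d_of_not_lt χ 0 (hr n) (hr (n + 1))
      change ((glueIsoRight Y V (hr n)).hom ≫ ψ.f (Int.ofNat n)) ≫
        M.W.d (Int.ofNat n) (Int.ofNat (n + 1)) =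
        (glue χ 0).d (Int.ofNat n) (Int.ofNat (n + 1)) ≫
          (glueIsoRight Y V (hr (n + 1))).hom ≫ ψ.f (Int.ofNat (n + 1))
      refine (congrArg (_ ≫ ·) hd).trans (Eq.trans ?_ (congrArg (· ≫ _) hg).symm)
      exact (Category.assoc _ _ _).trans (iso_conj_comp _ _ (ψ.comm _ _))
    | Int.negSucc 0 => by
      have hd : (M.W.d (-1) 0).hom = (Y.d (-1) 0).hom ≫ ((χ ≫ ψ).f 0).hom := by
        refine (M.d_eq (-1)).trans ?_
        rw [hι]
        change π (-1) ≫ (𝟙 _ ≫ a ≫ 𝟙 _) ≫ ι' 0 = _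
        rw [Category.id_comp, Category.comp_id, ha, Category.assoc]
        rfl
      have hd' : M.W.d (Int.negSucc 0) (Int.ofNat 0) =
          (Y.d (Int.negSucc 0) (Int.ofNat 0) ≫ χ.f (Int.ofNat 0)) ≫ ψ.f (Int.ofNat 0) := by
        rw [Category.assoc]
        ext
        exact hd
      have hg : (glue χ 0).d (Int.negSucc 0) (Int.ofNat 0) = (glueIsoLeft Y V (hl 0)).hom ≫
          (Y.d (Int.negSucc 0) (Int.ofNat 0) ≫ χ.f (Int.ofNat 0)) ≫
          (glueIsoRight Y V (hr 0)).inv :=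
        (glue_d_of_lt χ 0 (hl 0) (Int.ofNat 0)).trans (congrArg ((glueIsoLeft Y V (hl 0)).hom ≫ ·)
          ((congrArg (Y.d (Int.negSucc 0) (Int.ofNat 0) ≫ ·) (glueIn_of_not_lt χ 0 (hr 0))).trans
            (Category.assoc _ _ _).symm))
      refine (congrArg (_ ≫ ·) hd').trans (Eq.trans ?_ (congrArg (· ≫ _) hg).symm)
      exact iso_conj_comp _ _ rfl
    | Int.negSucc (n + 1) => by
      have hd : M.W.d (Int.negSucc (n + 1)) (Int.negSucc n) =
          Y.d (Int.negSucc (n + 1)) (Int.negSucc n) := by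
        ext
        refine (M.d_eq (Int.negSucc (n + 1))).trans
          (Eq.trans ?_ (h (Int.negSucc (n + 1))).2.symm)
        exact π (Int.negSucc (n + 1)) ≫= Category.id_comp _
      have hg : (glue χ 0).d (Int.negSucc (n + 1)) (Int.negSucc n) =
          (glueIsoLeft Y V (hl (n + 1))).hom ≫ Y.d _ _ ≫ (glueIsoLeft Y V (hl n)).inv :=
        (glue_d_of_lt χ 0 (hl (n + 1)) _).trans (congrArg (_ ≫ _ ≫ ·) (glueIn_of_lt χ 0 (hl n)))
      refine (congrArg (_ ≫ ·) hd).trans (Eq.trans ?_ (congrArg (· ≫ _) hg).symm)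
      exact (iso_conj_comp _ _ (Category.comp_id _).symm).trans
        (congrArg (_ ≫ ·) (Category.comp_id _))
  refine ⟨Arrow.mk a, M, { f := φ, comm' := ?_ }, ?_⟩
  · rintro i _ rfl
    exact hφ i
  · intro i hi
    change IsIso (φ i)
    match i with
    | Int.ofNat n =>
      have := hi (Int.not_lt.1 (hr n))
      exact inferInstanceAs (IsIso ((glueIsoRight Y V (hr n)).hom ≫ ψ.f (Int.ofNat n)))
    | Int.negSucc n => exact (glueIsoLeft Y V (hl n)).isIso_hom

/-- Adding a projective cover of `B 0` to the source makes the arrow a deflation. The model only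
changes in degree `-1`, so its class in the quotient is the same. -/
lemma exists_deflation_iso_verdierObj {α : Arrow C} (M : Model S α) :
    ∃ β : MorEpi S, Nonempty (verdierObj M.W (isEventuallyAcyclic_model S α M) ≅
      (toVerdier S).obj β) := by
  obtain ⟨K, Q, i, q, w, hQ, h⟩ := exists_projective_cover (S := S) (M.B 0)
  let E (i : ℤ) : C := if i = 0 then Q else 0
  have e (i : ℤ) (hi : i = 0) : E i = Q := if_pos hi
  have hE' (i : ℤ) (hi : i ≠ 0) : IsZero (E i) := by
    dsimp only [E]
    rw [if_neg hi]
    exact isZero_zero C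
  have hE (i : ℤ) : projectives S (E i) := by
    by_cases hi : i = 0
    · rw [e i hi]
      exact hQ
    · exact (projectives S).prop_of_isZero (hE' i hi)
  let t (i : ℤ) : E i ⟶ M.B i :=
    if hi : i = 0 then eqToHom (e i hi) ≫ q ≫ eqToHom (by rw [hi]) else 0
  have ht : AdmissibleEpi S (t 0) := by
    have ht' : t 0 = (eqToIso (e 0 rfl)).hom ≫ q := by simp [t]
    rw [ht']
    exact AdmissibleEpi.iso_comp ⟨_, _, _, h⟩ _
  let N := M.addProj E hE hE' t
  let β : MorEpi S := ⟨Arrow.mk (biprod.desc (M.γ 0) (t 0)), AdmissibleEpi.biprod_desc ht _⟩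
  have : Epi β.obj.hom := β.property.epi
  have := Model.isIso_mapModel (α := β.obj) N (model S β.obj)
  have := isIso_verdierMap_quotient (hK := isEventuallyAcyclic_model S α M)
    (hL := isEventuallyAcyclic_model S _ N) (M.toAddProj E hE hE' t) (-1) (-1)
    (fun i hi => M.isIso_toAddProj_f E hE hE' t i (by omega))
  exact ⟨β, ⟨asIso (verdierMap ((HomotopyCategory.quotient _ _).map (M.toAddProj E hE hE' t))) ≪≫
    @asIso _ _ _ _ _ (isIso_verdierMap (hK := isEventuallyAcyclic_model S _ N)
      (hL := isEventuallyAcyclic_model S _ (model S β.obj))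
      (mapModel (α := β.obj) N (model S β.obj) (𝟙 _)))⟩⟩

lemma IsAcyclicComplex.isEventuallyAcyclic {X : ProjComplex S} (hX : IsAcyclicComplex S X) :
    IsEventuallyAcyclic S X :=
  (isEventuallyAcyclic_iff X).2 ⟨0, 0, fun j _ => hX.acyclicAt j, fun j _ => hX.acyclicAt j⟩

instance : (toVerdier S).EssSurj where
  mem_essImage X := by
    obtain ⟨X, rfl⟩ : ∃ Y, X = (boundedInKInfB S).trW.Q.obj Y :=
      ⟨_, ((Localization.Construction.objEquiv _).apply_symm_apply X).symm⟩
    obtain ⟨X, hX⟩ := X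
    obtain ⟨V, hV, ⟨e⟩⟩ := hX
    obtain ⟨V : ProjComplex S, rfl⟩ := V.quotient_obj_surjective
    replace hV := (KInfBStrict_quotient_obj_iff S V).1 hV
    have hV' := hV
    rw [isEventuallyAcyclic_iff] at hV'
    obtain ⟨m, n, hm, hn⟩ := hV'
    obtain ⟨Y, hY, hVY⟩ := exists_isAcyclicComplex_left m V hm
    obtain ⟨f, hf, hf'⟩ := hVY.symm
    obtain ⟨Y', hY', g, hg, hg'⟩ := exists_isAcyclicComplex_right n V hn
    -- The partial identifications extend to chain maps `V ⟶ Y'` and `Y ⟶ V`, since maps lift along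
    -- the differentials of `Y'` and extend along those of `Y`.
    obtain ⟨ψ, hψ⟩ := exists_hom_of_liftsTo n g (fun i j hij hi => hg' i j hi (by omega))
      (fun i _ => hY'.liftsTo i)
    obtain ⟨χ, hχ⟩ := exists_hom_of_extendsFrom m f (fun i j hij hj => hf' i j (by omega) hj)
      (fun i _ => hY.extendsFrom i)
    obtain ⟨α, M, φ, hφ⟩ := exists_model_of_isAcyclicComplex hY hY' χ ψ
    obtain ⟨β, ⟨e'⟩⟩ := exists_deflation_iso_verdierObj M
    -- The complex glued from `Y` and `V` maps both to `V` and to the model `M`, and both maps are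
    -- invertible outside a finite range of degrees.
    have h₁ := hY.isEventuallyAcyclic.glue χ 0 hV
    have i₁ := isIso_verdierMap_quotient (hK := h₁) (hL := hV) (fromGlue χ 0) m 0 (fun i hi =>
      isIso_fromGlue_f χ 0 (by
        obtain hi | hi := hi
        · right
          rw [hχ i (by omega)]
          exact hf i (by omega)
        · exact .inl (by omega)))
    have i₂ := isIso_verdierMap_quotient (hK := h₁) (hL := isEventuallyAcyclic_model S α M) φ 0 n
      (fun i hi => hφ i (fun hi' => by
        rw [hψ i (by omega)]
        exact hg i (by omega)))
    let e₀ : (⟨X, _, (KInfBStrict_quotient_obj_iff S V).2 hV, ⟨e⟩⟩ : (KInfB S).FullSubcategory) ≅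
        infObj V hV :=
      (KInfB S).fullyFaithfulι.preimageIso e
    exact ⟨β, ⟨(((boundedInKInfB S).trW.Q.mapIso e₀ ≪≫ (asIso (verdierMap (hK := h₁) (hL := hV)
      ((HomotopyCategory.quotient _ _).map (fromGlue χ 0)))).symm ≪≫
        asIso (verdierMap ((HomotopyCategory.quotient _ _).map φ))) ≪≫ e').symm⟩⟩

end EssSurj

end ExactCat

namespace ExactCat

/-! ### Images of models under exact functors -/

section MapModel

variable {C : Type u} [Category.{v} C] [Preadditive C] {S : ObjectProperty (ShortComplex C)}

/-- A model of an arrow is also a model of the isomorphic arrows. -/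
def Model.ofIso {α β : Arrow C} (M : Model S α) (i : α ≅ β) : Model S β :=
  { M with e := M.e ≪≫ i }

variable {D : Type u'} [Category.{v'} D] [Preadditive D] {R : ObjectProperty (ShortComplex D)}

/-- A functor which preserves the conflations and the projective objects. -/
structure IsProjExact (R : ObjectProperty (ShortComplex D)) (S : ObjectProperty (ShortComplex C))
    (G : D ⥤ C) [G.Additive] : Prop where
  map_conflation : ∀ T : ShortComplex D, R T → S (T.map G)
  map_projective : ∀ P : D, projectives R P → projectives S (G.obj P)

variable {G G' : D ⥤ C} [G.Additive] [G'.Additive] (hG : IsProjExact R S G)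
  (hG' : IsProjExact R S G')

/-- The functor induced between the categories of projective objects. -/
def IsProjExact.onProjectives : (projectives R).FullSubcategory ⥤ (projectives S).FullSubcategory :=
  (projectives S).lift ((projectives R).ι ⋙ G) (fun P => hG.map_projective _ P.property)

instance : hG.onProjectives.Additive where
  map_add {_ _ f g} := by
    ext
    exact G.map_add (f := f.hom) (g := g.hom)

/-- The functor induced on complexes of projective objects. -/
def IsProjExact.onComplexes : ProjComplex R ⥤ ProjComplex S :=
  hG.onProjectives.mapHomologicalComplex _

/-- The image of a model under an exact functor. -/
def Model.map {α : Arrow D} (M : Model R α) : Model S (G.mapArrow.obj α) where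
  W := hG.onComplexes.obj M.W
  A i := G.obj (M.A i)
  B i := G.obj (M.B i)
  γ i := G.map (M.γ i)
  ι i := G.map (M.ι i)
  π i := G.map (M.π i)
  w i := (G.map_comp _ _).symm.trans ((congrArg (fun k => G.map k) (M.w i)).trans
    (G.map_zero _ _))
  conflation i := hG.map_conflation _ (M.conflation i)
  d_eq i := (congrArg (fun k => G.map k) (M.d_eq i)).trans ((G.map_comp _ _).trans
    (congrArg (G.map (M.π i) ≫ ·) (G.map_comp _ _)))
  isIso i hi := by
    have := M.isIso i hi
    infer_instance
  e := G.mapArrow.mapIso M.e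

/-- A natural transformation induces natural maps between complexes. -/
def IsProjExact.complexMap (τ : G ⟶ G') (X : ProjComplex R) :
    hG.onComplexes.obj X ⟶ hG'.onComplexes.obj X where
  f i := ObjectProperty.homMk (τ.app (X.X i).obj)
  comm' i j _ := by
    ext
    exact (τ.naturality (X.d i j).hom).symm

lemma IsProjExact.complexMap_naturality (τ : G ⟶ G') {X Y : ProjComplex R} (φ : X ⟶ Y) :
    hG.onComplexes.map φ ≫ hG.complexMap hG' τ Y =
      hG.complexMap hG' τ X ≫ hG'.onComplexes.map φ := by
  ext i
  exact τ.naturality (φ.f i).hom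

section

variable [HasZeroObject C] [HasBinaryBiproducts C] [IsExactStructure S]
  [HasZeroObject D] [HasBinaryBiproducts D] [IsExactStructure R]

lemma comp_paste {X₁ X₂ X₃ Y₁ Y₂ Y₃ : C} {f : X₁ ⟶ X₂} {g : X₂ ⟶ X₃} {f' : Y₁ ⟶ Y₂} {g' : Y₂ ⟶ Y₃}
    {a : X₁ ⟶ Y₁} {b : X₂ ⟶ Y₂} {c : X₃ ⟶ Y₃} (h₁ : f ≫ b = a ≫ f') (h₂ : g ≫ c = b ≫ g') :
    (f ≫ g) ≫ c = a ≫ f' ≫ g' := by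
  rw [Category.assoc, h₂, reassoc_of% h₁]

lemma Model.map_ofIso_p {α : Arrow D} (M : Model R α) {α' : Arrow C} (i : G.mapArrow.obj α ≅ α') :
    ((M.map hG).ofIso i).p = G.map M.p ≫ i.hom.left :=
  (Category.assoc _ _ _).symm.trans (congrArg (· ≫ i.hom.left) (G.map_comp _ _).symm)

lemma Model.map_ofIso_j {α : Arrow D} (M : Model R α) {α' : Arrow C} (i : G.mapArrow.obj α ≅ α') :
    ((M.map hG).ofIso i).j = i.inv.right ≫ G.map M.j :=
  (Category.assoc _ _ _).trans (congrArg (i.inv.right ≫ ·) (G.map_comp _ _).symm)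

lemma Functor.map_comm_sq {W X Y Z : D} {f : W ⟶ X} {g : X ⟶ Z} {h : W ⟶ Y} {k : Y ⟶ Z}
    (w : f ≫ g = h ≫ k) : G.map f ≫ G.map g = G.map h ≫ G.map k := by
  rw [← G.map_comp, ← G.map_comp, w]

lemma Model.IsLift.map {α β : Arrow D} {M : Model R α} {N : Model R β} {f : α ⟶ β}
    {φ : M.W ⟶ N.W} (h : M.IsLift N f φ) {α' β' : Arrow C} (i : G.mapArrow.obj α ≅ α')
    (j : G.mapArrow.obj β ≅ β') (f' : α' ⟶ β')
    (hl : i.hom.left ≫ f'.left = G.map f.left ≫ j.hom.left)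
    (hr : i.inv.right ≫ G.map f.right = f'.right ≫ j.inv.right) :
    ((M.map hG).ofIso i).IsLift ((N.map hG).ofIso j) f' (hG.onComplexes.map φ) where
  p := ((congrArg (G.map (φ.f (-1)).hom ≫ ·) (N.map_ofIso_p hG j)).trans
    (comp_paste (Functor.map_comm_sq h.p.symm) hl).symm).trans
      (congrArg (· ≫ f'.left) (M.map_ofIso_p hG i)).symm
  j := ((congrArg (· ≫ G.map (φ.f 0).hom) (M.map_ofIso_j hG i)).trans
    (comp_paste hr (Functor.map_comm_sq h.j))).trans
      (congrArg (f'.right ≫ ·) (N.map_ofIso_j hG j)).symm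

lemma Model.isLift_complexMap {α : Arrow D} (M : Model R α) (τ : G ⟶ G') {α' β' : Arrow C}
    (i : G.mapArrow.obj α ≅ α') (j : G'.mapArrow.obj α ≅ β') (f' : α' ⟶ β')
    (hl : i.hom.left ≫ f'.left = τ.app α.left ≫ j.hom.left)
    (hr : i.inv.right ≫ τ.app α.right = f'.right ≫ j.inv.right) :
    ((M.map hG).ofIso i).IsLift ((M.map hG').ofIso j) f' (hG.complexMap hG' τ M.W) where
  p := ((congrArg (τ.app _ ≫ ·) (M.map_ofIso_p hG' j)).trans
    (comp_paste (τ.naturality M.p) hl).symm).trans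
      (congrArg (· ≫ f'.left) (M.map_ofIso_p hG i)).symm
  j := ((congrArg (· ≫ τ.app _) (M.map_ofIso_j hG i)).trans
    (comp_paste hr (τ.naturality M.j))).trans
      (congrArg (f'.right ≫ ·) (M.map_ofIso_j hG' j)).symm

end

end MapModel

/-! ### The kernel functor -/

section Kernel

variable {C : Type u} [Category.{v} C] [Preadditive C] [HasZeroObject C] [HasBinaryBiproducts C]
  {S : ObjectProperty (ShortComplex C)} [IsFrobenius S]

/-- The kernel of a deflation. -/
def kerObj (α : MorEpi S) : C := α.property.choose

/-- The inclusion of the kernel of a deflation. -/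
def kerι (α : MorEpi S) : kerObj α ⟶ α.obj.left := α.property.choose_spec.choose

lemma kerι_hom (α : MorEpi S) : kerι α ≫ α.obj.hom = 0 :=
  α.property.choose_spec.choose_spec.choose

lemma kerι_conflation (α : MorEpi S) : S (ShortComplex.mk (kerι α) α.obj.hom (kerι_hom α)) :=
  α.property.choose_spec.choose_spec.choose_spec

instance (α : MorEpi S) : Mono (kerι α) := conflation_mono (kerι_conflation α)

lemma exists_kerMap {α β : MorEpi S} (f : α ⟶ β) :
    ∃ k : kerObj α ⟶ kerObj β, k ≫ kerι β = kerι α ≫ f.hom.left :=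
  conflation_lift (kerι_conflation β) _ (by
    rw [Category.assoc, MorEpi.w, ← Category.assoc, kerι_hom, zero_comp])

variable (S) in
/-- The kernel functor on the category of deflations. -/
def kerFunctor : MorEpi S ⥤ C where
  obj := kerObj
  map f := (exists_kerMap f).choose
  map_id α := by
    rw [← cancel_mono (kerι α), (exists_kerMap _).choose_spec, Category.id_comp]
    exact Category.comp_id _
  map_comp f g := by
    rw [← cancel_mono (kerι _), Category.assoc, (exists_kerMap _).choose_spec,
      (exists_kerMap _).choose_spec, ← Category.assoc, (exists_kerMap _).choose_spec,
      Category.assoc]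
    rfl

lemma kerFunctor_map_kerι {α β : MorEpi S} (f : α ⟶ β) :
    (kerFunctor S).map f ≫ kerι β = kerι α ≫ f.hom.left := (exists_kerMap f).choose_spec

instance : (kerFunctor S).Additive where
  map_add {α β f g} := (cancel_mono (kerι β)).1 <| (kerFunctor_map_kerι (f + g)).trans <|
    (Preadditive.comp_add _ _ _ (kerι α) f.hom.left g.hom.left).trans <|
    (congrArg₂ (· + ·) (kerFunctor_map_kerι f).symm (kerFunctor_map_kerι g).symm).trans
      (Preadditive.add_comp _ _ _ ((kerFunctor S).map f) ((kerFunctor S).map g) (kerι β)).symm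

instance : (MorEpi.leftFunctor S).Additive where

instance : (MorEpi.rightFunctor S).Additive where

variable (S) in
/-- The inclusion of the kernel, as a natural transformation. -/
def kerToLeft : kerFunctor S ⟶ MorEpi.leftFunctor S where
  app := kerι
  naturality _ _ f := kerFunctor_map_kerι f

variable (S) in
/-- The deflation, as a natural transformation. -/
def leftToRight : MorEpi.leftFunctor S ⟶ MorEpi.rightFunctor S where
  app α := α.obj.hom
  naturality _ _ f := MorEpi.w f

variable (S)

lemma isProjExact_left : IsProjExact (morEpiConflations S) S (MorEpi.leftFunctor S) where
  map_conflation _ hT := hT.1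
  map_projective P hP := ((morEpi_projectives_iff P).1 hP).1

lemma isProjExact_right : IsProjExact (morEpiConflations S) S (MorEpi.rightFunctor S) where
  map_conflation _ hT := hT.2
  map_projective P hP := ((morEpi_projectives_iff P).1 hP).2

/-- Conflations which end with a projective object split. -/
lemma exists_splitting {K X P : C} {i : K ⟶ X} {p : X ⟶ P} {w : i ≫ p = 0}
    (h : S (ShortComplex.mk i p w)) (hP : projectives S P) :
    ∃ (r : X ⟶ K) (s : P ⟶ X), i ≫ r = 𝟙 K ∧ s ≫ p = 𝟙 P ∧ r ≫ i + p ≫ s = 𝟙 X := by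
  have := conflation_mono h
  obtain ⟨s, hs⟩ := hP _ h (𝟙 P)
  dsimp at s hs
  obtain ⟨r, hr⟩ := conflation_lift h (𝟙 X - p ≫ s) (by
    rw [Preadditive.sub_comp, Category.id_comp, Category.assoc, hs, Category.comp_id, sub_self])
  refine ⟨r, s, ?_, hs, by rw [hr, sub_add_cancel]⟩
  rw [← cancel_mono i, Category.assoc, hr, Preadditive.comp_sub, reassoc_of% w, zero_comp, sub_zero,
    Category.comp_id, Category.id_comp]

/-- Exactness is the statement on kernels of a morphism of conflations. A projective deflation
splits, so its kernel is a retract of its projective source. -/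
lemma isProjExact_ker : IsProjExact (morEpiConflations S) S (kerFunctor S) where
  map_conflation T hT := by
    have := conflation_mono (kerι_conflation T.X₂)
    obtain ⟨a, b, w, h, ha, hb⟩ := conflation_kernels hT.1 hT.2
      { τ₁ := T.X₁.obj.hom, τ₂ := T.X₂.obj.hom, τ₃ := T.X₃.obj.hom
        comm₁₂ := (MorEpi.w T.f).symm, comm₂₃ := (MorEpi.w T.g).symm }
      (kerι_conflation T.X₁) (kerι_conflation T.X₂) (kerι_conflation T.X₃)
    obtain rfl : a = (kerFunctor S).map T.f :=
      (cancel_mono (kerι _)).1 (ha.trans (kerFunctor_map_kerι T.f).symm)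
    obtain rfl : b = (kerFunctor S).map T.g :=
      (cancel_mono (kerι _)).1 (hb.trans (kerFunctor_map_kerι T.g).symm)
    exact h
  map_projective P hP := by
    rw [morEpi_projectives_iff] at hP
    obtain ⟨r, s, hr, -⟩ := exists_splitting S (kerι_conflation P) hP.2
    exact projectives_of_retract hP.1 (kerι P) r hr

/-- The degreewise split sequence of complexes attached to a complex of projective deflations. -/
def kerShortComplex (X : ProjComplex (morEpiConflations S)) : ShortComplex (ProjComplex S) :=
  ShortComplex.mk ((isProjExact_ker S).complexMap (isProjExact_left S) (kerToLeft S) X)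
    ((isProjExact_left S).complexMap (isProjExact_right S) (leftToRight S) X) (by
      ext i
      exact kerι_hom (X.X i).obj)

/-- The functoriality of `kerShortComplex`. -/
def kerShortComplexMap {X Y : ProjComplex (morEpiConflations S)} (φ : X ⟶ Y) :
    kerShortComplex S X ⟶ kerShortComplex S Y where
  τ₁ := (isProjExact_ker S).onComplexes.map φ
  τ₂ := (isProjExact_left S).onComplexes.map φ
  τ₃ := (isProjExact_right S).onComplexes.map φ
  comm₁₂ := IsProjExact.complexMap_naturality _ _ _ φ
  comm₂₃ := IsProjExact.complexMap_naturality _ _ _ φ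

/-- The sequences `kerShortComplex S X` are degreewise split. -/
def kerSplitting (X : ProjComplex (morEpiConflations S)) (n : ℤ) :
    ((kerShortComplex S X).map (HomologicalComplex.eval _ _ n)).Splitting :=
  have h := exists_splitting S (kerι_conflation (X.X n).obj)
    ((morEpi_projectives_iff _).1 (X.X n).property).2
  { r := ObjectProperty.homMk h.choose
    s := ObjectProperty.homMk h.choose_spec.choose
    f_r := by
      ext
      exact h.choose_spec.choose_spec.1
    s_g := by
      ext
      exact h.choose_spec.choose_spec.2.1
    id := by
      ext
      exact h.choose_spec.choose_spec.2.2 }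

end Kernel

end ExactCat

namespace ExactCat

/-! ### The connecting morphism of a conflation of deflations -/

section Delta

variable {C : Type u} [Category.{v} C] [Preadditive C] [HasZeroObject C] [HasBinaryBiproducts C]
  {S : ObjectProperty (ShortComplex C)} [IsFrobenius S]

lemma inv_comp_eq_comp_inv {D : Type*} [Category* D] {X Y X' Y' : D} (e : X ≅ Y) (e' : X' ≅ Y')
    {a : X ⟶ X'} {b : Y ⟶ Y'} (h : e.hom ≫ b = a ≫ e'.hom) : e.inv ≫ a = b ≫ e'.inv := by
  rw [Iso.inv_comp_eq, ← Category.assoc, h, Category.assoc, Iso.hom_inv_id, Category.comp_id]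

lemma exists_kerIso {K X Y : C} {i : K ⟶ X} {p : X ⟶ Y} {w : i ≫ p = 0}
    (h : S (ShortComplex.mk i p w)) (hp : AdmissibleEpi S p) :
    ∃ e : kerObj (MorEpi.of hp) ≅ K, e.hom ≫ i = kerι (MorEpi.of hp) := by
  have := conflation_mono h
  obtain ⟨a, ha⟩ := conflation_lift h (kerι (MorEpi.of hp)) (kerι_hom (MorEpi.of hp))
  obtain ⟨b, hb⟩ := conflation_lift (kerι_conflation (MorEpi.of hp)) i w
  refine ⟨⟨a, b, ?_, ?_⟩, ha⟩
  · rw [← cancel_mono (kerι (MorEpi.of hp)), Category.assoc, hb, ha, Category.id_comp]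
  · rw [← cancel_mono i, Category.assoc, ha, hb, Category.id_comp]

/-- A conflation identifies its first term with the kernel of its second map. -/
def kerIso {K X Y : C} {i : K ⟶ X} {p : X ⟶ Y} {w : i ≫ p = 0}
    (h : S (ShortComplex.mk i p w)) (hp : AdmissibleEpi S p) : kerObj (MorEpi.of hp) ≅ K :=
  (exists_kerIso h hp).choose

lemma kerIso_hom {K X Y : C} {i : K ⟶ X} {p : X ⟶ Y} {w : i ≫ p = 0}
    (h : S (ShortComplex.mk i p w)) (hp : AdmissibleEpi S p) :
    (kerIso h hp).hom ≫ i = kerι (MorEpi.of hp) :=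
  (exists_kerIso h hp).choose_spec

lemma kerIso_inv {K X Y : C} {i : K ⟶ X} {p : X ⟶ Y} {w : i ≫ p = 0}
    (h : S (ShortComplex.mk i p w)) (hp : AdmissibleEpi S p) :
    (kerIso h hp).inv ≫ kerι (MorEpi.of hp) = i := by
  rw [← kerIso_hom h hp, Iso.inv_hom_id_assoc]

lemma kerIso_naturality {K X Y K' X' Y' : C} {i : K ⟶ X} {p : X ⟶ Y} {w : i ≫ p = 0}
    {i' : K' ⟶ X'} {p' : X' ⟶ Y'} {w' : i' ≫ p' = 0} (h : S (ShortComplex.mk i p w))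
    (hp : AdmissibleEpi S p) (h' : S (ShortComplex.mk i' p' w')) (hp' : AdmissibleEpi S p')
    (f : MorEpi.of hp ⟶ MorEpi.of hp') (a : K ⟶ K') (ha : a ≫ i' = i ≫ f.hom.left) :
    (kerIso h hp).hom ≫ a = (kerFunctor S).map f ≫ (kerIso h' hp').hom := by
  have := conflation_mono h'
  refine (cancel_mono i').1 ((Category.assoc _ _ _).trans
    (((congrArg (_ ≫ ·) ha).trans ?_).trans (Category.assoc _ _ _).symm))
  refine Eq.trans ?_ (congrArg ((kerFunctor S).map f ≫ ·) (kerIso_hom h' hp')).symm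
  rw [← Category.assoc, kerIso_hom]
  exact (kerFunctor_map_kerι f).symm

variable {T T' T'' : ShortComplex (MorEpi S)} (hT : morEpiConflations S T)
  (hT' : morEpiConflations S T')

/-- A conflation of deflations, considered as a morphism between its two components. -/
def colArrow : Arrow (MorEpi S) :=
  Arrow.mk (MorEpi.ofHom T.X₂.obj.hom T.X₃.obj.hom (MorEpi.w T.g).symm :
    MorEpi.of (p := T.g.hom.left) ⟨_, _, _, hT.1⟩ ⟶ MorEpi.of (p := T.g.hom.right) ⟨_, _, _, hT.2⟩)

lemma MorEpi.epi_of {α β : MorEpi S} (f : α ⟶ β) [Epi f.hom.left] [Epi f.hom.right] : Epi f where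
  left_cancellation _ _ h := MorEpi.hom_ext
    ((cancel_epi f.hom.left).1 (congrArg (fun k => k.hom.left) h))
    ((cancel_epi f.hom.right).1 (congrArg (fun k => k.hom.right) h))

instance : Epi (colArrow hT).hom :=
  have : Epi (colArrow hT).hom.hom.left := T.X₂.property.epi
  have : Epi (colArrow hT).hom.hom.right := T.X₃.property.epi
  MorEpi.epi_of _

/-- The first term of a conflation, as the kernel of its second map. -/
def colKer : (kerFunctor S).mapArrow.obj (colArrow hT) ≅ T.X₁.obj :=
  Arrow.isoMk (kerIso hT.1 ⟨_, _, _, hT.1⟩) (kerIso hT.2 ⟨_, _, _, hT.2⟩)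
    (kerIso_naturality hT.1 _ hT.2 _ (colArrow hT).hom T.X₁.obj.hom (MorEpi.w T.f).symm)

/-- The middle term of a conflation. -/
def colLeft : (MorEpi.leftFunctor S).mapArrow.obj (colArrow hT) ≅ T.X₂.obj := Iso.refl _

/-- The last term of a conflation. -/
def colRight : (MorEpi.rightFunctor S).mapArrow.obj (colArrow hT) ≅ T.X₃.obj := Iso.refl _

/-- A model of the morphism between the two components of a conflation. -/
def colModel : Model (morEpiConflations S) (colArrow hT) := model _ _

/-- The model of the first term. -/
def colModel₁ : Model S T.X₁.obj := ((colModel hT).map (isProjExact_ker S)).ofIso (colKer hT)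

/-- The model of the middle term. -/
def colModel₂ : Model S T.X₂.obj := ((colModel hT).map (isProjExact_left S)).ofIso (colLeft hT)

/-- The model of the last term. -/
def colModel₃ : Model S T.X₃.obj := ((colModel hT).map (isProjExact_right S)).ofIso (colRight hT)

/-- The three models of the terms come from one complex of projective deflations. So the maps of the
conflation lift to the inclusions of the kernels and to the deflations themselves, which form a
degreewise split sequence. -/
lemma mapModel_col₁₂ : mapModel (colModel₁ hT) (colModel₂ hT) T.f.hom =
    (HomotopyCategory.quotient _ _).map (kerShortComplex S (colModel hT).W).f :=
  ((colModel hT).isLift_complexMap (isProjExact_ker S) (isProjExact_left S) (kerToLeft S)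
    (colKer hT) (colLeft hT) T.f.hom ((kerIso_hom hT.1 _).trans (Category.comp_id _).symm)
    ((kerIso_inv hT.2 _).trans (Category.comp_id _).symm)).mapModel_eq

lemma mapModel_col₂₃ : mapModel (colModel₂ hT) (colModel₃ hT) T.g.hom =
    (HomotopyCategory.quotient _ _).map (kerShortComplex S (colModel hT).W).g :=
  ((colModel hT).isLift_complexMap (isProjExact_left S) (isProjExact_right S) (leftToRight S)
    (colLeft hT) (colRight hT) T.g.hom ((Category.id_comp _).trans (Category.comp_id _).symm)
    ((Category.id_comp _).trans (Category.comp_id _).symm)).mapModel_eq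

variable {hT hT'} in
/-- The functoriality of `colArrow`. -/
def colArrowMap (φ : T ⟶ T') : colArrow hT ⟶ colArrow hT' where
  left := MorEpi.ofHom φ.τ₂.hom.left φ.τ₃.hom.left
    (congrArg (fun k => k.hom.left) φ.comm₂₃)
  right := MorEpi.ofHom φ.τ₂.hom.right φ.τ₃.hom.right
    (congrArg (fun k => k.hom.right) φ.comm₂₃)
  w := MorEpi.hom_ext (MorEpi.w φ.τ₂) (MorEpi.w φ.τ₃)

/-- A single chain map between the large models gives compatible lifts of both end components of
`φ`; this is the source of the naturality of the connecting morphism. -/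
lemma exists_col_lift (φ : T ⟶ T') : ∃ ψ : (colModel hT).W ⟶ (colModel hT').W,
    mapModel (colModel₁ hT) (colModel₁ hT') φ.τ₁.hom =
      (HomotopyCategory.quotient _ _).map (kerShortComplexMap S ψ).τ₁ ∧
    mapModel (colModel₃ hT) (colModel₃ hT') φ.τ₃.hom =
      (HomotopyCategory.quotient _ _).map (kerShortComplexMap S ψ).τ₃ := by
  obtain ⟨ψ, hψ⟩ := (colModel hT).exists_isLift (colModel hT')
    (colArrowMap (hT := hT) (hT' := hT') φ)
  refine ⟨ψ, (hψ.map (isProjExact_ker S) (colKer hT) (colKer hT') φ.τ₁.hom ?_ ?_).mapModel_eq,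
    (hψ.map (isProjExact_right S) (colRight hT) (colRight hT') φ.τ₃.hom ?_ ?_).mapModel_eq⟩
  · exact kerIso_naturality hT.1 _ hT'.1 _ (colArrowMap φ).left φ.τ₁.hom.left
      (congrArg (fun k => k.hom.left) φ.comm₁₂)
  · have := kerIso_naturality hT.2 _ hT'.2 _ (colArrowMap (hT := hT) (hT' := hT') φ).right
      φ.τ₁.hom.right (congrArg (fun k => k.hom.right) φ.comm₁₂)
    exact inv_comp_eq_comp_inv _ _ this
  · exact (Category.id_comp _).trans (Category.comp_id _).symm
  · exact (Category.id_comp _).trans (Category.comp_id _).symm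

/-- The isomorphism in the Verdier quotient between two models. -/
def modelIso {α : Arrow C} [Epi α.hom] (M N : Model S α) :
    verdierObj M.W (isEventuallyAcyclic_model S α M) ≅
      verdierObj N.W (isEventuallyAcyclic_model S α N) where
  hom := verdierMap (mapModel M N (𝟙 α))
  inv := verdierMap (mapModel N M (𝟙 α))
  hom_inv_id := by
    rw [← verdierMap_comp, ← mapModel_comp, Category.comp_id, mapModel_id, verdierMap_id]
  inv_hom_id := by
    rw [← verdierMap_comp, ← mapModel_comp, Category.comp_id, mapModel_id, verdierMap_id]

lemma modelIso_naturality {α β : Arrow C} [Epi α.hom] [Epi β.hom] (M M' : Model S α)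
    (N N' : Model S β) (f : α ⟶ β) :
    verdierMap (mapModel M N f) ≫ (modelIso N N').hom =
      (modelIso M M').hom ≫ verdierMap (mapModel M' N' f) := by
  refine (verdierMap_comp _ _).symm.trans (Eq.trans ?_ (verdierMap_comp _ _))
  rw [← mapModel_comp, ← mapModel_comp, Category.comp_id, Category.id_comp]

/-- The connecting morphism of the models attached to a conflation. -/
def colDelta : verdierObj (colModel₃ hT).W (isEventuallyAcyclic_model S _ _) ⟶
    (verdierObj (colModel₁ hT).W (isEventuallyAcyclic_model S _ _))⟦(1 : ℤ)⟧ :=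
  verdierDelta (kerSplitting S (colModel hT).W) _ _

/-- The connecting morphism of a conflation of deflations. -/
def morDelta : (toVerdier S).obj T.X₃ ⟶ ((toVerdier S).obj T.X₁)⟦(1 : ℤ)⟧ :=
  (modelIso (model S T.X₃.obj) (colModel₃ hT)).hom ≫ colDelta hT ≫
    (modelIso (model S T.X₁.obj) (colModel₁ hT)).inv⟦(1 : ℤ)⟧'

lemma morDelta_modelIso : morDelta hT ≫ (modelIso (model S T.X₁.obj) (colModel₁ hT)).hom⟦(1 : ℤ)⟧' =
    (modelIso (model S T.X₃.obj) (colModel₃ hT)).hom ≫ colDelta hT := by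
  refine (Category.assoc _ _ _).trans (congrArg (_ ≫ ·) ((Category.assoc _ _ _).trans ?_))
  exact (congrArg (_ ≫ ·) ((shiftFunctor (KInfBModKBounded S) (1 : ℤ)).mapIso
    (modelIso (model S T.X₁.obj) (colModel₁ hT))).inv_hom_id).trans (Category.comp_id _)

lemma morDelta_distinguished :
    Triangle.mk ((toVerdier S).map T.f) ((toVerdier S).map T.g) (morDelta hT) ∈
      distTriang (KInfBModKBounded S) := by
  refine isomorphic_distinguished _ (verdierDelta_distinguished
    (kerSplitting S (colModel hT).W) (isEventuallyAcyclic_model S _ (colModel₁ hT))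
    (isEventuallyAcyclic_model S _ (colModel₂ hT))
    (isEventuallyAcyclic_model S _ (colModel₃ hT))) _
    (Triangle.isoMk _ _ (modelIso (model S T.X₁.obj) (colModel₁ hT))
      (modelIso (model S T.X₂.obj) (colModel₂ hT)) (modelIso (model S T.X₃.obj) (colModel₃ hT))
      ?_ ?_ (morDelta_modelIso hT))
  · exact (modelIso_naturality _ (colModel₁ hT) _ (colModel₂ hT) T.f.hom).trans
      (congrArg (fun k => _ ≫ verdierMap k) (mapModel_col₁₂ hT))
  · exact (modelIso_naturality _ (colModel₂ hT) _ (colModel₃ hT) T.g.hom).trans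
      (congrArg (fun k => _ ≫ verdierMap k) (mapModel_col₂₃ hT))

lemma colDelta_naturality (φ : T ⟶ T') :
    verdierMap (mapModel (colModel₃ hT) (colModel₃ hT') φ.τ₃.hom) ≫ colDelta hT' =
      colDelta hT ≫
        (verdierMap (mapModel (colModel₁ hT) (colModel₁ hT') φ.τ₁.hom))⟦(1 : ℤ)⟧' := by
  obtain ⟨ψ, h₁, h₃⟩ := exists_col_lift hT hT' φ
  rw [h₁, h₃]
  exact verdierDelta_naturality (kerSplitting S (colModel hT).W)
    (kerSplitting S (colModel hT').W) (kerShortComplexMap S ψ) _ _ _ _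

lemma conj_naturality {D : Type*} [Category* D] [HasShift D ℤ] {Z Z' W W' X X' V V' : D}
    (z : Z ≅ W) (z' : Z' ≅ W') (x : X ≅ V) (x' : X' ≅ V') (d : W ⟶ V⟦(1 : ℤ)⟧)
    (d' : W' ⟶ V'⟦(1 : ℤ)⟧) (f : Z ⟶ Z') (g : W ⟶ W') (a : X ⟶ X') (b : V ⟶ V')
    (h₁ : f ≫ z'.hom = z.hom ≫ g) (h₂ : a ≫ x'.hom = x.hom ≫ b)
    (h : g ≫ d' = d ≫ b⟦(1 : ℤ)⟧') :
    f ≫ z'.hom ≫ d' ≫ x'.inv⟦(1 : ℤ)⟧' = (z.hom ≫ d ≫ x.inv⟦(1 : ℤ)⟧') ≫ a⟦(1 : ℤ)⟧' := by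
  rw [reassoc_of% h₁, reassoc_of% h, Category.assoc, Category.assoc, ← Functor.map_comp,
    ← Functor.map_comp, inv_comp_eq_comp_inv _ _ h₂.symm]

lemma morDelta_naturality (φ : T ⟶ T') :
    (toVerdier S).map φ.τ₃ ≫ morDelta hT' =
      morDelta hT ≫ ((toVerdier S).map φ.τ₁)⟦(1 : ℤ)⟧' :=
  conj_naturality _ _ _ _ _ _ _ _ _ _ (modelIso_naturality _ _ _ _ φ.τ₃.hom)
    (modelIso_naturality _ _ _ _ φ.τ₁.hom) (colDelta_naturality hT hT' φ)

end Delta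

end ExactCat

namespace ExactCat

/-! ### Triangle equivalences from delta functors -/

section DeltaFunctor

variable {E : Type u} [Category.{v} E] [Preadditive E] [HasZeroObject E] [HasBinaryBiproducts E]
  {R : ObjectProperty (ShortComplex E)} [IsFrobenius R]
  {D : Type u'} [Category.{v'} D] [Preadditive D] [HasZeroObject D] [HasShift D ℤ]
  [∀ n : ℤ, (shiftFunctor D n).Additive] [Pretriangulated D]

lemma stableRel_sub {X Y : E} {f g : X ⟶ Y} (h : stableRel R f g) : stableRel R (f - g) 0 := by
  obtain ⟨P, hP, a, b, hab⟩ := h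
  exact ⟨P, hP, a, b, by rw [sub_zero, hab]⟩

/-- The functor induced on the stable category. -/
def stableLift (F : E ⥤ D) [F.Additive]
    (hF : ∀ {X Y : E} (f : X ⟶ Y), stableRel R f 0 → F.map f = 0) : Stable R ⥤ D :=
  CategoryTheory.Quotient.lift _ F (fun X Y f g h => by
    rw [← sub_eq_zero, ← F.map_sub]
    exact hF _ (stableRel_sub h))

variable (R) in
/-- A functor to a triangulated category which sends conflations to triangles, in a natural way,
and which is full, essentially surjective and whose kernel consists of the morphisms which
factor through projective objects. -/
structure DeltaFunctor (F : E ⥤ D) [F.Additive] where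
  map_eq_zero : ∀ {X Y : E} (f : X ⟶ Y), stableRel R f 0 → F.map f = 0
  stableRel_of_map_eq_zero : ∀ {X Y : E} (f : X ⟶ Y), F.map f = 0 → stableRel R f 0
  map_surjective : ∀ {X Y : E}, Function.Surjective (F.map : (X ⟶ Y) → _)
  essSurj : F.EssSurj
  δ : ∀ {T : ShortComplex E} (_ : R T), F.obj T.X₃ ⟶ (F.obj T.X₁)⟦(1 : ℤ)⟧
  distinguished : ∀ {T : ShortComplex E} (hT : R T),
    Triangle.mk (F.map T.f) (F.map T.g) (δ hT) ∈ distTriang D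
  naturality : ∀ {T T' : ShortComplex E} (hT : R T) (hT' : R T') (φ : T ⟶ T'),
    F.map φ.τ₃ ≫ δ hT' = δ hT ≫ (F.map φ.τ₁)⟦(1 : ℤ)⟧'

lemma comp_assoc_paste {A B B' A' X Y : D} {a : A ⟶ B} {s : B ⟶ X} {e : X ⟶ Y} {n : B ⟶ B'}
    {d : B' ⟶ Y} {b : A ⟶ A'} {k : A' ⟶ B'} {δ : A' ⟶ Y} (h : a ≫ n = b ≫ k)
    (hn : n ≫ d = s ≫ e) (hk : k ≫ d = δ) : (a ≫ s) ≫ e = b ≫ δ := by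
  rw [Category.assoc, ← hn, reassoc_of% h, hk]

namespace DeltaFunctor

variable {F : E ⥤ D} [F.Additive] (Δ : DeltaFunctor R F)

/-- The functor induced on the stable category by a delta functor. -/
def functor : Stable R ⥤ D := stableLift F Δ.map_eq_zero

instance : Δ.functor.Faithful where
  map_injective {X Y f g} h := by
    obtain ⟨f, rfl⟩ := (toStable R).map_surjective f
    obtain ⟨g, rfl⟩ := (toStable R).map_surjective g
    have h' : F.map f = F.map g := h
    obtain ⟨P, hP, a, b, hab⟩ := Δ.stableRel_of_map_eq_zero (f - g) (by rw [F.map_sub, h', sub_self])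
    exact CategoryTheory.Quotient.sound _ ⟨P, hP, a, b, by rw [← hab, sub_zero]⟩

instance : Δ.functor.Full where
  map_surjective {X Y} f := by
    obtain ⟨g, hg⟩ := Δ.map_surjective (X := X.as) (Y := Y.as) f
    exact ⟨(toStable R).map g, hg⟩

instance : Δ.functor.EssSurj where
  mem_essImage Z := by
    have := Δ.essSurj
    exact ⟨(toStable R).obj (F.objPreimage Z), ⟨F.objObjPreimageIso Z⟩⟩

/-- The functor kills projective objects, so the middle term of the triangle is zero. For the chosen
conflations this gives the compatibility with the suspension. -/
lemma isIso_δ {T : ShortComplex E} (hT : R T) (h : projectives R T.X₂) : IsIso (Δ.δ hT) := by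
  refine (Triangle.isZero₂_iff_isIso₃ _ (Δ.distinguished hT)).1 ?_
  change IsZero (F.obj T.X₂)
  rw [IsZero.iff_id_eq_zero, ← F.map_id]
  exact Δ.map_eq_zero _ ⟨_, h, 𝟙 _, 𝟙 _, by simp⟩

instance (X : E) : IsIso (Δ.δ (cosyzygy_conflation R X)) :=
  Δ.isIso_δ _ (by
    rw [IsFrobenius.projectives_eq_injectives (S := R)]
    exact cosyzygy_injective R X)

/-- The connecting morphism of the chosen conflations, as an isomorphism. -/
def deltaIso (X : E) : F.obj (cosyzygy R X).X₃ ≅ (F.obj X)⟦(1 : ℤ)⟧ :=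
  asIso (Δ.δ (cosyzygy_conflation R X))

/-- The compatibility with the shifts of the functor induced on the stable category. -/
def shiftIso : suspension R ⋙ Δ.functor ≅ Δ.functor ⋙ shiftFunctor D (1 : ℤ) :=
  NatIso.ofComponents (fun X => Δ.deltaIso X.as) (fun {X Y} f => by
    obtain ⟨f, rfl⟩ := (toStable R).map_surjective f
    have h := Δ.naturality (cosyzygy_conflation R X.as) (cosyzygy_conflation R Y.as)
      (cosyzygyMap (S := R) f)
    rw [cosyzygyMap_τ₁] at h
    exact h)

/-- Naturality against the chosen conflation shows that `δ` agrees with the third map in the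
definition of the stable triangles. -/
lemma map_τ₃_comp_δ {T : ShortComplex E} (hT : R T) (φ : T ⟶ cosyzygy R T.X₁)
    (hφ : φ.τ₁ = 𝟙 T.X₁) : F.map φ.τ₃ ≫ Δ.δ (cosyzygy_conflation R T.X₁) = Δ.δ hT := by
  rw [Δ.naturality hT, hφ]
  exact (congrArg (_ ≫ ·) ((congrArg _ (F.map_id _)).trans
    (CategoryTheory.Functor.map_id _ _))).trans (Category.comp_id _)

lemma distinguished_of_isDistinguished {X Y Z : Stable R} {f : X ⟶ Y} {g : Y ⟶ Z}
    {h : Z ⟶ (suspension R).obj X} (H : IsDistinguished R f g h) :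
    Triangle.mk (Δ.functor.map f) (Δ.functor.map g)
      (Δ.functor.map h ≫ Δ.shiftIso.hom.app X) ∈ distTriang D := by
  obtain ⟨T, hT, φ, hφ, e₁, e₂, e₃, h₁, h₂, h₃⟩ := H
  refine isomorphic_distinguished _ (Δ.distinguished hT) _ (Triangle.isoMk _ _
    (Δ.functor.mapIso e₁) (Δ.functor.mapIso e₂) (Δ.functor.mapIso e₃) ?_ ?_ ?_)
  · exact (Δ.functor.map_comp _ _).symm.trans ((congrArg Δ.functor.map h₁).trans
      (Δ.functor.map_comp _ _))
  · exact (Δ.functor.map_comp _ _).symm.trans ((congrArg Δ.functor.map h₂).trans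
      (Δ.functor.map_comp _ _))
  · have hn : Δ.functor.map ((suspension R).map e₁.hom) ≫
        Δ.δ (cosyzygy_conflation R T.X₁) =
        Δ.shiftIso.hom.app X ≫ (Δ.functor.map e₁.hom)⟦(1 : ℤ)⟧' := Δ.shiftIso.hom.naturality e₁.hom
    have h₃' := (Δ.functor.map_comp _ _).symm.trans ((congrArg Δ.functor.map h₃).trans
      (Δ.functor.map_comp _ _))
    exact comp_assoc_paste h₃' hn (Δ.map_τ₃_comp_δ hT φ hφ)

/-- Adding an injective object does not change the class in the stable category. -/
def stableBiprodIso (Y : E) {I : E} (hI : projectives R I) :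
    (toStable R).obj Y ≅ (toStable R).obj (Y ⊞ I) where
  hom := (toStable R).map biprod.inl
  inv := (toStable R).map biprod.fst
  hom_inv_id := by rw [← Functor.map_comp, biprod.inl_fst, CategoryTheory.Functor.map_id]
  inv_hom_id := by
    rw [← Functor.map_comp, ← CategoryTheory.Functor.map_id]
    refine (CategoryTheory.Quotient.sound _ ⟨I, hI, biprod.snd, biprod.inr, ?_⟩).symm
    rw [← biprod.total, add_sub_cancel_left]

/-- Adding an injective hull replaces `f` by an inflation that is isomorphic to it in the stable
category. Its conflation has a distinguished image over the same first map, so the two triangles of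
`D` are isomorphic, and the isomorphism on third terms descends because the functor is fully
faithful. -/
lemma isDistinguished_of_distinguished {X Y Z : Stable R} {f : X ⟶ Y} {g : Y ⟶ Z}
    {h : Z ⟶ (suspension R).obj X}
    (H : Triangle.mk (Δ.functor.map f) (Δ.functor.map g)
      (Δ.functor.map h ≫ Δ.shiftIso.hom.app X) ∈ distTriang D) : IsDistinguished R f g h := by
  obtain ⟨f, rfl⟩ := (toStable R).map_surjective f
  obtain ⟨I, Q, i, q, w, hI, hi⟩ := IsFrobenius.enough_injectives (S := R) X.as
  obtain ⟨Z', p, w', hT⟩ := AdmissibleMono.biprod_lift (⟨_, _, _, hi⟩ : AdmissibleMono R i) f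
  obtain ⟨φ, hφ⟩ := exists_extension hT (cosyzygy_injective R X.as) (𝟙 X.as)
  have hI' : projectives R I := by rwa [IsFrobenius.projectives_eq_injectives (S := R)]
  let e₂ := stableBiprodIso Y.as hI'
  have h₁ : (toStable R).map f ≫ e₂.hom = (toStable R).map (biprod.lift f i) := by
    rw [← Iso.eq_comp_inv]
    exact (congrArg _ (biprod.lift_fst f i).symm).trans ((toStable R).map_comp _ _)
  have h₁' : F.map f ≫ Δ.functor.map e₂.hom = F.map (biprod.lift f i) :=
    (Δ.functor.map_comp _ _).symm.trans (congrArg Δ.functor.map h₁)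
  let t := isoTriangleOfIso₁₂ _ _ H (Δ.distinguished hT) (Iso.refl _) (Δ.functor.mapIso e₂)
    (h₁'.trans (Category.id_comp _).symm)
  let e₃ : Z ≅ (toStable R).obj Z' := Δ.functor.preimageIso (Triangle.π₃.mapIso t)
  have he₃ : Δ.functor.map e₃.hom = t.hom.hom₃ := Δ.functor.map_preimage _
  refine ⟨_, hT, φ, hφ, Iso.refl _, e₂, e₃, h₁.trans (Category.id_comp _).symm, ?_, ?_⟩
  · apply Δ.functor.map_injective
    rw [Functor.map_comp, he₃]
    exact t.hom.comm₂.trans (Δ.functor.map_comp e₂.hom ((toStable R).map p)).symm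
  · apply Δ.functor.map_injective
    refine (cancel_mono (Δ.δ (cosyzygy_conflation R X.as))).1 ?_
    have h₃ : Δ.functor.map h ≫ Δ.shiftIso.hom.app X = t.hom.hom₃ ≫ Δ.δ hT :=
      ((congrArg (_ ≫ ·) ((shiftFunctor D (1 : ℤ)).map_id (Δ.functor.obj X))).trans
        (Category.comp_id _)).symm.trans t.hom.comm₃
    have h₄ : Δ.functor.map (e₃.hom ≫ (toStable R).map φ.τ₃) = t.hom.hom₃ ≫ F.map φ.τ₃ :=
      (Δ.functor.map_comp e₃.hom ((toStable R).map φ.τ₃)).trans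
        (congrArg (· ≫ F.map φ.τ₃) he₃)
    have h₅ : h ≫ (suspension R).map (𝟙 X) = h :=
      (congrArg (h ≫ ·) (CategoryTheory.Functor.map_id _ _)).trans (Category.comp_id h)
    exact (congrArg (fun k => Δ.functor.map k ≫ Δ.shiftIso.hom.app X) h₅).trans
      (h₃.trans ((congrArg (· ≫ Δ.δ (cosyzygy_conflation R X.as)) h₄).trans
        ((Category.assoc _ _ _).trans
          (congrArg (t.hom.hom₃ ≫ ·) (Δ.map_τ₃_comp_δ hT φ hφ)))).symm)

/-- The triangle equivalence induced by a delta functor. -/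
def stableTriangleEquivalence : StableTriangleEquivalence R D where
  functor := Δ.functor
  isEquivalence := { }
  shiftIso := Δ.shiftIso
  distinguished_iff _ _ _ :=
    ⟨Δ.distinguished_of_isDistinguished, Δ.isDistinguished_of_distinguished⟩

end DeltaFunctor

end DeltaFunctor

/-! ### The delta functor defined by models of deflations. -/

section

variable {C : Type u} [Category.{v} C] [Preadditive C] [HasZeroObject C] [HasBinaryBiproducts C]
  (S : ObjectProperty (ShortComplex C)) [IsFrobenius S]

/-- The functor from the category of deflations to the Verdier quotient is a delta functor. -/
def toVerdierDelta : DeltaFunctor (morEpiConflations S) (toVerdier S) where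
  map_eq_zero := toVerdier_map_eq_zero
  stableRel_of_map_eq_zero := stableRel_of_toVerdier_map_eq_zero
  map_surjective := toVerdier_map_surjective
  essSurj := inferInstance
  δ := morDelta
  distinguished := morDelta_distinguished
  naturality := morDelta_naturality

end

end ExactCat

end

theorem mainTheorem7 {C : Type u} [Category.{v} C] [Preadditive C] [HasZeroObject C]
    [HasBinaryBiproducts C] (S : ObjectProperty (ShortComplex C)) [ExactCat.IsFrobenius S] :
    ∃ (_ : ExactCat.IsFrobenius (ExactCat.morEpiConflations S))
      (_ : (ExactCat.KInfB S).IsTriangulated),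
      (∀ α : ExactCat.MorEpi S, ExactCat.projectives (ExactCat.morEpiConflations S) α ↔
        ExactCat.projectives S α.obj.left ∧ ExactCat.projectives S α.obj.right) ∧
      Nonempty (ExactCat.StableTriangleEquivalence (ExactCat.morEpiConflations S)
        (ExactCat.KInfBModKBounded S)) :=
  ⟨inferInstance, inferInstance, ExactCat.morEpi_projectives_iff,
    ⟨(ExactCat.toVerdierDelta S).stableTriangleEquivalence⟩⟩
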